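/- Let $d\ge 0$, $T>0$, and let $a_\alpha:[0,T]\times\mathbb R^{d+1}\to\mathbb R$ be given for the multi-indices $\alpha\in\mathbb N_0^{d+1}$ with $|\alpha|\le 2$, such that $a_\alpha(t,\cdot)$ is $C^\infty$ for each $t$. Let $\bar z:[0,T]\to\mathbb R^{d+1}$ be continuous and suppose that $t\mapsto \partial_z^\eta a_\alpha(t,\bar z(t))$ is continuous on $[0,T]$ for all $|\alpha|\le2$ and all $\eta$. For $n\ge0$ put $$a_{\alpha,n}(t,z)=\sum_{|\eta|=n}\frac{1}{\eta!}(z-\bar z(t))^\eta\,\partial_z^\eta a_\alpha(t,\bar z(t)),\qquad \mathcal A_n(t)=\sum_{|\alpha|\le 2}a_{\alpha,n}(t,z)\,\partial_z^\alpha .$$ Let $m(s)$ be the vector with entries $m_j(s)=a_{e_j,0}(s)$, let $A(s)$ be the symmetric matrix with entries $A_{jj}(s)=2a_{2e_j,0}(s)$ and $A_{jl}(s)=a_{e_j+e_l,0}(s)$ for $j\ne l$, and put $\mathbf m(t,s)=\int_t^s m(r)\,dr$, $\mathbf C(t,s)=\int_t^s A(r)\,dr$. Assume that $\mathbf C(t,s)$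 is positive definite whenever $0\le t<s\le T$. A classical solution below is a real function on $[0,T]\times\mathbb R^{d+1}$ that is continuous, satisfies a bound $|w(t,z)|\le Ke^{c|z|}$ there, is $C^2$ in $z$ for each $0\le t<T$, is differentiable in $t$ for $0\le t<T$ (from the right at $t=0$), and satisfies the equation for $0\le t<T$ and the terminal condition at $T$. Let $v_0$ be a classical solution of $$(\partial_t+\mathcal A_0(t))v_0=0,\qquad v_0(T,\cdot)=\phi ,$$ and consider for $n\ge1$ the problems $$(\partial_t+\mathcal A_0(t))v_n+\sum_{k=1}^n\mathcal A_k(t)v_{n-k}=0,\qquad v_n(T,\cdot)=0. \qquad (*)$$ For $n\ge 1$ define $$\mathcal L_n(t,T)=\sum_{k=1}^n\ \sum_{i\in I_{n,k}}\int_t^T dt_1\int_{t_1}^T dt_2\cdots\int_{t_{k-1}}^T dt_k\ \mathcal G_{i_1}(t,t_1)\,\mathcal G_{i_2}(t,t_2)\cdots\mathcal G_{i_k}(t,t_k),$$ where $I_{n,k}$ is the set of $k$-tuples $(i_1,\dots,i_k)$ of positive integers with $i_1+\dots+i_k=n$, and $$\mathcal G_i(t,s)=\sum_{|\alpha|\le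 2}a_{\alpha,i}(s,\mathcal Z(t,s))\,\partial_z^\alpha,\qquad \mathcal Z(t,s)=z+\mathbf m(t,s)+\mathbf C(t,s)\nabla_z ;$$ here the components of $\mathcal Z(t,s)$, which commute on smooth functions, are substituted into the polynomial $a_{\alpha,i}(s,\cdot)$. Then: 1. $v_0(t,\cdot)$ is $C^\infty$ for $0\le t<T$. 2. For $n\ge1$ and $0\le t<T$, $\mathcal L_n(t,T)$ is, on $C^\infty(\mathbb R^{d+1})$, a linear differential operator of finite order with smooth coefficients. 3. With $\mathcal L_k(t,T)v_0(t,\cdot)$ in place of $v_k$ for every $k\ge 1$, the differential equations in $(*)$ hold for all $n\ge1$, $0\le t<T$ and $z\in\mathbb R^{d+1}$. 4. If $n\ge1$ and $v_1,\dots,v_n$ are classical solutions of $(*)$ for the orders $1,\dots,n$, then $$v_n(t,z)=\mathcal L_n(t,T)\,v_0(t,z)\qquad\text{for all } 0\le t<T,\ z\in\mathbb R^{d+1}.$$ -/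

import Mathlib

open Set
open scoped ContDiff

noncomputable section

namespace PolyExpansion

/-- The state space `ℝ^{d+1}` of `z = (x, y₁, …, y_d)`. -/
abbrev Space (d : ℕ) : Type := Fin (d + 1) → ℝ

/-- Multi-indices `α = (α₁, …, α_{d+1})`. -/
abbrev MultiIndex (d : ℕ) : Type := Fin (d + 1) → ℕ

/-- Operators acting on real functions of `z`. -/
abbrev Op (d : ℕ) : Type := (Space d → ℝ) → (Space d → ℝ)

variable {d : ℕ}

/-- The multi-indices `α` with `|α| = n`. -/
def indicesOfOrder (d n : ℕ) : Finset (MultiIndex d) :=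
  Finset.piAntidiag Finset.univ n

/-- The multi-indices `α` with `|α| ≤ 2`. -/
def indicesLeTwo (d : ℕ) : Finset (MultiIndex d) :=
  (Finset.range 3).biUnion (indicesOfOrder d)

/-- The factorial `α! = ∏ⱼ αⱼ!`. -/
def multiFactorial (α : MultiIndex d) : ℕ := ∏ j, (α j).factorial

/-- The ordered composition `B₁^{α₁} ∘ B₂^{α₂} ∘ ⋯ ∘ B_{d+1}^{α_{d+1}}` of powers of operators. -/
def opMonomial (B : Fin (d + 1) → Op d) (α : MultiIndex d) : Op d := fun f =>
  (List.finRange (d + 1)).foldr (fun j g => (B j)^[α j] g) f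

/-- The partial derivative `∂_{z_j}`. -/
def partialDeriv (j : Fin (d + 1)) : Op d := fun f z => fderiv ℝ f z (Pi.single j 1)

/-- The partial derivative `∂_z^α`. -/
def multiDeriv (α : MultiIndex d) : Op d := opMonomial partialDeriv α

/-- `a_{α,n}(t,z) = ∑_{|η| = n} (1/η!) (z - z̄(t))^η ∂_z^η a_α(t, z̄(t))`. -/
def taylorCoeff (a : MultiIndex d → ℝ → Space d → ℝ) (zbar : ℝ → Space d)
    (α : MultiIndex d) (n : ℕ) (t : ℝ) (z : Space d) : ℝ :=
  ∑ η ∈ indicesOfOrder d n,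
    (1 / (multiFactorial η : ℝ)) * (∏ j, (z j - zbar t j) ^ η j) *
      multiDeriv η (a α t) (zbar t)

/-- `𝒜_n(t) = ∑_{|α| ≤ 2} a_{α,n}(t,z) ∂_z^α`. -/
def generatorTerm (a : MultiIndex d → ℝ → Space d → ℝ) (zbar : ℝ → Space d)
    (n : ℕ) (t : ℝ) : Op d := fun f z =>
  ∑ α ∈ indicesLeTwo d, taylorCoeff a zbar α n t z * multiDeriv α f z

/-- The instantaneous drift vector `m(s)`, with entries `a_{e_j,0}(s) = a_{e_j}(s, z̄(s))`. -/
def driftVec (a : MultiIndex d → ℝ → Space d → ℝ) (zbar : ℝ → Space d) (s : ℝ) : Space d :=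
  fun j => a (Pi.single j 1) s (zbar s)

/-- The instantaneous covariance matrix `A(s)`: `2 a_{2e_j,0}(s)` on the diagonal and
`a_{e_j+e_l,0}(s)` off the diagonal. -/
def covMatrix (a : MultiIndex d → ℝ → Space d → ℝ) (zbar : ℝ → Space d) (s : ℝ) :
    Matrix (Fin (d + 1)) (Fin (d + 1)) ℝ :=
  Matrix.of fun j l =>
    (if j = l then 2 else 1) * a (Pi.single j 1 + Pi.single l 1) s (zbar s)

/-- `𝐦(t,s) = ∫_t^s m(r) dr`. -/
def meanInt (a : MultiIndex d → ℝ → Space d → ℝ) (zbar : ℝ → Space d) (t s : ℝ) : Space d :=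
  fun j => ∫ r in t..s, driftVec a zbar r j

/-- `𝐂(t,s) = ∫_t^s A(r) dr`. -/
def covInt (a : MultiIndex d → ℝ → Space d → ℝ) (zbar : ℝ → Space d) (t s : ℝ) :
    Matrix (Fin (d + 1)) (Fin (d + 1)) ℝ :=
  Matrix.of fun j l => ∫ r in t..s, covMatrix a zbar r j l

/-- The `j`-th component of `𝒵(t,s) - z̄(s)`, where `𝒵(t,s) = z + 𝐦(t,s) + 𝐂(t,s) ∇_z`. -/
def centeredZ (a : MultiIndex d → ℝ → Space d → ℝ) (zbar : ℝ → Space d) (t s : ℝ)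
    (j : Fin (d + 1)) : Op d := fun f z =>
  (z j + meanInt a zbar t s j) * f z + (∑ l, covInt a zbar t s j l * partialDeriv l f z)
    - zbar s j * f z

/-- The operator `a_{α,n}(s, 𝒵(t,s))`: the polynomial `a_{α,n}(s, ·)` with the components of
`𝒵(t,s)` substituted for those of `z`. On smooth functions these components commute with each
other, because `𝐂(t,s)` is symmetric, so the order of the factors is immaterial. -/
def taylorOp (a : MultiIndex d → ℝ → Space d → ℝ) (zbar : ℝ → Space d)
    (α : MultiIndex d) (n : ℕ) (t s : ℝ) : Op d := fun f z =>
  ∑ η ∈ indicesOfOrder d n,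
    (1 / (multiFactorial η : ℝ)) * multiDeriv η (a α s) (zbar s) *
      opMonomial (centeredZ a zbar t s) η f z

/-- `𝒢_n(t,s) = ∑_{|α| ≤ 2} a_{α,n}(s, 𝒵(t,s)) ∂_z^α`. -/
def gOp (a : MultiIndex d → ℝ → Space d → ℝ) (zbar : ℝ → Space d)
    (n : ℕ) (t s : ℝ) : Op d := fun f z =>
  ∑ α ∈ indicesLeTwo d, taylorOp a zbar α n t s (multiDeriv α f) z

/-- `I_{n,k}`: the `k`-tuples of positive integers with sum `n`. -/
def compositions (n k : ℕ) : Finset (Fin k → ℕ) :=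
  (Finset.piAntidiag Finset.univ n).filter fun i => ∀ j, 1 ≤ i j

/-- `𝒢_{i₁}(t,t₁) ∘ 𝒢_{i₂}(t,t₂) ∘ ⋯ ∘ 𝒢_{i_k}(t,t_k)`. -/
def gProd (a : MultiIndex d → ℝ → Space d → ℝ) (zbar : ℝ → Space d) {k : ℕ}
    (i : Fin k → ℕ) (t : ℝ) (τ : Fin k → ℝ) : Op d := fun f =>
  (List.finRange k).foldr (fun j g => gOp a zbar (i j) t (τ j) g) f

/-- `∫_t^T dt₁ ∫_{t₁}^T dt₂ ⋯ ∫_{t_{k-1}}^T dt_k F(t₁, …, t_k)`. -/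
def iteratedIntegral (T : ℝ) : (k : ℕ) → ℝ → ((Fin k → ℝ) → ℝ) → ℝ
  | 0, _, F => F Fin.elim0
  | k + 1, t, F => ∫ s in t..T, iteratedIntegral T k s fun τ => F (Fin.cons s τ)

/-- `𝓛_n(t,T)`. -/
def lOp (a : MultiIndex d → ℝ → Space d → ℝ) (zbar : ℝ → Space d)
    (n : ℕ) (t T : ℝ) : Op d := fun f z =>
  ∑ k ∈ Finset.Icc 1 n, ∑ i ∈ compositions n k,
    iteratedIntegral T k t fun τ => gProd a zbar i t τ f z

/-- `L` is, on smooth functions, a linear differential operator of finite order with smooth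
coefficients. -/
def IsLinearDiffOp (L : Op d) : Prop :=
  ∃ (B : Finset (MultiIndex d)) (c : MultiIndex d → Space d → ℝ),
    (∀ β ∈ B, ContDiff ℝ ∞ (c β)) ∧
    ∀ f : Space d → ℝ, ContDiff ℝ ∞ f → ∀ z, L f z = ∑ β ∈ B, c β z * multiDeriv β f z

/-- `w` satisfies `(∂_t + A(t)) w(t,·) + h(t,·) = 0` pointwise for `0 ≤ t < T`
(the time derivative at `t = 0` is the right derivative). -/
def SolvesPDE (T : ℝ) (A : ℝ → Op d) (h w : ℝ → Space d → ℝ) : Prop :=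
  ∀ t ∈ Ico 0 T, ∀ z,
    HasDerivWithinAt (fun s => w s z) (-(A t (w t) z + h t z)) (Icc 0 T) t

/-- `w` is a classical solution, of at most exponential growth in `z` uniformly in `t`, of the
terminal value problem `(∂_t + A(t)) w(t,·) + h(t,·) = 0` for `0 ≤ t < T`, `w(T,·) = g`. -/
structure IsClassicalSolution (T : ℝ) (A : ℝ → Op d) (h : ℝ → Space d → ℝ) (g : Space d → ℝ)
    (w : ℝ → Space d → ℝ) : Prop where
  continuousOn : ContinuousOn (fun p : ℝ × Space d => w p.1 p.2) (Icc 0 T ×ˢ univ)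
  contDiff : ∀ t ∈ Ico 0 T, ContDiff ℝ 2 (w t)
  growth : ∃ K c : ℝ, ∀ t ∈ Icc 0 T, ∀ z, |w t z| ≤ K * Real.exp (c * ‖z‖)
  pde : SolvesPDE T A h w
  terminal : w T = g

/-- The source term `∑_{k=1}^n 𝒜_k(t) v_{n-k}(t,·)` of the `n`-th order equation. -/
def sourceTerm (a : MultiIndex d → ℝ → Space d → ℝ) (zbar : ℝ → Space d)
    (v : ℕ → ℝ → Space d → ℝ) (n : ℕ) (t : ℝ) (z : Space d) : ℝ :=
  ∑ k ∈ Finset.Icc 1 n, generatorTerm a zbar k t (v (n - k) t) z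

/-- `v₀` for `n = 0`, and `𝓛_n(t,T) v₀(t,·)` for `n ≥ 1`. -/
def expansionTerm (a : MultiIndex d → ℝ → Space d → ℝ) (zbar : ℝ → Space d) (T : ℝ)
    (v₀ : ℝ → Space d → ℝ) (n : ℕ) (t : ℝ) : Space d → ℝ :=
  if n = 0 then v₀ t else lOp a zbar n t T (v₀ t)

end PolyExpansion

end

noncomputable section

namespace PolyExpansion

variable {d : ℕ}

/-! ### The algebra of smooth functions and its differential operators -/

/-! The order-zero operator `𝒜_0(t)` (`gen`) has coefficients depending on time only. Hence every
`∂_j` commutes with `∂_t + gen`, and so does `X_j(t) = z_j - ∫_0^t m_j - ∑_l (∫_0^t A_{jl}) ∂_l`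
(`shiftOp`), because the commutator of `gen` with `z_j` is `m_j + ∑_l A_{jl} ∂_l`, which is `-∂_t
X_j`. The algebra `flowAlg` generated by these operators therefore maps solutions of the homogeneous
equation to solutions (`IsRegularSol.flowAlg`). Since `𝒵_j(t,s) = X_j(t) + ∫_0^s m_j + ∑_l (∫_0^s
A_{jl}) ∂_l`, each product of operators `𝒢_i` is a finite sum of scalars depending on the
integration times multiplied by elements of `flowAlg` at time `t` (`IsSeparable`). The iterated
integrals act on the scalars alone.

Differentiating `𝓛_n(t,T) v_0` along a solution, only the outer lower limit contributes besides
`-gen`. It produces `-∑_m 𝒢_m(t,t) 𝓛_{n-m}(t,T) v_0`, and `𝒢_m(t,t) = 𝒜_m(t)` because the integrals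
in `𝒵(t,t)` are empty. This is the hierarchy (`hasDerivAt_smL`, `IsFreezing.generatorTerm_coe`).
Writing elements of the Weyl algebra in normal form shows that `𝓛_n` is a differential operator.

Smoothness of `v_0` is obtained without a heat kernel. Cosine terminal data have explicit solutions
(`wave`). For a combination `u` of these, `u² + ∑ C_{jl}(t,t₁) ∂_j u ∂_l u` is a subsolution equal
to `u²` at time `t₁`, so the maximum principle bounds the gradient before `t₁` by the values at
`t₁`; iteration bounds all derivatives (`exists_smMultiDeriv_sq_le`). Trigonometric polynomials
approximate `v_0(T,·)` in a weighted sup norm (`exists_trigPoly_near`), so the corresponding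
solutions converge with all derivatives before `T`, and the maximum principle identifies the limit
with `v_0` (`exists_isRegularSol_eq`).

Uniqueness cannot compare `v_n` with `𝓛_n(t,T) v_0` at time `T` directly, as the derivatives of
`v_0` are not controlled there. Instead, for `T' < T`, the operator `𝓛_n` with its integrals started
at the fixed time `T'` gives a homogeneous solution. Adding it to the difference yields a
homogeneous solution on `[0,T']` with terminal value `v_n(T',·)`, which is small in a weighted norm.
Letting `T'` tend to `T` removes the correction (`eq_smL_of_isClassicalSolution`). -/

theorem contDiff_partialDeriv {m n : WithTop ℕ∞} {f : Space d → ℝ} (hf : ContDiff ℝ n f)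
    (hmn : m + 1 ≤ n) (j : Fin (d + 1)) : ContDiff ℝ m (partialDeriv j f) :=
  (hf.fderiv_right hmn).clm_apply contDiff_const

theorem partialDeriv_partialDeriv {f : Space d → ℝ} (hf : ContDiff ℝ 2 f) (i j : Fin (d + 1))
    (z : Space d) : partialDeriv i (partialDeriv j f) z =
      fderiv ℝ (fderiv ℝ f) z (Pi.single i 1) (Pi.single j 1) := by
  have h1 : HasFDerivAt (fderiv ℝ f) (fderiv ℝ (fderiv ℝ f) z) z :=
    (((hf.fderiv_right (m := 1) (by norm_num)).differentiable (by norm_num)) z).hasFDerivAt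
  have h2 := h1.clm_apply (hasFDerivAt_const (Pi.single j (1 : ℝ) : Space d) z)
  change fderiv ℝ (fun y => fderiv ℝ f y (Pi.single j 1)) z (Pi.single i 1) = _
  rw [h2.fderiv]
  simp

theorem partialDeriv_comm {f : Space d → ℝ} (hf : ContDiff ℝ 2 f) (i j : Fin (d + 1)) :
    partialDeriv i (partialDeriv j f) = partialDeriv j (partialDeriv i f) := by
  ext z
  rw [partialDeriv_partialDeriv hf, partialDeriv_partialDeriv hf]
  exact (hf.contDiffAt.isSymmSndFDerivAt (by simp)) _ _

/-- The algebra of smooth real functions of `z`. -/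
def smoothAlg (d : ℕ) : Subalgebra ℝ (Space d → ℝ) where
  carrier := {f | ContDiff ℝ ∞ f}
  mul_mem' {_ _} (hf : ContDiff ℝ ∞ _) (hg : ContDiff ℝ ∞ _) := hf.mul hg
  add_mem' {_ _} (hf : ContDiff ℝ ∞ _) (hg : ContDiff ℝ ∞ _) := hf.add hg
  algebraMap_mem' r := show ContDiff ℝ ∞ fun _ => r from contDiff_const

theorem mem_smoothAlg {f : Space d → ℝ} : f ∈ smoothAlg d ↔ ContDiff ℝ ∞ f := Iff.rfl

/-- Smooth real functions of `z`. -/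
abbrev Sm (d : ℕ) : Type := smoothAlg d

/-- Linear operators on smooth functions. -/
abbrev SmOp (d : ℕ) : Type := Module.End ℝ (Sm d)

theorem Sm.contDiff (f : Sm d) : ContDiff ℝ ∞ (f : Space d → ℝ) := f.2

theorem Sm.differentiable (f : Sm d) : Differentiable ℝ (f : Space d → ℝ) :=
  f.contDiff.differentiable (by simp)

theorem Sm.contDiff_two (f : Sm d) : ContDiff ℝ 2 (f : Space d → ℝ) :=
  f.contDiff.of_le (WithTop.coe_le_coe.2 le_top)

/-- The partial derivative `∂_{z_j}` on smooth functions. -/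
def smDeriv (j : Fin (d + 1)) : SmOp d where
  toFun f := ⟨partialDeriv j f,
    mem_smoothAlg.2 (contDiff_partialDeriv (m := ∞) f.contDiff (by simp) j)⟩
  map_add' f g := by
    ext z
    simp only [partialDeriv, Subalgebra.coe_add, Pi.add_apply]
    rw [fderiv_add (f.differentiable z) (g.differentiable z)]
    rfl
  map_smul' c f := by
    ext z
    simp only [partialDeriv, Subalgebra.coe_smul, Pi.smul_apply, RingHom.id_apply]
    rw [fderiv_const_smul (f.differentiable z)]
    rfl

theorem coe_smDeriv (j : Fin (d + 1)) (f : Sm d) :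
    (smDeriv j f : Space d → ℝ) = partialDeriv j f := rfl

/-- The coordinate function `z_j`. -/
def coordFn (j : Fin (d + 1)) : Sm d := ⟨fun z => z j, mem_smoothAlg.2 (contDiff_apply _ _ j)⟩

@[simp] theorem coordFn_apply (j : Fin (d + 1)) (z : Space d) :
    (coordFn j : Space d → ℝ) z = z j := rfl

/-- Multiplication by a smooth function. -/
abbrev mulOp (g : Sm d) : SmOp d := LinearMap.mulLeft ℝ g

/-- Multiplication by `z_j`. -/
abbrev coordOp (j : Fin (d + 1)) : SmOp d := mulOp (coordFn j)

@[simp] theorem Sm.coe_sum {ι : Type*} (s : Finset ι) (f : ι → Sm d) (z : Space d) :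
    ((∑ i ∈ s, f i : Sm d) : Space d → ℝ) z = ∑ i ∈ s, (f i : Space d → ℝ) z := by
  rw [AddSubmonoidClass.coe_finsetSum, Finset.sum_apply]

theorem smDeriv_mul (j : Fin (d + 1)) (f g : Sm d) :
    smDeriv j (f * g) = f * smDeriv j g + g * smDeriv j f := by
  ext z
  simp only [coe_smDeriv, partialDeriv, Subalgebra.coe_mul, Subalgebra.coe_add, Pi.add_apply,
    Pi.mul_apply]
  rw [fderiv_mul (f.differentiable z) (g.differentiable z)]
  simp

theorem smDeriv_mul_mulOp (j : Fin (d + 1)) (g : Sm d) :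
    smDeriv j * mulOp g = mulOp g * smDeriv j + mulOp (smDeriv j g) := by
  ext1 f
  simp only [Module.End.mul_apply, LinearMap.add_apply, LinearMap.mulLeft_apply, smDeriv_mul]
  rw [mul_comm f]

theorem smDeriv_comm (i j : Fin (d + 1)) :
    (smDeriv i * smDeriv j : SmOp d) = smDeriv j * smDeriv i := by
  ext1 f
  exact Subtype.ext (partialDeriv_comm f.contDiff_two i j)

theorem smDeriv_coordFn (i j : Fin (d + 1)) :
    smDeriv i (coordFn j : Sm d) = if i = j then 1 else 0 := by
  ext z
  have : HasFDerivAt (fun z : Space d => z j) (ContinuousLinearMap.proj (R := ℝ) j) z :=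
    hasFDerivAt_apply j z
  simp only [coe_smDeriv, partialDeriv, coordFn]
  rw [this.fderiv]
  by_cases h : i = j
  · subst h; simp
  · simp [h]

theorem smDeriv_mul_coordOp (i j : Fin (d + 1)) :
    (smDeriv i * coordOp j : SmOp d) = coordOp j * smDeriv i + if i = j then 1 else 0 := by
  rw [coordOp, smDeriv_mul_mulOp, smDeriv_coordFn]
  split_ifs
  · ext1 f; simp
  · ext1 f; simp

theorem smDeriv_one (j : Fin (d + 1)) : smDeriv j (1 : Sm d) = 0 := by
  ext z
  simp only [coe_smDeriv, partialDeriv]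
  have : ((1 : Sm d) : Space d → ℝ) = fun _ => 1 := rfl
  rw [this]; simp

/-- The ordered product `b₁^{β₁} ⋯ b_{d+1}^{β_{d+1}}`. -/
def ordPow {R : Type*} [Monoid R] (b : Fin (d + 1) → R) (β : MultiIndex d) : R :=
  ((List.finRange (d + 1)).map fun j => b j ^ β j).prod

/-- The derivative `∂_z^β` on smooth functions. -/
abbrev smMultiDeriv (β : MultiIndex d) : SmOp d := ordPow smDeriv β

theorem coe_iterate_of_coe {B : Op d} {b : SmOp d}
    (h : ∀ f : Sm d, B f = (b f : Space d → ℝ)) (n : ℕ) (f : Sm d) :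
    B^[n] f = ((b ^ n) f : Space d → ℝ) := by
  induction n generalizing f with
  | zero => rfl
  | succ n ih => rw [Function.iterate_succ_apply, h, ih, pow_succ]; rfl

/-- The bridge from operators on arbitrary functions, for which linearity and commutation can fail,
to the ring of endomorphisms of smooth functions. -/
theorem opMonomial_coe {B : Fin (d + 1) → Op d} {b : Fin (d + 1) → SmOp d}
    (h : ∀ j, ∀ f : Sm d, B j f = (b j f : Space d → ℝ)) (η : MultiIndex d) (f : Sm d) :
    opMonomial B η f = (ordPow b η f : Space d → ℝ) := by
  unfold opMonomial ordPow
  induction List.finRange (d + 1) with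
  | nil => rfl
  | cons j l ih =>
    rw [List.foldr_cons, ih, coe_iterate_of_coe (h j), List.map_cons, List.prod_cons]
    rfl

theorem multiDeriv_coe (β : MultiIndex d) (f : Sm d) :
    multiDeriv β f = (smMultiDeriv β f : Space d → ℝ) :=
  opMonomial_coe (fun _ _ => rfl) β f

theorem ordPow_zero {R : Type*} [Monoid R] (b : Fin (d + 1) → R) :
    ordPow b (0 : MultiIndex d) = 1 := by
  simp [ordPow]

/-- The list has no repetition, so the extra factor occurs at most once and can be commuted to the
front. The conditional on membership lets the induction run over partial lists. -/
theorem prod_map_pow_add_single {ι R : Type*} [DecidableEq ι] [Monoid R] (b : ι → R)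
    (hb : ∀ i j, Commute (b i) (b j)) (β : ι → ℕ) (j : ι) (l : List ι) (hl : l.Nodup) :
    (l.map fun i => b i ^ (β + Pi.single j 1 : ι → ℕ) i).prod =
      (if j ∈ l then b j else 1) * (l.map fun i => b i ^ β i).prod := by
  induction l with
  | nil => simp
  | cons i l ih =>
    obtain ⟨hi, hl⟩ := List.nodup_cons.1 hl
    simp only [List.map_cons, List.prod_cons, ih hl, List.mem_cons]
    by_cases hij : j = i
    · subst hij
      simp [hi, pow_succ', mul_assoc]
    · have hc : Commute (b i ^ β i) (b j) := (hb i j).pow_left _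
      by_cases hjl : j ∈ l
      · simp [hij, hjl, ← mul_assoc, hc.eq]
      · simp [hij, hjl]

theorem ordPow_add_single {R : Type*} [Monoid R] {b : Fin (d + 1) → R}
    (hb : ∀ i j, Commute (b i) (b j)) (β : MultiIndex d) (j : Fin (d + 1)) :
    ordPow b (β + Pi.single j 1) = b j * ordPow b β := by
  have := prod_map_pow_add_single b hb β j (List.finRange (d + 1)) (List.nodup_finRange _)
  simpa [ordPow] using this

theorem smMultiDeriv_add_single (β : MultiIndex d) (j : Fin (d + 1)) :
    (smMultiDeriv (β + Pi.single j 1) : SmOp d) = smDeriv j * smMultiDeriv β :=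
  ordPow_add_single (fun i j => smDeriv_comm i j) β j

/-- Induction on a multi-index, adding one derivative at a time. -/
theorem MultiIndex.induction {p : MultiIndex d → Prop} (h0 : p 0)
    (h1 : ∀ β j, p β → p (β + Pi.single j 1)) (β : MultiIndex d) : p β := by
  induction hn : ∑ j, β j generalizing β with
  | zero =>
    have : β = 0 := by
      ext j
      exact (Finset.sum_eq_zero_iff.1 hn) j (Finset.mem_univ j)
    rwa [this]
  | succ n ih =>
    obtain ⟨j, hj⟩ : ∃ j, β j ≠ 0 := by
      by_contra! h
      simp [h] at hn
    have hβ : β = (β - Pi.single j 1) + Pi.single j 1 := by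
      ext i
      by_cases hij : i = j
      · subst hij; simp; omega
      · simp [hij]
    rw [hβ]
    apply h1
    apply ih
    have h2 : ∑ i, β i = ∑ i, ((β - Pi.single j 1) + Pi.single j 1 : MultiIndex d) i := by rw [← hβ]
    simp only [Pi.add_apply, Finset.sum_add_distrib, Finset.sum_pi_single', Finset.mem_univ,
      if_true] at h2
    rw [hn] at h2
    omega

/-! ### Second order operators with space-independent coefficients -/

/-- Continuous, space-independent coefficients of a second order operator: a rate, a drift vector
and a positive semidefinite diffusion matrix. -/
structure FrozenCoeff (d : ℕ) where
  rate : ℝ → ℝ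
  drift : ℝ → Space d
  cov : ℝ → Matrix (Fin (d + 1)) (Fin (d + 1)) ℝ
  continuous_rate : Continuous rate
  continuous_drift : ∀ j, Continuous fun t => drift t j
  continuous_cov : ∀ j l, Continuous fun t => cov t j l
  posSemidef_cov : ∀ t, (cov t).PosSemidef

/-- The operator `rate + drift · ∇ + (1/2) tr (cov ∇²)`. -/
def genFn (q : FrozenCoeff d) (t : ℝ) (f : Space d → ℝ) (z : Space d) : ℝ :=
  q.rate t * f z + ∑ j, q.drift t j * partialDeriv j f z +
    (1 / 2) * ∑ j, ∑ l, q.cov t j l * partialDeriv j (partialDeriv l f) z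

theorem partialDeriv_add {f g : Space d → ℝ} (hf : ContDiff ℝ 1 f) (hg : ContDiff ℝ 1 g)
    (j : Fin (d + 1)) : partialDeriv j (f + g) = partialDeriv j f + partialDeriv j g := by
  ext z
  simp only [partialDeriv, Pi.add_apply]
  rw [fderiv_add (hf.differentiable (by norm_num) z) (hg.differentiable (by norm_num) z)]
  rfl

theorem partialDeriv_smul {f : Space d → ℝ} (hf : ContDiff ℝ 1 f) (c : ℝ)
    (j : Fin (d + 1)) : partialDeriv j (c • f) = c • partialDeriv j f := by
  ext z
  simp only [partialDeriv, Pi.smul_apply]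
  rw [fderiv_const_smul (hf.differentiable (by norm_num) z)]
  rfl

theorem genFn_add (q : FrozenCoeff d) (t : ℝ) {f g : Space d → ℝ} (hf : ContDiff ℝ 2 f)
    (hg : ContDiff ℝ 2 g) (z : Space d) :
    genFn q t (f + g) z = genFn q t f z + genFn q t g z := by
  have h1 := partialDeriv_add (hf.of_le one_le_two) (hg.of_le one_le_two)
  have h2 : ∀ j l, partialDeriv j (partialDeriv l (f + g)) =
      partialDeriv j (partialDeriv l f) + partialDeriv j (partialDeriv l g) := fun j l => by
    rw [h1, partialDeriv_add (contDiff_partialDeriv hf (by norm_num) l)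
      (contDiff_partialDeriv hg (by norm_num) l)]
  simp only [genFn, h2]
  simp only [h1, Pi.add_apply, mul_add, Finset.sum_add_distrib]
  ring

theorem genFn_smul (q : FrozenCoeff d) (t c : ℝ) {f : Space d → ℝ} (hf : ContDiff ℝ 2 f)
    (z : Space d) : genFn q t (c • f) z = c * genFn q t f z := by
  have h1 := partialDeriv_smul (hf.of_le one_le_two) c
  have h2 : ∀ j l, partialDeriv j (partialDeriv l (c • f)) =
      c • partialDeriv j (partialDeriv l f) := fun j l => by
    rw [h1, partialDeriv_smul (contDiff_partialDeriv hf (by norm_num) l)]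
  simp only [genFn, h2]
  simp only [h1, Pi.smul_apply, smul_eq_mul, mul_left_comm _ c, ← Finset.mul_sum]
  ring

/-- The Frobenius product of two positive semidefinite matrices is nonnegative. -/
theorem sum_mul_nonneg_of_posSemidef {n : Type*} [Fintype n] {A H : Matrix n n ℝ}
    (hA : A.PosSemidef) (hH : H.PosSemidef) : 0 ≤ ∑ j, ∑ l, A j l * H j l := by
  -- By the Schur product theorem the entrywise product is positive semidefinite; its quadratic form
  -- at the all-ones vector is the sum in question.
  have h := (hA.hadamard hH).dotProduct_mulVec_nonneg (fun _ => 1)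
  simpa [dotProduct, Matrix.mulVec, Matrix.hadamard] using h

/-! ### Second order conditions at a maximum, and the maximum principle. -/

theorem deriv_deriv_line {f : Space d → ℝ} (hf : ContDiff ℝ 2 f) (z h : Space d) :
    (∀ s : ℝ, HasDerivAt (fun s : ℝ => f (z + s • h)) (fderiv ℝ f (z + s • h) h) s) ∧
    HasDerivAt (fun s : ℝ => fderiv ℝ f (z + s • h) h) (fderiv ℝ (fderiv ℝ f) z h h) 0 := by
  have hl : ∀ s : ℝ, HasDerivAt (fun s : ℝ => z + s • h) h s := fun s => by
    simpa using ((hasDerivAt_id s).smul_const h).const_add z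
  refine ⟨fun s => ?_, ?_⟩
  · have h1 : HasFDerivAt f (fderiv ℝ f (z + s • h)) (z + s • h) :=
      (hf.differentiable (by norm_num) _).hasFDerivAt
    exact h1.comp_hasDerivAt s (hl s)
  · have h1 : HasFDerivAt (fderiv ℝ f) (fderiv ℝ (fderiv ℝ f) (z + (0 : ℝ) • h))
        (z + (0 : ℝ) • h) :=
      (((hf.fderiv_right (m := 1) (by norm_num)).differentiable (by norm_num)) _).hasFDerivAt
    have h2 : HasDerivAt (fun s : ℝ => fderiv ℝ f (z + s • h))
        (fderiv ℝ (fderiv ℝ f) (z + (0 : ℝ) • h) h) 0 := h1.comp_hasDerivAt (0 : ℝ) (hl 0)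
    have h3 := h2.clm_apply (hasDerivAt_const (0 : ℝ) h)
    rw [zero_smul, add_zero, map_zero, add_zero] at h3
    exact h3

/-- A positive second derivative along a line would make the point a local minimum on that line.
Being also a maximum, the function would be locally constant there, with vanishing second
derivative. -/
theorem fderiv_fderiv_nonpos_of_isMax {f : Space d → ℝ} (hf : ContDiff ℝ 2 f) {z : Space d}
    (hz : ∀ y, f y ≤ f z) (h : Space d) : fderiv ℝ (fderiv ℝ f) z h h ≤ 0 := by
  by_contra! hpos
  obtain ⟨h1, h2⟩ := deriv_deriv_line hf z h
  have hd : deriv (fun s : ℝ => f (z + s • h)) = fun s => fderiv ℝ f (z + s • h) h :=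
    funext fun s => (h1 s).deriv
  have hmax : IsLocalMax (fun s : ℝ => f (z + s • h)) 0 :=
    Filter.Eventually.of_forall fun s => by simpa using hz (z + s • h)
  have hmin : IsLocalMin (fun s : ℝ => f (z + s • h)) 0 := by
    apply isLocalMin_of_deriv_deriv_pos
    · rw [hd, h2.deriv]; exact hpos
    · exact hmax.deriv_eq_zero
    · exact (h1 0).continuousAt
  have hconst : (fun s : ℝ => f (z + s • h)) =ᶠ[nhds 0] fun _ => f (z + (0 : ℝ) • h) := by
    filter_upwards [hmax, hmin] with s hs1 hs2 using le_antisymm hs1 hs2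
  have h3 := hconst.deriv.deriv_eq
  rw [hd, h2.deriv] at h3
  simp at h3
  linarith

theorem partialDeriv_eq_zero_of_isMax {f : Space d → ℝ} {z : Space d}
    (hz : ∀ y, f y ≤ f z) (j : Fin (d + 1)) : partialDeriv j f z = 0 := by
  have hmax : IsLocalMax f z := Filter.Eventually.of_forall hz
  simp [partialDeriv, hmax.fderiv_eq_zero]

theorem fderiv_fderiv_eq_sum {f : Space d → ℝ} (hf : ContDiff ℝ 2 f) (z x : Space d) :
    fderiv ℝ (fderiv ℝ f) z x x =
      ∑ j, ∑ l, x j * partialDeriv j (partialDeriv l f) z * x l := by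
  have hx : x = ∑ j, x j • (Pi.single j (1 : ℝ) : Space d) := by
    ext i; simp [Finset.sum_apply, Pi.single_apply]
  conv_lhs => rw [hx]
  simp only [map_sum, map_smul, sum_apply, smul_apply,
    smul_eq_mul, partialDeriv_partialDeriv hf, Finset.mul_sum]
  rw [Finset.sum_comm]
  refine Finset.sum_congr rfl fun j _ => Finset.sum_congr rfl fun l _ => by ring

theorem posSemidef_neg_hessian_of_isMax {f : Space d → ℝ} (hf : ContDiff ℝ 2 f) {z : Space d}
    (hz : ∀ y, f y ≤ f z) :
    (Matrix.of fun j l => -partialDeriv j (partialDeriv l f) z).PosSemidef := by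
  apply Matrix.PosSemidef.of_dotProduct_mulVec_nonneg
  · ext j l
    simp [partialDeriv_comm hf j l]
  · intro x
    have h := fderiv_fderiv_nonpos_of_isMax hf hz x
    rw [fderiv_fderiv_eq_sum hf] at h
    simp only [dotProduct, Matrix.mulVec, star_trivial, Matrix.of_apply, Finset.mul_sum]
    rw [← neg_nonneg, ← Finset.sum_neg_distrib] at h
    refine h.trans_eq (Finset.sum_congr rfl fun j _ => ?_)
    rw [← Finset.sum_neg_distrib]
    exact Finset.sum_congr rfl fun l _ => by ring

/-- At a maximum the gradient vanishes and minus the Hessian is positive semidefinite, so its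
Frobenius product with the covariance is nonnegative and only the rate term remains. -/
theorem genFn_le_of_isMax (q : FrozenCoeff d) (t : ℝ) {f : Space d → ℝ} (hf : ContDiff ℝ 2 f)
    {z : Space d} (hz : ∀ y, f y ≤ f z) : genFn q t f z ≤ q.rate t * f z := by
  have h := sum_mul_nonneg_of_posSemidef (q.posSemidef_cov t)
    (posSemidef_neg_hessian_of_isMax hf hz)
  simp only [Matrix.of_apply, mul_neg, Finset.sum_neg_distrib] at h
  simp only [genFn, partialDeriv_eq_zero_of_isMax hz, mul_zero, Finset.sum_const_zero]
  linarith

theorem HasDerivWithinAt.nonpos_of_le {f : ℝ → ℝ} {f' t t₁ : ℝ} (ht : t < t₁)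
    (hf : HasDerivWithinAt f f' (Icc t t₁) t) (hmax : ∀ s ∈ Icc t t₁, f s ≤ f t) : f' ≤ 0 := by
  have h := (hf.mono Ioo_subset_Icc_self)
  rw [hasDerivWithinAt_iff_tendsto_slope' (by simp)] at h
  have : (nhdsWithin t (Ioo t t₁)).NeBot := by
    rw [nhdsWithin_Ioo_eq_nhdsGT ht]; infer_instance
  refine le_of_tendsto h ?_
  filter_upwards [self_mem_nhdsWithin] with s hs
  rw [slope_def_field]
  exact div_nonpos_of_nonpos_of_nonneg (by linarith [hmax s ⟨hs.1.le, hs.2.le⟩])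
    (by linarith [hs.1])

/-- Maximum principle for strict subsolutions that are nonpositive outside a ball. -/
theorem nonpos_of_strict_subsolution (q : FrozenCoeff d) {t₀ t₁ M R : ℝ}
    {w w' : ℝ → Space d → ℝ}
    (hcont : ContinuousOn (fun p : ℝ × Space d => w p.1 p.2) (Icc t₀ t₁ ×ˢ univ))
    (hC2 : ∀ t ∈ Ico t₀ t₁, ContDiff ℝ 2 (w t))
    (hR : ∀ t ∈ Icc t₀ t₁, ∀ z, R ≤ ‖z‖ → w t z ≤ 0)
    (hterm : ∀ z, w t₁ z ≤ 0)
    (hd : ∀ t ∈ Ico t₀ t₁, ∀ z,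
      HasDerivWithinAt (fun s => w s z) (w' t z) (Icc t₀ t₁) t)
    (hsub : ∀ t ∈ Ico t₀ t₁, ∀ z, -genFn q t (w t) z < w' t z)
    (hM : ∀ t ∈ Icc t₀ t₁, q.rate t ≤ M) :
    ∀ t ∈ Icc t₀ t₁, ∀ z, w t z ≤ 0 := by
  intro t ht z
  by_contra! hpos
  -- The exponential absorbs the rate: at a positive maximum of `U` the right time derivative gives
  -- `w' ≤ -M w`, whereas the strict inequality and the spatial maximum give `w' > -rate * w ≥ -M
  -- w`.
  let U : ℝ × Space d → ℝ := fun p => Real.exp (M * p.1) * w p.1 p.2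
  have hUc : ContinuousOn U (Icc t₀ t₁ ×ˢ univ) :=
    (by fun_prop : Continuous fun p : ℝ × Space d => Real.exp (M * p.1)).continuousOn.mul hcont
  -- The ball contains the point where `w` is positive, and `w ≤ 0` beyond it, so a maximum over
  -- this compact set is a maximum over all of space.
  let K : Set (ℝ × Space d) := Icc t₀ t₁ ×ˢ Metric.closedBall 0 (max R ‖z‖)
  have hK : IsCompact K := isCompact_Icc.prod (isCompact_closedBall _ _)
  have hzK : (t, z) ∈ K := ⟨ht, by simp⟩
  obtain ⟨⟨s, y⟩, hsy, hmax⟩ := hK.exists_isMaxOn ⟨_, hzK⟩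
    (hUc.mono (prod_mono_right (subset_univ _)))
  have hUpos : 0 < U (s, y) :=
    lt_of_lt_of_le (mul_pos (Real.exp_pos _) hpos) (hmax hzK)
  have hs : s ∈ Icc t₀ t₁ := hsy.1
  have hall : ∀ r ∈ Icc t₀ t₁, ∀ x, U (r, x) ≤ U (s, y) := by
    intro r hr x
    by_cases hx : ‖x‖ ≤ max R ‖z‖
    · exact hmax (show (r, x) ∈ K from ⟨hr, by simpa using hx⟩)
    · have : w r x ≤ 0 := hR r hr x ((le_max_left _ _).trans (not_le.1 hx).le)
      exact (mul_nonpos_of_nonneg_of_nonpos (Real.exp_pos _).le this).trans hUpos.le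
  have hwpos : 0 < w s y := pos_of_mul_pos_right hUpos (Real.exp_pos _).le
  have hst : s < t₁ := by
    refine lt_of_le_of_ne hs.2 fun h => ?_
    have := hterm y
    rw [← h] at this
    linarith
  have hsI : s ∈ Ico t₀ t₁ := ⟨hs.1, hst⟩
  have hwmax : ∀ x, w s x ≤ w s y := fun x =>
    le_of_mul_le_mul_left (hall s hs x) (Real.exp_pos _)
  have hder : HasDerivWithinAt (fun r => U (r, y))
      (Real.exp (M * s) * M * w s y + Real.exp (M * s) * w' s y) (Icc s t₁) s := by
    have h1 : HasDerivAt (fun r => Real.exp (M * r)) (Real.exp (M * s) * M) s := by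
      simpa using ((hasDerivAt_id s).const_mul M).exp
    exact (h1.hasDerivWithinAt).mul ((hd s hsI y).mono (Icc_subset_Icc_left hs.1))
  have h1 := HasDerivWithinAt.nonpos_of_le hst hder
    fun r hr => hall r ⟨hs.1.trans hr.1, hr.2⟩ y
  have h2 : M * w s y + w' s y ≤ 0 := by
    have : Real.exp (M * s) * (M * w s y + w' s y) ≤ 0 := by linarith
    exact nonpos_of_mul_nonpos_right this (Real.exp_pos _)
  have h3 := hsub s hsI y
  have h4 := genFn_le_of_isMax q s (hC2 s hsI) hwmax
  have h5 : q.rate s * w s y ≤ M * w s y := mul_le_mul_of_nonneg_right (hM s hs) hwpos.le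
  linarith

/-- The weight `∑ⱼ cosh (κ zⱼ)`. -/
def weight (κ : ℝ) (z : Space d) : ℝ := ∑ j, Real.cosh (κ * z j)

theorem contDiff_weight (κ : ℝ) : ContDiff ℝ ∞ (weight (d := d) κ) := by
  unfold weight
  exact ContDiff.sum fun j _ => Real.contDiff_cosh.comp (contDiff_const.mul (contDiff_apply _ _ j))

theorem weight_pos (κ : ℝ) (z : Space d) : 0 < weight κ z :=
  Finset.sum_pos (fun _ _ => Real.cosh_pos _) Finset.univ_nonempty

theorem hasFDerivAt_coord_comp {g : ℝ → ℝ} {g' κ : ℝ} {z : Space d} {j : Fin (d + 1)}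
    (hg : HasDerivAt g g' (κ * z j)) :
    HasFDerivAt (fun z : Space d => g (κ * z j))
      ((g' * κ) • (ContinuousLinearMap.proj j : Space d →L[ℝ] ℝ)) z := by
  have h1 : HasFDerivAt (fun z : Space d => κ * z j)
      (κ • (ContinuousLinearMap.proj j : Space d →L[ℝ] ℝ)) z :=
    (hasFDerivAt_apply j z).const_mul κ
  have := hg.comp_hasFDerivAt z h1
  rwa [smul_smul] at this

theorem partialDeriv_weight (κ : ℝ) (j : Fin (d + 1)) :
    partialDeriv j (weight (d := d) κ) = fun z => κ * Real.sinh (κ * z j) := by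
  ext z
  have h : HasFDerivAt (weight (d := d) κ) (∑ l, (Real.sinh (κ * z l) * κ) •
      (ContinuousLinearMap.proj l : Space d →L[ℝ] ℝ)) z := by
    unfold weight
    exact HasFDerivAt.fun_sum fun l _ => hasFDerivAt_coord_comp (Real.hasDerivAt_cosh _)
  simp only [partialDeriv]
  rw [h.fderiv]
  simp [Pi.single_apply, mul_comm]

theorem partialDeriv_partialDeriv_weight (κ : ℝ) (j l : Fin (d + 1)) (z : Space d) :
    partialDeriv j (partialDeriv l (weight (d := d) κ)) z =
      if j = l then κ ^ 2 * Real.cosh (κ * z j) else 0 := by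
  rw [partialDeriv_weight]
  have h := (hasFDerivAt_coord_comp (κ := κ) (z := z) (j := l)
    (Real.hasDerivAt_sinh _)).const_mul κ
  simp only [partialDeriv]
  rw [h.fderiv]
  by_cases hjl : j = l
  · subst hjl; simp; ring
  · simp [hjl, Ne.symm hjl]

/-- `B` bounds the coefficients on the time set `s`. -/
structure FrozenCoeff.BoundedOn (q : FrozenCoeff d) (B : ℝ) (s : Set ℝ) : Prop where
  rate : ∀ t ∈ s, |q.rate t| ≤ B
  drift : ∀ t ∈ s, ∀ j, |q.drift t j| ≤ B
  cov : ∀ t ∈ s, ∀ j, |q.cov t j j| ≤ B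

/-- A growth rate that makes `e^{λ(t₁-t)}` times the weight a supersolution. -/
def growthRate (B κ : ℝ) : ℝ := B * (1 + κ + κ ^ 2) + 1

/-- As `|sinh| ≤ cosh` and the Hessian of the weight is diagonal, each term of the operator is at
most a constant times `∑ cosh (κ z_j)`; hence only diagonal covariance entries need a bound. The
summand `1` in `growthRate` makes the inequality strict. -/
theorem genFn_weight_lt {q : FrozenCoeff d} {B κ t : ℝ} {s : Set ℝ} (hq : q.BoundedOn B s)
    (hκ : 0 ≤ κ) (ht : t ∈ s) (z : Space d) :
    genFn q t (weight κ) z < growthRate B κ * weight κ z := by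
  have hB : 0 ≤ B := (abs_nonneg _).trans (hq.rate t ht)
  have key : genFn q t (weight κ) z ≤ B * (1 + κ + κ ^ 2) * weight κ z := by
    have h1 : q.rate t * weight κ z ≤ ∑ j, B * Real.cosh (κ * z j) := by
      rw [← Finset.mul_sum]
      exact mul_le_mul_of_nonneg_right ((le_abs_self _).trans (hq.rate t ht)) (weight_pos _ _).le
    have h2 : ∑ j, q.drift t j * partialDeriv j (weight κ) z ≤
        ∑ j, B * κ * Real.cosh (κ * z j) := by
      refine Finset.sum_le_sum fun j _ => ?_
      rw [partialDeriv_weight]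
      have hs : |Real.sinh (κ * z j)| ≤ Real.cosh (κ * z j) := by
        rw [Real.abs_sinh, ← Real.cosh_abs (κ * z j)]
        exact (Real.sinh_lt_cosh _).le
      calc q.drift t j * (κ * Real.sinh (κ * z j))
          ≤ |q.drift t j| * (κ * |Real.sinh (κ * z j)|) := by
            rw [← abs_of_nonneg hκ, ← abs_mul, abs_of_nonneg hκ, ← abs_mul]
            exact le_abs_self _
        _ ≤ B * (κ * Real.cosh (κ * z j)) := by
            gcongr
            exact hq.drift t ht j
        _ = _ := by ring
    have h3 : (1 / 2) * ∑ j, ∑ l, q.cov t j l * partialDeriv j (partialDeriv l (weight κ)) z ≤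
        ∑ j, B * κ ^ 2 * Real.cosh (κ * z j) := by
      have : ∑ j, ∑ l, q.cov t j l * partialDeriv j (partialDeriv l (weight κ)) z ≤
          ∑ j, B * κ ^ 2 * Real.cosh (κ * z j) := by
        refine Finset.sum_le_sum fun j _ => ?_
        simp only [partialDeriv_partialDeriv_weight, mul_ite, mul_zero, Finset.sum_ite_eq,
          Finset.mem_univ, if_true]
        rw [mul_assoc]
        exact mul_le_mul_of_nonneg_right ((le_abs_self _).trans (hq.cov t ht j))
          (mul_nonneg (sq_nonneg _) (Real.cosh_pos _).le)
      have h0 : 0 ≤ ∑ j, B * κ ^ 2 * Real.cosh (κ * z j) :=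
        Finset.sum_nonneg fun j _ => mul_nonneg (mul_nonneg hB (sq_nonneg _)) (Real.cosh_pos _).le
      linarith
    have h4 : B * (1 + κ + κ ^ 2) * weight κ z = ∑ j, B * Real.cosh (κ * z j) +
        ∑ j, B * κ * Real.cosh (κ * z j) + ∑ j, B * κ ^ 2 * Real.cosh (κ * z j) := by
      simp only [← Finset.mul_sum, weight]; ring
    rw [h4, genFn]
    linarith
  have := weight_pos κ z
  rw [growthRate]
  linarith

/-- The sup norm is attained at some coordinate, and the `cosh` of that coordinate alone is at least
half of the exponential. The weight is thus a smooth substitute for `e^{κ‖z‖}`. -/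
theorem exp_norm_le_weight {κ : ℝ} (hκ : 0 ≤ κ) (z : Space d) :
    Real.exp (κ * ‖z‖) ≤ 2 * weight κ z := by
  obtain ⟨j, -, hj⟩ := Finset.exists_max_image Finset.univ (fun j => ‖z j‖) Finset.univ_nonempty
  have hz : ‖z‖ ≤ ‖z j‖ := (pi_norm_le_iff_of_nonneg (norm_nonneg _)).2
    fun i => hj i (Finset.mem_univ i)
  have h1 : Real.exp (κ * ‖z‖) ≤ 2 * Real.cosh (κ * z j) := by
    rw [← Real.cosh_abs, abs_mul, abs_of_nonneg hκ, Real.cosh_eq]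
    have := Real.exp_le_exp.2 (mul_le_mul_of_nonneg_left hz hκ)
    rw [Real.norm_eq_abs] at this
    have := Real.exp_pos (-(κ * |z j|))
    linarith
  have h2 : Real.cosh (κ * z j) ≤ weight κ z :=
    Finset.single_le_sum (f := fun j => Real.cosh (κ * z j))
      (fun _ _ => (Real.cosh_pos _).le) (Finset.mem_univ j)
  linarith

theorem weight_le_exp_norm {κ : ℝ} (hκ : 0 ≤ κ) (z : Space d) :
    weight κ z ≤ (d + 1) * Real.exp (κ * ‖z‖) := by
  have h : ∀ j ∈ Finset.univ, Real.cosh (κ * z j) ≤ Real.exp (κ * ‖z‖) := by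
    intro j _
    have h1 : |z j| ≤ ‖z‖ := norm_le_pi_norm z j
    rw [← Real.cosh_abs, abs_mul, abs_of_nonneg hκ, Real.cosh_eq]
    have h2 : Real.exp (κ * |z j|) ≤ Real.exp (κ * ‖z‖) :=
      Real.exp_le_exp.2 (mul_le_mul_of_nonneg_left h1 hκ)
    have h3 : Real.exp (-(κ * |z j|)) ≤ Real.exp (κ * ‖z‖) :=
      Real.exp_le_exp.2 (by nlinarith [norm_nonneg z, abs_nonneg (z j)])
    linarith
  have := Finset.sum_le_card_nsmul _ _ _ h
  simpa [weight] using this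

/-- For `κ > c`, a function of growth `e^{c‖z‖}` is below any multiple of the weight far out. -/
theorem exists_radius_exp_le_weight {c κ : ℝ} (hκ : 0 ≤ κ) (hc : c < κ) (K : ℝ) {ε : ℝ}
    (hε : 0 < ε) : ∃ R : ℝ, ∀ z : Space d, R ≤ ‖z‖ →
      K * Real.exp (c * ‖z‖) ≤ ε * weight κ z := by
  have h : Filter.Tendsto (fun x : ℝ => Real.exp ((κ - c) * x)) Filter.atTop Filter.atTop :=
    Real.tendsto_exp_atTop.comp (Filter.tendsto_id.const_mul_atTop (sub_pos.2 hc))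
  obtain ⟨R, hR⟩ := (Filter.eventually_atTop.1 (h.eventually_ge_atTop (2 * K / ε)))
  refine ⟨R, fun z hz => ?_⟩
  have h1 := hR _ hz
  rw [div_le_iff₀ hε] at h1
  have h2 : Real.exp (κ * ‖z‖) = Real.exp ((κ - c) * ‖z‖) * Real.exp (c * ‖z‖) := by
    rw [← Real.exp_add]; ring_nf
  have h3 := exp_norm_le_weight hκ z
  rw [h2] at h3
  have h4 := Real.exp_pos (c * ‖z‖)
  nlinarith

theorem hasDerivAt_barrier (lam t₁ t x : ℝ) :
    HasDerivAt (fun s => Real.exp (lam * (t₁ - s)) * x)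
      (-lam * (Real.exp (lam * (t₁ - t)) * x)) t := by
  have h1 : HasDerivAt (fun s => lam * (t₁ - s)) (-lam) t := by
    simpa using ((hasDerivAt_id t).const_sub t₁).const_mul lam
  exact (h1.exp.mul_const x).congr_deriv (by ring)

/-- Maximum principle for subsolutions of at most exponential growth. -/
theorem le_barrier_of_subsolution (q : FrozenCoeff d) {t₀ t₁ B κ ε : ℝ}
    (hq : q.BoundedOn B (Icc t₀ t₁)) (hκ : 0 ≤ κ) (hε : 0 ≤ ε) {w w' : ℝ → Space d → ℝ}
    (hcont : ContinuousOn (fun p : ℝ × Space d => w p.1 p.2) (Icc t₀ t₁ ×ˢ univ))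
    (hC2 : ∀ t ∈ Ico t₀ t₁, ContDiff ℝ 2 (w t))
    (hgrowth : ∃ K c : ℝ, ∀ t ∈ Icc t₀ t₁, ∀ z, w t z ≤ K * Real.exp (c * ‖z‖))
    (hd : ∀ t ∈ Ico t₀ t₁, ∀ z,
      HasDerivWithinAt (fun s => w s z) (w' t z) (Icc t₀ t₁) t)
    (hsub : ∀ t ∈ Ico t₀ t₁, ∀ z, -genFn q t (w t) z ≤ w' t z)
    (hterm : ∀ z, w t₁ z ≤ ε * weight κ z) :
    ∀ t ∈ Icc t₀ t₁, ∀ z,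
      w t z ≤ ε * (Real.exp (growthRate B κ * (t₁ - t)) * weight κ z) := by
  obtain ⟨K, c, hKc⟩ := hgrowth
  intro t ht z
  have hB : 0 ≤ B := (abs_nonneg _).trans (hq.rate t ht)
  have hgr : ∀ κ, 0 ≤ κ → 0 ≤ growthRate B κ := fun κ hκ => by unfold growthRate; positivity
  -- The given `κ` describes the terminal bound and need not exceed the growth exponent `c`. A
  -- second barrier with larger exponent controls infinity.
  let κ' : ℝ := max c 0 + 1
  have hκ' : 0 ≤ κ' := by positivity
  have hcκ' : c < κ' := (le_max_left c 0).trans_lt (lt_add_one _)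
  let bar : ℝ → ℝ → Space d → ℝ := fun κ t z => Real.exp (growthRate B κ * (t₁ - t)) * weight κ z
  have hbarpos : ∀ κ t z, 0 < bar κ t z := fun κ t z =>
    mul_pos (Real.exp_pos _) (weight_pos _ _)
  have hbar : ∀ κ t, bar κ t = Real.exp (growthRate B κ * (t₁ - t)) • weight κ := fun _ _ => rfl
  have hbarC : ∀ κ t, ContDiff ℝ 2 (bar κ t) := fun κ t =>
    contDiff_const.mul ((contDiff_weight κ).of_le (WithTop.coe_le_coe.2 le_top))
  have hwc : ∀ κ, Continuous (weight (d := d) κ) := fun κ => (contDiff_weight κ).continuous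
  have hbarc : ∀ κ, Continuous fun p : ℝ × Space d => bar κ p.1 p.2 := fun κ =>
    (by fun_prop : Continuous fun p : ℝ × Space d =>
      Real.exp (growthRate B κ * (t₁ - p.1))).mul ((hwc κ).comp continuous_snd)
  have hbargen : ∀ κ, 0 ≤ κ → ∀ t ∈ Icc t₀ t₁, ∀ z,
      genFn q t (bar κ t) z < growthRate B κ * bar κ t z := by
    intro κ hκ t ht z
    rw [hbar, genFn_smul q t _ ((contDiff_weight κ).of_le (WithTop.coe_le_coe.2 le_top))]
    have := mul_lt_mul_of_pos_left (genFn_weight_lt hq hκ ht z)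
      (Real.exp_pos (growthRate B κ * (t₁ - t)))
    simp only [Pi.smul_apply, smul_eq_mul]
    linarith
  -- Subtracting `δ` times the second barrier makes the function nonpositive far out and the
  -- subsolution inequality strict. Afterwards `δ` tends to `0` at the fixed point.
  have key : ∀ δ : ℝ, 0 < δ → w t z - ε * bar κ t z - δ * bar κ' t z ≤ 0 := by
    intro δ hδ
    obtain ⟨R, hR⟩ := exists_radius_exp_le_weight (d := d) hκ' hcκ' K hδ
    have hu : ∀ s, (fun z => w s z - ε * bar κ s z - δ * bar κ' s z) =
        w s + ((-ε) • bar κ s + (-δ) • bar κ' s) := fun s => by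
      ext z; simp; ring
    refine nonpos_of_strict_subsolution q (t₀ := t₀) (t₁ := t₁) (M := B) (R := R)
      (w := fun t z => w t z - ε * bar κ t z - δ * bar κ' t z)
      (w' := fun t z => w' t z - ε * (-growthRate B κ * bar κ t z)
        - δ * (-growthRate B κ' * bar κ' t z)) ?_ ?_ ?_ ?_ ?_ ?_ ?_ t ht z
    · exact (hcont.sub (continuous_const.mul (hbarc κ)).continuousOn).sub
        (continuous_const.mul (hbarc κ')).continuousOn
    · intro s hs
      exact ((hC2 s hs).sub (contDiff_const.mul (hbarC κ s))).sub (contDiff_const.mul (hbarC κ' s))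
    · intro s hs x hx
      have h1 := hKc s hs x
      have h2 := hR x hx
      have h3 : weight κ' x ≤ bar κ' s x := le_mul_of_one_le_left (weight_pos _ _).le
        (Real.one_le_exp (mul_nonneg (hgr _ hκ') (sub_nonneg.2 hs.2)))
      have h4 := mul_nonneg hε (hbarpos κ s x).le
      have h5 := mul_le_mul_of_nonneg_left h3 hδ.le
      linarith
    · intro x
      have h1 := hterm x
      have h2 : bar κ t₁ x = weight κ x := by simp [bar]
      have h3 := mul_pos hδ (hbarpos κ' t₁ x)
      rw [h2]
      linarith
    · intro s hs x
      exact ((hd s hs x).sub ((hasDerivAt_barrier _ _ _ _).const_mul ε).hasDerivWithinAt).sub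
        ((hasDerivAt_barrier _ _ _ _).const_mul δ).hasDerivWithinAt
    · intro s hs x
      have hs' : s ∈ Icc t₀ t₁ := ⟨hs.1, hs.2.le⟩
      have e1 : genFn q s (fun z => w s z - ε * bar κ s z - δ * bar κ' s z) x =
          genFn q s (w s) x + (-ε * genFn q s (bar κ s) x + -δ * genFn q s (bar κ' s) x) := by
        have hsm : ∀ κ c : ℝ, ContDiff ℝ 2 (c • bar κ s) := fun κ c =>
          contDiff_const.smul (hbarC κ s)
        have hsum : ContDiff ℝ 2 ((-ε) • bar κ s + (-δ) • bar κ' s) := (hsm _ _).add (hsm _ _)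
        rw [hu, genFn_add q s (hC2 s hs) hsum, genFn_add q s (hsm _ _) (hsm _ _),
          genFn_smul q s _ (hbarC κ s), genFn_smul q s _ (hbarC κ' s)]
      have h1 := hsub s hs x
      have h2 := mul_le_mul_of_nonneg_left (hbargen κ hκ s hs' x).le hε
      have h3 := mul_lt_mul_of_pos_left (hbargen κ' hκ' s hs' x) hδ
      change -genFn q s (fun z => w s z - ε * bar κ s z - δ * bar κ' s z) x < _
      rw [e1]
      linarith
    · exact fun s hs => (le_abs_self _).trans (hq.rate s hs)
  have hb := hbarpos κ' t z
  refine le_of_forall_pos_le_add fun δ hδ => ?_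
  have h1 := key (δ / bar κ' t z) (div_pos hδ hb)
  rw [div_mul_cancel₀ _ hb.ne'] at h1
  change w t z ≤ ε * bar κ t z + δ
  linarith

/-! ### The generator on smooth functions -/

/-- The operator `rate + drift · ∇ + (1/2) tr (cov ∇²)` on smooth functions. -/
def gen (q : FrozenCoeff d) (t : ℝ) : SmOp d :=
  q.rate t • 1 + ∑ j, q.drift t j • smDeriv j +
    (1 / 2 : ℝ) • ∑ j, ∑ l, q.cov t j l • (smDeriv j * smDeriv l)

theorem coe_gen (q : FrozenCoeff d) (t : ℝ) (f : Sm d) (z : Space d) :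
    (gen q t f : Space d → ℝ) z = genFn q t f z := by
  simp [gen, genFn, LinearMap.sum_apply, ← coe_smDeriv]

theorem FrozenCoeff.cov_symm (q : FrozenCoeff d) (t : ℝ) (j l : Fin (d + 1)) :
    q.cov t j l = q.cov t l j := by
  have := (q.posSemidef_cov t).isHermitian.apply l j
  simpa using this

/-- The form `∑ cov_{jl} ∂_j f ∂_l g`. -/
def gradForm (q : FrozenCoeff d) (t : ℝ) (f g : Sm d) : Sm d :=
  ∑ j, ∑ l, q.cov t j l • (smDeriv j f * smDeriv l g)

/-- Leibniz rule for a second order operator: symmetry of the covariance merges the two mixed terms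
into `gradForm` and cancels the factor `1/2`. The rate is counted twice by the first two summands
and once on the left, hence the correction. -/
theorem gen_mul (q : FrozenCoeff d) (t : ℝ) (f g : Sm d) :
    gen q t (f * g) =
      f * gen q t g + g * gen q t f - q.rate t • (f * g) + gradForm q t f g := by
  have h2 : ∀ j l, smDeriv j (smDeriv l (f * g)) = f * smDeriv j (smDeriv l g) +
      g * smDeriv j (smDeriv l f) + (smDeriv j f * smDeriv l g + smDeriv l f * smDeriv j g) := by
    intro j l
    simp only [smDeriv_mul, map_add]
    ring
  have h3 : ∑ j, ∑ l, q.cov t j l • (smDeriv l f * smDeriv j g) = gradForm q t f g := by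
    rw [Finset.sum_comm]
    exact Finset.sum_congr rfl fun j _ => Finset.sum_congr rfl fun l _ => by rw [q.cov_symm]
  simp only [gen, LinearMap.add_apply, LinearMap.smul_apply, LinearMap.sum_apply,
    Module.End.mul_apply, Module.End.one_apply, h2]
  simp only [smDeriv_mul, smul_add, Finset.sum_add_distrib, h3, mul_add, Finset.mul_sum,
    mul_smul_comm]
  change _ = _ + gradForm q t f g
  have h4 : ∑ j, ∑ l, q.cov t j l • (smDeriv j f * smDeriv l g) = gradForm q t f g := rfl
  rw [h4]
  have h5 : g * f = f * g := mul_comm _ _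
  rw [h5]
  module

/-- The coefficients do not depend on `z`, and partial derivatives of smooth functions commute. -/
theorem gen_comm_smDeriv (q : FrozenCoeff d) (t : ℝ) (i : Fin (d + 1)) :
    Commute (gen q t) (smDeriv i) := by
  have h : ∀ j, Commute (smDeriv j : SmOp d) (smDeriv i) := fun j => smDeriv_comm j i
  unfold gen
  refine (((Commute.one_left _).smul_left _).add_left ?_).add_left (Commute.smul_left ?_ _)
  · exact Commute.sum_left _ _ _ fun j _ => (h j).smul_left _
  · exact Commute.sum_left _ _ _ fun j _ => Commute.sum_left _ _ _ fun l _ =>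
      ((h j).mul_left (h l)).smul_left _

/-- The same coefficients with twice the rate, which govern products of two solutions. -/
def FrozenCoeff.double (q : FrozenCoeff d) : FrozenCoeff d :=
  { q with rate := fun t => 2 * q.rate t, continuous_rate := q.continuous_rate.const_mul 2 }

theorem gen_double_mul (q : FrozenCoeff d) (t : ℝ) (f g : Sm d) :
    gen q.double t (f * g) = f * gen q t g + g * gen q t f + gradForm q t f g := by
  have h : gen q.double t = gen q t + q.rate t • 1 := by
    simp only [gen, FrozenCoeff.double]
    module
  rw [h, LinearMap.add_apply, gen_mul, LinearMap.smul_apply, Module.End.one_apply]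
  abel

/-! ### Integrated coefficients -/

theorem hasDerivAt_integral_left {g : ℝ → ℝ} (hg : Continuous g) (T t : ℝ) :
    HasDerivAt (fun t => ∫ r in t..T, g r) (-g t) t := by
  have h := (intervalIntegral.integral_hasDerivAt_right (hg.intervalIntegrable T t)
    (hg.stronglyMeasurableAtFilter _ _) hg.continuousAt).neg
  refine h.congr_of_eventuallyEq (Filter.Eventually.of_forall fun s => ?_)
  exact intervalIntegral.integral_symm _ _

/-- The integrated covariance `∫_t^s cov`. -/
def FrozenCoeff.covI (q : FrozenCoeff d) (t s : ℝ) : Matrix (Fin (d + 1)) (Fin (d + 1)) ℝ :=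
  Matrix.of fun j l => ∫ r in t..s, q.cov r j l

theorem dotProduct_mulVec_eq_sum {n : Type*} [Fintype n] (A : Matrix n n ℝ) (x : n → ℝ) :
    star x ⬝ᵥ A.mulVec x = ∑ j, ∑ l, A j l * (x j * x l) := by
  simp only [dotProduct, Matrix.mulVec, Finset.mul_sum, star_trivial]
  exact Finset.sum_congr rfl fun j _ => Finset.sum_congr rfl fun l _ => by ring

theorem FrozenCoeff.covI_quad (q : FrozenCoeff d) (t s : ℝ) (x : Space d) :
    ∑ j, ∑ l, q.covI t s j l * (x j * x l) =
      ∫ r in t..s, ∑ j, ∑ l, q.cov r j l * (x j * x l) := by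
  have hc : ∀ j l, Continuous fun r => q.cov r j l * (x j * x l) := fun j l =>
    (q.continuous_cov j l).mul continuous_const
  rw [intervalIntegral.integral_finsetSum fun j _ =>
    (continuous_finsetSum _ fun l _ => hc j l).intervalIntegrable _ _]
  refine Finset.sum_congr rfl fun j _ => ?_
  rw [intervalIntegral.integral_finsetSum fun l _ => (hc j l).intervalIntegrable _ _]
  refine Finset.sum_congr rfl fun l _ => ?_
  rw [intervalIntegral.integral_mul_const]
  rfl

theorem FrozenCoeff.covI_posSemidef (q : FrozenCoeff d) {t s : ℝ} (hts : t ≤ s) :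
    (q.covI t s).PosSemidef := by
  apply Matrix.PosSemidef.of_dotProduct_mulVec_nonneg
  · ext j l
    simp only [Matrix.conjTranspose_apply, star_trivial, FrozenCoeff.covI, Matrix.of_apply]
    exact intervalIntegral.integral_congr fun r _ => q.cov_symm r l j
  · intro x
    rw [dotProduct_mulVec_eq_sum, q.covI_quad]
    refine intervalIntegral.integral_nonneg hts fun r _ => ?_
    rw [← dotProduct_mulVec_eq_sum]
    exact (q.posSemidef_cov r).dotProduct_mulVec_nonneg x

theorem FrozenCoeff.covI_add (q : FrozenCoeff d) (t r s : ℝ) (j l : Fin (d + 1)) :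
    q.covI t s j l = q.covI t r j l + q.covI r s j l :=
  (intervalIntegral.integral_add_adjacent_intervals
    ((q.continuous_cov j l).intervalIntegrable _ _)
    ((q.continuous_cov j l).intervalIntegrable _ _)).symm

/-- A positive definite form is bounded below by a multiple of each squared coordinate. -/
theorem exists_lower_bound_of_posDef {C : Matrix (Fin (d + 1)) (Fin (d + 1)) ℝ}
    (hC : C.PosDef) : ∃ δ : ℝ, 0 < δ ∧ ∀ x : Space d, ∀ i,
      δ * x i ^ 2 ≤ ∑ j, ∑ l, C j l * (x j * x l) := by
  let Q : Space d → ℝ := fun x => ∑ j, ∑ l, C j l * (x j * x l)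
  have hQ : Continuous Q := by fun_prop
  -- The constant is the minimum of the form on the unit sphere, positive by definiteness;
  -- homogeneity of degree two extends the bound to all vectors.
  have hne : (Metric.sphere (0 : Space d) 1).Nonempty := (NormedSpace.sphere_nonempty).2 zero_le_one
  obtain ⟨y, hy, hmin⟩ := (isCompact_sphere (0 : Space d) 1).exists_isMinOn hne hQ.continuousOn
  have hy0 : y ≠ 0 := by
    rintro rfl
    simp at hy
  refine ⟨Q y, ?_, fun x i => ?_⟩
  · have := hC.dotProduct_mulVec_pos hy0
    rwa [dotProduct_mulVec_eq_sum] at this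
  · by_cases hx : x = 0
    · subst hx; simp
    · have hx' : 0 < ‖x‖ := norm_pos_iff.2 hx
      have h1 : Q y ≤ Q (‖x‖⁻¹ • x) := hmin (by simp [norm_smul, hx'.ne'])
      have h2 : Q (‖x‖⁻¹ • x) = (‖x‖ ^ 2)⁻¹ * Q x := by
        simp only [Q, Finset.mul_sum, Pi.smul_apply, smul_eq_mul]
        exact Finset.sum_congr rfl fun j _ => Finset.sum_congr rfl fun l _ => by ring
      have hyQ : 0 ≤ Q y := by
        have := (hC.dotProduct_mulVec_pos hy0).le
        rwa [dotProduct_mulVec_eq_sum] at this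
      have h3 : Q y * ‖x‖ ^ 2 ≤ Q x := by
        rw [h2, ← div_eq_inv_mul, le_div_iff₀ (by positivity)] at h1
        exact h1
      have h4 : x i ^ 2 ≤ ‖x‖ ^ 2 := by
        rw [← sq_abs]
        exact pow_le_pow_left₀ (abs_nonneg _) (norm_le_pi_norm x i) 2
      exact (mul_le_mul_of_nonneg_left h4 hyQ).trans h3

/-! ### Trigonometric solutions -/

/-- The solution of `∂_t u + gen u = 0` with terminal value `cos (ξ · z + θ)` at time `T`. -/
def wave (q : FrozenCoeff d) (T : ℝ) (ξ : Space d) (θ : ℝ) (t : ℝ) : Sm d :=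
  ⟨fun z => Real.exp ((∫ r in t..T, q.rate r) -
      (1 / 2) * ∑ j, ∑ l, (∫ r in t..T, q.cov r j l) * (ξ j * ξ l)) *
    Real.cos (∑ j, ξ j * (z j + ∫ r in t..T, q.drift r j) + θ),
    mem_smoothAlg.2 <| contDiff_const.mul <| Real.contDiff_cos.comp <|
      (ContDiff.sum fun j _ => contDiff_const.mul ((contDiff_apply _ _ j).add contDiff_const)).add
        contDiff_const⟩

/-- Differentiating a cosine shifts its phase by `π/2`. Carrying the phase as a parameter keeps the
family closed under derivatives up to scalars. -/
theorem smDeriv_wave (q : FrozenCoeff d) (T : ℝ) (ξ : Space d) (θ t : ℝ) (j : Fin (d + 1)) :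
    smDeriv j (wave q T ξ θ t) = ξ j • wave q T ξ (θ + Real.pi / 2) t := by
  ext z
  have h1 : HasFDerivAt (fun z : Space d => ∑ j, ξ j * (z j + ∫ r in t..T, q.drift r j) + θ)
      (∑ j, ξ j • (ContinuousLinearMap.proj j : Space d →L[ℝ] ℝ)) z :=
    (HasFDerivAt.fun_sum fun j _ => ((hasFDerivAt_apply j z).add_const _).const_mul _).add_const _
  have h2 := h1.cos.const_mul (Real.exp ((∫ r in t..T, q.rate r) -
      (1 / 2) * ∑ j, ∑ l, (∫ r in t..T, q.cov r j l) * (ξ j * ξ l)))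
  simp only [coe_smDeriv, partialDeriv, wave, Subalgebra.coe_smul, Pi.smul_apply, smul_eq_mul]
  rw [h2.fderiv, ← add_assoc, Real.cos_add_pi_div_two]
  simp [Pi.single_apply]
  ring

theorem gen_wave (q : FrozenCoeff d) (T : ℝ) (ξ : Space d) (θ t : ℝ) :
    gen q t (wave q T ξ θ t) =
      (q.rate t - (1 / 2) * ∑ j, ∑ l, q.cov t j l * (ξ j * ξ l)) • wave q T ξ θ t +
        (∑ j, q.drift t j * ξ j) • wave q T ξ (θ + Real.pi / 2) t := by
  have h : wave q T ξ (θ + Real.pi / 2 + Real.pi / 2) t = -wave q T ξ θ t := by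
    ext z
    simp only [wave, Subalgebra.coe_neg, Pi.neg_apply]
    rw [← add_assoc, ← add_assoc, Real.cos_add_pi_div_two, Real.sin_add_pi_div_two]
    ring
  simp only [gen, LinearMap.add_apply, LinearMap.smul_apply, LinearMap.sum_apply,
    Module.End.mul_apply, Module.End.one_apply, smDeriv_wave, map_smul, h, smul_neg, smul_smul,
    Finset.sum_neg_distrib, ← Finset.sum_smul]
  have h2 : ∑ j, ∑ l, q.cov t j l * (ξ l * ξ j) = ∑ j, ∑ l, q.cov t j l * (ξ j * ξ l) :=
    Finset.sum_congr rfl fun j _ => Finset.sum_congr rfl fun l _ => by rw [mul_comm (ξ l)]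
  simp only [h2]
  module

theorem hasDerivAt_wave (q : FrozenCoeff d) (T : ℝ) (ξ : Space d) (θ t : ℝ) (z : Space d) :
    HasDerivAt (fun s => (wave q T ξ θ s : Space d → ℝ) z)
      (-(gen q t (wave q T ξ θ t) : Space d → ℝ) z) t := by
  have h1 : HasDerivAt (fun t => (∫ r in t..T, q.rate r) -
      (1 / 2) * ∑ j, ∑ l, (∫ r in t..T, q.cov r j l) * (ξ j * ξ l))
      (-q.rate t - (1 / 2) * ∑ j, ∑ l, -q.cov t j l * (ξ j * ξ l)) t :=
    (hasDerivAt_integral_left q.continuous_rate T t).sub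
      ((HasDerivAt.fun_sum fun j _ => HasDerivAt.fun_sum fun l _ =>
        (hasDerivAt_integral_left (q.continuous_cov j l) T t).mul_const _).const_mul _)
  have h2 : HasDerivAt (fun t => ∑ j, ξ j * (z j + ∫ r in t..T, q.drift r j) + θ)
      (∑ j, ξ j * -q.drift t j) t :=
    (HasDerivAt.fun_sum fun j _ =>
      ((hasDerivAt_integral_left (q.continuous_drift j) T t).const_add _).const_mul _).add_const _
  refine (h1.exp.mul h2.cos).congr_deriv ?_
  rw [gen_wave]
  simp only [wave, Subalgebra.coe_add, Subalgebra.coe_smul, Pi.add_apply, Pi.smul_apply,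
    smul_eq_mul]
  rw [← add_assoc, Real.cos_add_pi_div_two]
  have h3 : ∑ j, ξ j * -q.drift t j = -∑ j, q.drift t j * ξ j := by
    rw [← Finset.sum_neg_distrib]
    exact Finset.sum_congr rfl fun j _ => by ring
  simp only [neg_mul, Finset.sum_neg_distrib, h3]
  ring

theorem continuous_integral_left {g : ℝ → ℝ} (hg : Continuous g) (T : ℝ) :
    Continuous fun t => ∫ r in t..T, g r :=
  continuous_iff_continuousAt.2 fun t => (hasDerivAt_integral_left hg T t).continuousAt

theorem continuous_wave (q : FrozenCoeff d) (T : ℝ) (ξ : Space d) (θ : ℝ) :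
    Continuous fun p : ℝ × Space d => (wave q T ξ θ p.1 : Space d → ℝ) p.2 := by
  have h1 := continuous_integral_left q.continuous_rate T
  have h2 := fun j => continuous_integral_left (q.continuous_drift j) T
  have h3 := fun j l => continuous_integral_left (q.continuous_cov j l) T
  simp only [wave]
  fun_prop

theorem exists_bound_wave (q : FrozenCoeff d) (T : ℝ) (ξ : Space d) (θ : ℝ) (t₀ t₁ : ℝ) :
    ∃ K, ∀ t ∈ Icc t₀ t₁, ∀ z, |(wave q T ξ θ t : Space d → ℝ) z| ≤ K := by
  have h1 := continuous_integral_left q.continuous_rate T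
  have h3 := fun j l => continuous_integral_left (q.continuous_cov j l) T
  have hc : Continuous fun t => Real.exp ((∫ r in t..T, q.rate r) -
      (1 / 2) * ∑ j, ∑ l, (∫ r in t..T, q.cov r j l) * (ξ j * ξ l)) := by fun_prop
  obtain ⟨K, hK⟩ := isCompact_Icc.exists_bound_of_continuousOn (s := Icc t₀ t₁) hc.continuousOn
  refine ⟨K, fun t ht z => ?_⟩
  have h := hK t ht
  simp only [wave, abs_mul]
  rw [Real.norm_eq_abs] at h
  calc _ ≤ K * 1 := mul_le_mul h (Real.abs_cos_le_one _) (abs_nonneg _) ((abs_nonneg _).trans h)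
    _ = K := mul_one K

/-- Finite linear combinations of trigonometric solutions. -/
def trigSol (q : FrozenCoeff d) (T : ℝ) : Submodule ℝ (ℝ → Sm d) :=
  Submodule.span ℝ (range fun p : Space d × ℝ => wave q T p.1 p.2)

section trigSol
variable {q : FrozenCoeff d} {T : ℝ} {u : ℝ → Sm d}

theorem trigSol_smDeriv (hu : u ∈ trigSol q T) (j : Fin (d + 1)) :
    (fun t => smDeriv j (u t)) ∈ trigSol q T := by
  induction hu using Submodule.span_induction with
  | mem x hx =>
    obtain ⟨⟨ξ, θ⟩, rfl⟩ := hx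
    have : (fun t => smDeriv j (wave q T ξ θ t)) = ξ j • wave q T ξ (θ + Real.pi / 2) :=
      funext fun t => smDeriv_wave q T ξ θ t j
    simp only [this]
    exact Submodule.smul_mem _ _ (Submodule.subset_span ⟨(ξ, θ + Real.pi / 2), rfl⟩)
  | zero =>
    convert (trigSol q T).zero_mem using 1
    ext1 t
    exact map_zero _
  | add x y _ _ hx hy =>
    convert (trigSol q T).add_mem hx hy using 1
    ext1 t
    exact map_add _ _ _
  | smul a x _ hx =>
    convert (trigSol q T).smul_mem a hx using 1
    ext1 t
    exact (smDeriv j).map_smul a (x t)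

theorem trigSol_smMultiDeriv (hu : u ∈ trigSol q T) (β : MultiIndex d) :
    (fun t => smMultiDeriv β (u t)) ∈ trigSol q T := by
  induction β using MultiIndex.induction with
  | h0 => simpa [ordPow_zero] using hu
  | h1 β j ih => simpa [smMultiDeriv_add_single] using trigSol_smDeriv ih j

theorem trigSol_continuous (hu : u ∈ trigSol q T) :
    Continuous fun p : ℝ × Space d => (u p.1 : Space d → ℝ) p.2 := by
  induction hu using Submodule.span_induction with
  | mem x hx =>
    obtain ⟨⟨ξ, θ⟩, rfl⟩ := hx
    exact continuous_wave q T ξ θ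
  | zero => exact continuous_const
  | add x y _ _ hx hy => exact hx.add hy
  | smul a x _ hx => exact hx.const_mul a

theorem trigSol_hasDerivAt (hu : u ∈ trigSol q T) (t : ℝ) (z : Space d) :
    HasDerivAt (fun s => (u s : Space d → ℝ) z) (-(gen q t (u t) : Space d → ℝ) z) t := by
  induction hu using Submodule.span_induction with
  | mem x hx =>
    obtain ⟨⟨ξ, θ⟩, rfl⟩ := hx
    exact hasDerivAt_wave q T ξ θ t z
  | zero => simpa using hasDerivAt_const t (0 : ℝ)
  | add x y _ _ hx hy =>
    refine (hx.add hy).congr_deriv ?_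
    simp
    ring
  | smul a x _ hx =>
    refine (hx.const_mul a).congr_deriv ?_
    simp

theorem trigSol_exists_bound (hu : u ∈ trigSol q T) (t₀ t₁ : ℝ) :
    ∃ K, ∀ t ∈ Icc t₀ t₁, ∀ z, |(u t : Space d → ℝ) z| ≤ K := by
  induction hu using Submodule.span_induction with
  | mem x hx =>
    obtain ⟨⟨ξ, θ⟩, rfl⟩ := hx
    exact exists_bound_wave q T ξ θ t₀ t₁
  | zero => exact ⟨0, by simp⟩
  | add x y _ _ hx hy =>
    obtain ⟨K, hK⟩ := hx
    obtain ⟨K', hK'⟩ := hy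
    exact ⟨K + K', fun t ht z => (abs_add_le _ _).trans (add_le_add (hK t ht z) (hK' t ht z))⟩
  | smul a x _ hx =>
    obtain ⟨K, hK⟩ := hx
    refine ⟨|a| * K, fun t ht z => ?_⟩
    simpa [abs_mul] using mul_le_mul_of_nonneg_left (hK t ht z) (abs_nonneg a)

end trigSol

/-! ### Gradient estimate for trigonometric solutions -/

/-- `u² + ∑ C_{jl}(t,t₁) ∂_j u ∂_l u`, where `C(t,t₁) = ∫_t^{t₁} cov`. -/
def bernstein (q : FrozenCoeff d) (t₁ : ℝ) (u : ℝ → Sm d) (t : ℝ) : Sm d :=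
  u t * u t + ∑ j, ∑ l, q.covI t t₁ j l • (smDeriv j (u t) * smDeriv l (u t))

/-- The time derivative of `bernstein` along a solution `u`. -/
def bernsteinDeriv (q : FrozenCoeff d) (t₁ : ℝ) (u : ℝ → Sm d) (t : ℝ) : Sm d :=
  (-gen q t (u t)) * u t + u t * (-gen q t (u t)) +
    ∑ j, ∑ l, ((-q.cov t j l) • (smDeriv j (u t) * smDeriv l (u t)) +
      q.covI t t₁ j l • ((-gen q t (smDeriv j (u t))) * smDeriv l (u t) +
        smDeriv j (u t) * (-gen q t (smDeriv l (u t)))))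

theorem bernstein_apply (q : FrozenCoeff d) (t₁ : ℝ) (u : ℝ → Sm d) (t : ℝ) (z : Space d) :
    (bernstein q t₁ u t : Space d → ℝ) z = (u t : Space d → ℝ) z * (u t : Space d → ℝ) z +
      ∑ j, ∑ l, q.covI t t₁ j l *
        ((smDeriv j (u t) : Space d → ℝ) z * (smDeriv l (u t) : Space d → ℝ) z) := by
  simp [bernstein]

theorem continuous_covI (q : FrozenCoeff d) (t₁ : ℝ) (j l : Fin (d + 1)) :
    Continuous fun t => q.covI t t₁ j l :=
  continuous_integral_left (q.continuous_cov j l) t₁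

section
variable {q : FrozenCoeff d} {T : ℝ} {u : ℝ → Sm d}

theorem hasDerivAt_bernstein (hu : u ∈ trigSol q T) (t₁ t : ℝ) (z : Space d) :
    HasDerivAt (fun s => (bernstein q t₁ u s : Space d → ℝ) z)
      ((bernsteinDeriv q t₁ u t : Space d → ℝ) z) t := by
  simp only [bernstein_apply]
  have h0 := trigSol_hasDerivAt hu t z
  have h1 := fun j => trigSol_hasDerivAt (trigSol_smDeriv hu j) t z
  have hc : ∀ j l, HasDerivAt (fun t => q.covI t t₁ j l) (-q.cov t j l) t := fun j l =>
    hasDerivAt_integral_left (q.continuous_cov j l) t₁ t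
  refine ((h0.mul h0).add (HasDerivAt.fun_sum fun j _ => HasDerivAt.fun_sum fun l _ =>
    (hc j l).mul ((h1 j).mul (h1 l)))).congr_deriv ?_
  simp only [bernsteinDeriv, Subalgebra.coe_add, Subalgebra.coe_mul, Subalgebra.coe_neg,
    Subalgebra.coe_smul, Sm.coe_sum, Pi.add_apply, Pi.mul_apply, Pi.neg_apply, Pi.smul_apply,
    smul_eq_mul]

/-- The key cancellation: applied to `u²`, the operator creates `∑ cov_{jl} ∂_j u ∂_l u`, exactly
the term produced with opposite sign by the time derivative of `C(t,t₁)`. What remains involves only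
second derivatives of `u`. -/
theorem gen_double_bernstein (t₁ t : ℝ) :
    gen q.double t (bernstein q t₁ u t) = -bernsteinDeriv q t₁ u t +
      ∑ j, ∑ l, q.covI t t₁ j l • gradForm q t (smDeriv j (u t)) (smDeriv l (u t)) := by
  simp only [bernstein, map_add, map_sum, map_smul, gen_double_mul]
  ext z
  simp only [bernsteinDeriv, gradForm, Subalgebra.coe_add, Subalgebra.coe_mul, Subalgebra.coe_neg,
    Subalgebra.coe_smul, Sm.coe_sum, Pi.add_apply, Pi.mul_apply, Pi.neg_apply, Pi.smul_apply,
    smul_eq_mul]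
  rw [neg_add, add_assoc (_ + _) _ _, add_assoc (-_) _ _]
  congr 1
  · ring
  · simp only [← Finset.sum_add_distrib, ← Finset.sum_neg_distrib]
    refine Finset.sum_congr rfl fun j _ => Finset.sum_congr rfl fun l _ => ?_
    ring

/-- With `H` the Hessian of `f`, this is the Frobenius product of `C(t,t₁)` and `Hᵀ cov H`, both
positive semidefinite. -/
theorem sum_covI_gradForm_nonneg {t t₁ : ℝ} (ht : t ≤ t₁) (f : Sm d) (z : Space d) :
    0 ≤ ((∑ j, ∑ l, q.covI t t₁ j l • gradForm q t (smDeriv j f) (smDeriv l f) : Sm d) :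
      Space d → ℝ) z := by
  let H : Matrix (Fin (d + 1)) (Fin (d + 1)) ℝ :=
    Matrix.of fun i j => (smDeriv i (smDeriv j f) : Space d → ℝ) z
  have h := sum_mul_nonneg_of_posSemidef (q.covI_posSemidef ht)
    ((q.posSemidef_cov t).conjTranspose_mul_mul_same H)
  refine h.trans_eq ?_
  simp only [Sm.coe_sum, Subalgebra.coe_smul, Pi.smul_apply, smul_eq_mul, gradForm,
    Subalgebra.coe_mul, Pi.mul_apply]
  refine Finset.sum_congr rfl fun j _ => Finset.sum_congr rfl fun l _ => ?_
  congr 1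
  simp only [Matrix.mul_apply, Matrix.conjTranspose_apply, star_trivial, H, Matrix.of_apply,
    Finset.sum_mul]
  rw [Finset.sum_comm]
  exact Finset.sum_congr rfl fun i _ => Finset.sum_congr rfl fun k _ => by ring

theorem FrozenCoeff.BoundedOn.double {B : ℝ} {s : Set ℝ} (hq : q.BoundedOn B s) :
    q.double.BoundedOn (2 * B) s where
  rate t ht := by
    have := hq.rate t ht
    simp only [FrozenCoeff.double, abs_mul, abs_two]
    linarith
  drift t ht j := by
    have := hq.drift t ht j
    have := (abs_nonneg _).trans this
    simp only [FrozenCoeff.double]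
    linarith
  cov t ht j := by
    have := hq.cov t ht j
    have := (abs_nonneg _).trans this
    simp only [FrozenCoeff.double]
    linarith

/-- The Bernstein function is a subsolution for the doubled rate, and `C(t₁,t₁) = 0` reduces it to
`u²` at the terminal time. No information on terminal derivatives enters. -/
theorem bernstein_le (hu : u ∈ trigSol q T) {t₀ t₁ B κ ε : ℝ}
    (hq : q.BoundedOn B (Icc t₀ t₁)) (hκ : 0 ≤ κ) (hε : 0 ≤ ε)
    (hterm : ∀ z, (u t₁ : Space d → ℝ) z ^ 2 ≤ ε * weight κ z) :
    ∀ t ∈ Icc t₀ t₁, ∀ z, (bernstein q t₁ u t : Space d → ℝ) z ≤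
      ε * (Real.exp (growthRate (2 * B) κ * (t₁ - t)) * weight κ z) := by
  refine le_barrier_of_subsolution q.double hq.double hκ hε
    (w' := fun t => bernsteinDeriv q t₁ u t) ?_ (fun t _ => Sm.contDiff_two _) ?_
    (fun t _ z => (hasDerivAt_bernstein hu t₁ t z).hasDerivWithinAt) ?_ ?_
  · simp only [bernstein_apply]
    have h1 := fun j => trigSol_continuous (trigSol_smDeriv hu j)
    have h2 := trigSol_continuous hu
    have h3 : ∀ j l, Continuous fun p : ℝ × Space d => q.covI p.1 t₁ j l := fun j l =>
      (continuous_covI q t₁ j l).comp continuous_fst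
    refine Continuous.continuousOn ?_
    exact (h2.mul h2).add (continuous_finsetSum _ fun j _ => continuous_finsetSum _ fun l _ =>
      (h3 j l).mul ((h1 j).mul (h1 l)))
  · obtain ⟨K₀, hK₀⟩ := trigSol_exists_bound hu t₀ t₁
    choose K₁ hK₁ using fun j => trigSol_exists_bound (trigSol_smDeriv hu j) t₀ t₁
    choose K₂ hK₂ using fun j l => isCompact_Icc.exists_bound_of_continuousOn (s := Icc t₀ t₁)
      (continuous_covI q t₁ j l).continuousOn
    refine ⟨K₀ * K₀ + ∑ j, ∑ l, K₂ j l * (K₁ j * K₁ l), 0, fun t ht z => ?_⟩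
    have hm : ∀ {a b x y : ℝ}, |a| ≤ x → |b| ≤ y → |a * b| ≤ x * y := fun {a b x y} h1 h2 => by
      rw [abs_mul]
      exact mul_le_mul h1 h2 (abs_nonneg _) ((abs_nonneg _).trans h1)
    rw [zero_mul, Real.exp_zero, mul_one, bernstein_apply]
    refine add_le_add ((le_abs_self _).trans (hm (hK₀ t ht z) (hK₀ t ht z)))
      (Finset.sum_le_sum fun j _ => Finset.sum_le_sum fun l _ => (le_abs_self _).trans
        (hm (hK₂ j l t ht) (hm (hK₁ j t ht z) (hK₁ l t ht z))))
  · intro t ht z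
    rw [← coe_gen, gen_double_bernstein]
    have := sum_covI_gradForm_nonneg (q := q) ht.2.le (u t) z
    simp only [Subalgebra.coe_add, Subalgebra.coe_neg, Pi.add_apply, Pi.neg_apply]
    linarith
  · intro z
    rw [bernstein_apply]
    simpa [FrozenCoeff.covI, ← sq] using hterm z

/-- Both summands of the Bernstein function are nonnegative, so each inherits its bound; a lower
bound on `C(t,t₁)` then extracts the individual first derivatives. -/
theorem sq_le_of_trigSol (hu : u ∈ trigSol q T) {t₀ t₁ B κ ε : ℝ}
    (hq : q.BoundedOn B (Icc t₀ t₁)) (hB : 0 ≤ B) (hκ : 0 ≤ κ) (hε : 0 ≤ ε)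
    (hterm : ∀ z, (u t₁ : Space d → ℝ) z ^ 2 ≤ ε * weight κ z) {t : ℝ} (ht : t ∈ Icc t₀ t₁)
    (z : Space d) :
    (u t : Space d → ℝ) z ^ 2 ≤ Real.exp (growthRate (2 * B) κ * (t₁ - t₀)) * ε * weight κ z ∧
      ∀ δ > 0, (∀ x : Space d, ∀ i, δ * x i ^ 2 ≤ ∑ j, ∑ l, q.covI t t₁ j l * (x j * x l)) →
        ∀ j, (smDeriv j (u t) : Space d → ℝ) z ^ 2 ≤
          δ⁻¹ * Real.exp (growthRate (2 * B) κ * (t₁ - t₀)) * ε * weight κ z := by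
  have h := bernstein_le hu hq hκ hε hterm t ht z
  rw [bernstein_apply] at h
  have hw := weight_pos κ z
  have hgr : 0 ≤ growthRate (2 * B) κ := by unfold growthRate; positivity
  have h1 : ε * (Real.exp (growthRate (2 * B) κ * (t₁ - t)) * weight κ z) ≤
      Real.exp (growthRate (2 * B) κ * (t₁ - t₀)) * ε * weight κ z := by
    rw [← mul_assoc, mul_comm ε]
    gcongr
    exact ht.1
  have h2 : 0 ≤ ∑ j, ∑ l, q.covI t t₁ j l *
      ((smDeriv j (u t) : Space d → ℝ) z * (smDeriv l (u t) : Space d → ℝ) z) := by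
    rw [← dotProduct_mulVec_eq_sum (q.covI t t₁) fun j => (smDeriv j (u t) : Space d → ℝ) z]
    exact (q.covI_posSemidef ht.2).dotProduct_mulVec_nonneg _
  rw [← sq] at h
  refine ⟨by linarith, fun δ hδ hlow j => ?_⟩
  have h3 := hlow (fun j => (smDeriv j (u t) : Space d → ℝ) z) j
  have h4 := sq_nonneg ((u t : Space d → ℝ) z)
  rw [mul_assoc, mul_assoc, ← mul_assoc (Real.exp _), ← div_eq_inv_mul, le_div_iff₀ hδ]
  linarith

/-- All derivatives of trigonometric solutions are controlled before the terminal time by the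
terminal value alone. -/
theorem exists_smMultiDeriv_sq_le {t₀ B κ : ℝ} (hq : q.BoundedOn B (Icc t₀ T)) (hB : 0 ≤ B)
    (hκ : 0 ≤ κ) (ht₀ : t₀ ≤ 0)
    (hC : ∀ t s : ℝ, 0 ≤ t → t < s → s ≤ T → (q.covI t s).PosDef) (β : MultiIndex d) :
    ∀ T' : ℝ, 0 ≤ T' → T' < T → ∃ K : ℝ, 0 ≤ K ∧ ∀ u ∈ trigSol q T, ∀ ε : ℝ, 0 ≤ ε →
      (∀ z, (u T : Space d → ℝ) z ^ 2 ≤ ε * weight κ z) → ∀ t ∈ Icc t₀ T', ∀ z,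
        (smMultiDeriv β (u t) : Space d → ℝ) z ^ 2 ≤ K * ε * weight κ z := by
  induction β using MultiIndex.induction with
  | h0 =>
    intro T' _ hT'
    refine ⟨Real.exp (growthRate (2 * B) κ * (T - t₀)), (Real.exp_pos _).le,
      fun u hu ε hε hterm t ht z => ?_⟩
    rw [smMultiDeriv, ordPow_zero]
    exact (sq_le_of_trigSol hu hq hB hκ hε hterm ⟨ht.1, ht.2.trans hT'.le⟩ z).1
  | h1 β j ih =>
    intro T' hT'0 hT'
    -- One derivative is gained per time interval: the lower-order bound is used at the midpoint of
    -- `T'` and `T`, which serves as terminal time for the next gradient estimate.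
    obtain ⟨K, hK0, hK⟩ := ih ((T' + T) / 2) (by linarith) (by linarith)
    obtain ⟨δ, hδ, hlow⟩ := exists_lower_bound_of_posDef
      (hC T' ((T' + T) / 2) hT'0 (by linarith) (by linarith))
    refine ⟨δ⁻¹ * Real.exp (growthRate (2 * B) κ * ((T' + T) / 2 - t₀)) * K, by positivity,
      fun u hu ε hε hterm t ht z => ?_⟩
    have h := (sq_le_of_trigSol (trigSol_smMultiDeriv hu β) (t₀ := t₀) (t₁ := (T' + T) / 2)
      (ε := K * ε) (t := t) ⟨fun t ht => hq.rate t ⟨ht.1, ht.2.trans (by linarith)⟩,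
        fun t ht => hq.drift t ⟨ht.1, ht.2.trans (by linarith)⟩,
        fun t ht => hq.cov t ⟨ht.1, ht.2.trans (by linarith)⟩⟩ hB hκ (by positivity)
      (fun z => hK u hu ε hε hterm _ ⟨by linarith, le_rfl⟩ z)
      ⟨ht.1, ht.2.trans (by linarith)⟩ z).2 δ hδ ?_ j
    · rw [smMultiDeriv_add_single]
      simpa [mul_assoc] using h
    · intro x i
      have h1 := hlow x i
      have h2 := (q.covI_posSemidef ht.2).dotProduct_mulVec_nonneg x
      rw [dotProduct_mulVec_eq_sum] at h2
      -- For `t ≤ T'` the form at `t` exceeds the one at `T'` by a positive semidefinite amount, so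
      -- a single `δ` serves all times, including negative ones where definiteness is not assumed.
      simp only [q.covI_add t T' ((T' + T) / 2), add_mul, Finset.sum_add_distrib]
      linarith

end

/-! ### Weighted density of trigonometric polynomials -/

/-- Linear combinations of the functions `cos (ξ · z + θ)`. -/
def trigPoly (d : ℕ) : Submodule ℝ (Space d → ℝ) :=
  Submodule.span ℝ (range fun p : Space d × ℝ => fun z => Real.cos (∑ j, p.1 j * z j + p.2))

theorem cos_mem_trigPoly (ξ : Space d) (θ : ℝ) :
    (fun z => Real.cos (∑ j, ξ j * z j + θ)) ∈ trigPoly d :=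
  Submodule.subset_span ⟨(ξ, θ), rfl⟩

theorem exists_trigSol_of_trigPoly (q : FrozenCoeff d) (T : ℝ) {p : Space d → ℝ}
    (hp : p ∈ trigPoly d) : ∃ u ∈ trigSol q T, (u T : Space d → ℝ) = p := by
  induction hp using Submodule.span_induction with
  | mem x hx =>
    obtain ⟨⟨ξ, θ⟩, rfl⟩ := hx
    refine ⟨wave q T ξ θ, Submodule.subset_span ⟨(ξ, θ), rfl⟩, ?_⟩
    ext z
    simp [wave]
  | zero => exact ⟨0, zero_mem _, rfl⟩
  | add x y _ _ hx hy =>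
    obtain ⟨u, hu, rfl⟩ := hx
    obtain ⟨v, hv, rfl⟩ := hy
    exact ⟨u + v, add_mem hu hv, rfl⟩
  | smul a x _ hx =>
    obtain ⟨u, hu, rfl⟩ := hx
    exact ⟨a • u, Submodule.smul_mem _ _ hu, rfl⟩

/-- The point of the torus with coordinates `z_j / (4R) + 1/4`. -/
def toTorus (R : ℝ) (z : Space d) : UnitAddTorus (Fin (d + 1)) :=
  fun j => ((z j / (4 * R) + 1 / 4 : ℝ) : UnitAddCircle)

/-- The map from the torus to the cube of radius `R` that inverts `toTorus R` on that cube. -/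
def ofTorus (R : ℝ) (x : UnitAddTorus (Fin (d + 1))) : Space d :=
  fun j => 4 * R * (‖x j‖ - 1 / 4)

theorem continuous_ofTorus (R : ℝ) : Continuous (ofTorus (d := d) R) := by
  unfold ofTorus
  fun_prop

theorem norm_ofTorus_le {R : ℝ} (hR : 0 < R) (x : UnitAddTorus (Fin (d + 1))) :
    ‖ofTorus R x‖ ≤ R := by
  refine (pi_norm_le_iff_of_nonneg hR.le).2 fun j => ?_
  have h1 : ‖x j‖ ≤ |(1 : ℝ)| / 2 := AddCircle.norm_le_half_period 1 one_ne_zero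
  have h2 := norm_nonneg (x j)
  rw [abs_one] at h1
  simp only [ofTorus, Real.norm_eq_abs]
  rw [abs_le]
  constructor <;> nlinarith

/-- On the cube, `z_j/(4R) + 1/4` lies in `[0,1/2]`, where the norm on the circle of length one is
the identity. Using the norm folds the circle onto an interval, so no periodicity is demanded of
functions pulled back from the cube. -/
theorem ofTorus_toTorus {R : ℝ} (hR : 0 < R) {z : Space d} (hz : ‖z‖ ≤ R) :
    ofTorus R (toTorus R z) = z := by
  ext j
  have h1 := abs_le.1 ((norm_le_pi_norm z j).trans hz)
  have h2 : -(1 / 4) ≤ z j / (4 * R) := by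
    rw [le_div_iff₀ (by positivity)]; linarith
  have h3 : z j / (4 * R) ≤ 1 / 4 := by
    rw [div_le_iff₀ (by positivity)]; linarith
  have h4 : ‖((z j / (4 * R) + 1 / 4 : ℝ) : UnitAddCircle)‖ = |z j / (4 * R) + 1 / 4| := by
    rw [AddCircle.norm_coe_eq_abs_iff 1 one_ne_zero, abs_one, abs_of_nonneg (by linarith)]
    linarith
  simp only [ofTorus, toTorus]
  rw [h4, abs_of_nonneg (by linarith)]
  field_simp
  ring

/-- Characters have real and imaginary parts that are cosines with a phase. Multiplication by
complex scalars mixes the two parts, so the induction must carry both. -/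
theorem trigPoly_of_mFourier_span (R : ℝ) {g : C(UnitAddTorus (Fin (d + 1)), ℂ)}
    (hg : g ∈ Submodule.span ℂ (range (UnitAddTorus.mFourier (d := Fin (d + 1))))) :
    (fun z => (g (toTorus R z)).re) ∈ trigPoly d ∧
      (fun z => (g (toTorus R z)).im) ∈ trigPoly d := by
  induction hg using Submodule.span_induction with
  | mem x hx =>
    obtain ⟨n, rfl⟩ := hx
    have h : ∀ z : Space d, UnitAddTorus.mFourier n (toTorus R z) = Complex.exp
        (((∑ j, (2 * Real.pi * n j / (4 * R)) * z j + ∑ j, 2 * Real.pi * n j / 4 : ℝ) : ℂ) *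
          Complex.I) := by
      intro z
      simp only [UnitAddTorus.mFourier, ContinuousMap.coe_mk, toTorus, fourier_coe_apply]
      rw [← Complex.exp_sum, ← Finset.sum_add_distrib]
      congr 1
      push_cast
      rw [Finset.sum_mul]
      refine Finset.sum_congr rfl fun j _ => ?_
      ring
    simp only [h, Complex.exp_ofReal_mul_I_re, Complex.exp_ofReal_mul_I_im]
    refine ⟨cos_mem_trigPoly _ _, ?_⟩
    simp only [← Real.cos_sub_pi_div_two, add_sub_assoc]
    exact cos_mem_trigPoly _ _
  | zero => exact ⟨(trigPoly d).zero_mem, (trigPoly d).zero_mem⟩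
  | add x y _ _ hx hy => exact ⟨add_mem hx.1 hy.1, add_mem hx.2 hy.2⟩
  | smul a x _ hx =>
    constructor
    · convert (trigPoly d).sub_mem ((trigPoly d).smul_mem a.re hx.1)
        ((trigPoly d).smul_mem a.im hx.2) using 1
      ext z
      simp
    · convert (trigPoly d).add_mem ((trigPoly d).smul_mem a.re hx.2)
        ((trigPoly d).smul_mem a.im hx.1) using 1
      ext z
      simp

theorem one_le_weight (κ : ℝ) (z : Space d) : 1 ≤ weight κ z :=
  (Real.one_le_cosh _).trans (Finset.single_le_sum (f := fun j => Real.cosh (κ * z j))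
    (fun _ _ => (Real.cosh_pos _).le) (Finset.mem_univ 0))

/-- Folding the torus onto a large cube turns `φ` into a continuous function on the torus, which
Fourier polynomials approximate uniformly. Outside the cube the approximant is close to a value of
`φ` inside it, and all terms are dominated by the weight because `κ > c`. -/
theorem exists_trigPoly_near {φ : Space d → ℝ} (hφ : Continuous φ) {K c κ ε : ℝ}
    (hgrowth : ∀ z, |φ z| ≤ K * Real.exp (c * ‖z‖)) (hc : 0 ≤ c) (hκ : c < κ) (hε : 0 < ε) :
    ∃ p ∈ trigPoly d, ∀ z, |φ z - p z| ≤ ε * weight κ z := by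
  -- The three summands account for `φ` at the point, `φ` at the folded point, and the uniform
  -- error.
  obtain ⟨R₀, hR₀⟩ := exists_radius_exp_le_weight (d := d) (hc.trans hκ.le) hκ (K + K + ε) hε
  have hK : 0 ≤ K := by
    have := (abs_nonneg _).trans (hgrowth 0)
    simpa using this
  let R : ℝ := max R₀ 1
  have hR : 0 < R := lt_max_of_lt_right one_pos
  let G : C(UnitAddTorus (Fin (d + 1)), ℂ) :=
    ⟨fun x => (φ (ofTorus R x) : ℂ),
      Complex.continuous_ofReal.comp (hφ.comp (continuous_ofTorus R))⟩
  have hG : G ∈ (Submodule.span ℂ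
      (range (UnitAddTorus.mFourier (d := Fin (d + 1))))).topologicalClosure := by
    rw [UnitAddTorus.span_mFourier_closure_eq_top]; trivial
  obtain ⟨g, hg, hgG⟩ := Metric.mem_closure_iff.1 hG ε hε
  refine ⟨_, (trigPoly_of_mFourier_span R hg).1, fun z => ?_⟩
  have h1 : |φ (ofTorus R (toTorus R z)) - (g (toTorus R z)).re| ≤ ε := by
    have h2 := (ContinuousMap.dist_apply_le_dist (f := G) (g := g) (toTorus R z)).trans hgG.le
    rw [dist_eq_norm] at h2
    have h3 := (Complex.abs_re_le_norm _).trans h2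
    simpa [G] using h3
  by_cases hz : ‖z‖ ≤ R
  · rw [ofTorus_toTorus hR hz] at h1
    exact h1.trans (le_mul_of_one_le_right hε.le (one_le_weight κ z))
  · push Not at hz
    have h2 := hgrowth z
    have h3 := hgrowth (ofTorus R (toTorus R z))
    have h4 : Real.exp (c * ‖ofTorus R (toTorus R z)‖) ≤ Real.exp (c * ‖z‖) :=
      Real.exp_le_exp.2 (mul_le_mul_of_nonneg_left ((norm_ofTorus_le hR _).trans hz.le) hc)
    have h5 : 1 ≤ Real.exp (c * ‖z‖) := Real.one_le_exp (by positivity)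
    have h6 := hR₀ z ((le_max_left _ _).trans hz.le)
    have h7 := mul_le_mul_of_nonneg_left h4 hK
    rw [abs_le] at h1 h2 h3 ⊢
    constructor <;> nlinarith

/-! ### Smoothness of solutions before the terminal time -/

/-- Cauchy–Schwarz together with `cosh² x ≤ cosh 2x`. It converts a weighted bound on a terminal
value into the bound on its square required by the Bernstein estimate. -/
theorem weight_sq_le (κ : ℝ) (z : Space d) :
    weight κ z ^ 2 ≤ (d + 1) * weight (2 * κ) z := by
  have h1 := sq_sum_le_card_mul_sum_sq (s := (Finset.univ : Finset (Fin (d + 1))))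
    (f := fun j => Real.cosh (κ * z j))
  have h2 : ∑ j, Real.cosh (κ * z j) ^ 2 ≤ weight (2 * κ) z := by
    refine Finset.sum_le_sum fun j _ => ?_
    rw [mul_assoc, Real.cosh_two_mul, Real.cosh_sq]
    nlinarith [sq_nonneg (Real.sinh (κ * z j))]
  refine h1.trans ?_
  rw [Finset.card_univ, Fintype.card_fin]
  push_cast
  gcongr

theorem exists_abs_smMultiDeriv_le {q : FrozenCoeff d} {T t₀ B κ : ℝ}
    (hq : q.BoundedOn B (Icc t₀ T)) (hB : 0 ≤ B) (hκ : 0 ≤ κ) (ht₀ : t₀ ≤ 0)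
    (hC : ∀ t s : ℝ, 0 ≤ t → t < s → s ≤ T → (q.covI t s).PosDef) (β : MultiIndex d)
    {T' : ℝ} (hT'0 : 0 ≤ T') (hT' : T' < T) :
    ∃ K : ℝ, 0 ≤ K ∧ ∀ u ∈ trigSol q T, ∀ ε : ℝ, 0 ≤ ε →
      (∀ z, |(u T : Space d → ℝ) z| ≤ ε * weight κ z) → ∀ t ∈ Icc t₀ T', ∀ z,
        |(smMultiDeriv β (u t) : Space d → ℝ) z| ≤ K * ε * weight (2 * κ) z := by
  obtain ⟨K, hK0, hK⟩ := exists_smMultiDeriv_sq_le hq hB (mul_nonneg zero_le_two hκ) ht₀ hC β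
    T' hT'0 hT'
  -- The added `1` gives `L ≤ (L + 1)²` for `L = K (d + 1)`; with `weight ≤ weight²` this avoids
  -- square roots.
  refine ⟨K * (d + 1) + 1, by positivity, fun u hu ε hε hterm t ht z => ?_⟩
  have h1 := hK u hu (ε ^ 2 * (d + 1)) (by positivity) (fun z => by
    rw [← sq_abs]
    calc _ ≤ (ε * weight κ z) ^ 2 := pow_le_pow_left₀ (abs_nonneg _) (hterm z) 2
      _ = ε ^ 2 * weight κ z ^ 2 := by ring
      _ ≤ ε ^ 2 * ((d + 1) * weight (2 * κ) z) := by gcongr; exact weight_sq_le κ z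
      _ = _ := by ring) t ht z
  have hw := one_le_weight (2 * κ) z
  have hw0 := weight_pos (2 * κ) z
  have hL : 0 ≤ K * (d + 1) := by positivity
  refine abs_le_of_sq_le_sq (h1.trans ?_) (by positivity)
  calc K * (ε ^ 2 * (d + 1)) * weight (2 * κ) z
      = ε ^ 2 * ((K * (d + 1)) * weight (2 * κ) z) := by ring
    _ ≤ ε ^ 2 * ((K * (d + 1) + 1) ^ 2 * weight (2 * κ) z ^ 2) := by
      gcongr
      · nlinarith
      · nlinarith
    _ = _ := by ring

/-- Solutions `V(t,·)`, `-1 < t < T`, of the homogeneous equation all of whose derivatives are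
jointly continuous, of exponential growth, and solutions themselves. -/
structure IsRegularSol (q : FrozenCoeff d) (T : ℝ) (V : ℝ → Sm d) : Prop where
  cont : ∀ β : MultiIndex d, ContinuousOn
    (fun p : ℝ × Space d => (smMultiDeriv β (V p.1) : Space d → ℝ) p.2) (Ioo (-1) T ×ˢ univ)
  growth : ∀ β : MultiIndex d, ∀ T' < T, ∃ K c : ℝ, ∀ t ∈ Icc 0 T', ∀ z,
    |(smMultiDeriv β (V t) : Space d → ℝ) z| ≤ K * Real.exp (c * ‖z‖)
  deriv : ∀ β : MultiIndex d, ∀ t ∈ Ioo (-1) T, ∀ z,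
    HasDerivAt (fun s => (smMultiDeriv β (V s) : Space d → ℝ) z)
      (-(smMultiDeriv β (gen q t (V t)) : Space d → ℝ) z) t

/-- Near a given point the times stay below the midpoint between `max t 0` and `T`, where one
constant `K` applies, and the weight is bounded on the unit ball around the spatial point. -/
theorem tendstoLocallyUniformlyOn_of_weighted_bound {E : Type*} [PseudoMetricSpace E] {T κ : ℝ}
    (hT : 0 < T) (hκ : 0 ≤ κ) {F : ℕ → ℝ × Space d → E} {G : ℝ × Space d → E}
    (h : ∀ T', 0 ≤ T' → T' < T → ∃ K : ℝ, 0 ≤ K ∧ ∀ N : ℕ, ∀ t ∈ Icc (-1) T', ∀ z,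
      dist (G (t, z)) (F N (t, z)) ≤ K * (2 / ((N : ℝ) + 1)) * weight κ z) :
    TendstoLocallyUniformlyOn F G Filter.atTop (Ioo (-1) T ×ˢ univ) := by
  rw [Metric.tendstoLocallyUniformlyOn_iff]
  rintro ε hε ⟨t, z⟩ ⟨ht, -⟩
  have hmax : max t 0 < T := max_lt ht.2 hT
  have h0 : 0 ≤ max t 0 := le_max_right _ _
  obtain ⟨K, hK0, hK⟩ := h ((max t 0 + T) / 2) (by linarith) (by linarith)
  refine ⟨(Ioo (-1) T ×ˢ univ) ∩ (Iio ((max t 0 + T) / 2) ×ˢ Metric.ball z 1),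
    inter_mem_nhdsWithin _ ((isOpen_Iio.prod Metric.isOpen_ball).mem_nhds
      ⟨?_, Metric.mem_ball_self one_pos⟩), ?_⟩
  · have := le_max_left t 0
    simp only [mem_Iio]
    linarith
  · let W : ℝ := (d + 1) * Real.exp (κ * (‖z‖ + 1))
    have hlim : Filter.Tendsto (fun N : ℕ => K * (2 / ((N : ℝ) + 1)) * W) Filter.atTop
        (nhds 0) := by
      have h1 : Filter.Tendsto (fun N : ℕ => 2 * (1 / ((N : ℝ) + 1))) Filter.atTop
          (nhds (2 * 0)) := tendsto_one_div_add_atTop_nhds_zero_nat.const_mul 2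
      have h2 := (h1.const_mul K).mul_const W
      simpa [div_eq_mul_inv] using h2
    filter_upwards [hlim.eventually (gt_mem_nhds hε)] with N hN
    rintro ⟨s, y⟩ ⟨⟨hs, -⟩, hs', hy⟩
    refine (hK N s ⟨hs.1.le, (mem_Iio.1 hs').le⟩ y).trans_lt (lt_of_le_of_lt ?_ hN)
    have hy' : ‖y‖ ≤ ‖z‖ + 1 := by
      have h1 := norm_sub_norm_le y z
      rw [← dist_eq_norm] at h1
      have h2 : dist y z < 1 := hy
      linarith
    have h3 : weight κ y ≤ W := (weight_le_exp_norm hκ y).trans (by simp only [W]; gcongr)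
    gcongr

theorem gen_comm_smMultiDeriv (q : FrozenCoeff d) (t : ℝ) (β : MultiIndex d) (f : Sm d) :
    smMultiDeriv β (gen q t f) = gen q t (smMultiDeriv β f) := by
  induction β using MultiIndex.induction with
  | h0 => rw [smMultiDeriv, ordPow_zero]; rfl
  | h1 β j ih =>
    rw [smMultiDeriv_add_single, Module.End.mul_apply, Module.End.mul_apply, ih]
    exact (LinearMap.congr_fun (gen_comm_smDeriv q t j).eq _).symm

theorem gen_smMultiDeriv_apply (q : FrozenCoeff d) (t : ℝ) (β : MultiIndex d) (f : Sm d)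
    (z : Space d) : (gen q t (smMultiDeriv β f) : Space d → ℝ) z =
      q.rate t * (smMultiDeriv β f : Space d → ℝ) z +
      ∑ j, q.drift t j * (smMultiDeriv (β + Pi.single j 1) f : Space d → ℝ) z +
      (1 / 2) * ∑ j, ∑ l, q.cov t j l *
        (smMultiDeriv (β + Pi.single l 1 + Pi.single j 1) f : Space d → ℝ) z := by
  simp only [coe_gen, genFn, smMultiDeriv_add_single, Module.End.mul_apply, coe_smDeriv]

theorem hasFDerivAt_of_smDeriv (f : Sm d) (z : Space d) :
    HasFDerivAt (f : Space d → ℝ) (∑ j, (smDeriv j f : Space d → ℝ) z •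
      (ContinuousLinearMap.proj j : Space d →L[ℝ] ℝ)) z := by
  suffices h : ∑ j, (smDeriv j f : Space d → ℝ) z •
      (ContinuousLinearMap.proj j : Space d →L[ℝ] ℝ) = fderiv ℝ f z by
    rw [h]; exact (f.differentiable z).hasFDerivAt
  refine ContinuousLinearMap.ext fun x => ?_
  conv_rhs => rw [← Finset.univ_sum_single x]
  rw [map_sum]
  simp only [sum_apply, smul_apply, ContinuousLinearMap.proj_apply, smul_eq_mul, coe_smDeriv,
    partialDeriv]
  refine Finset.sum_congr rfl fun j _ => ?_
  have : (Pi.single j (x j) : Space d) = x j • Pi.single j 1 := by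
    rw [← Pi.single_smul, smul_eq_mul, mul_one]
  rw [this, map_smul, smul_eq_mul, mul_comm]

/-- A sequence of trigonometric solutions whose terminal values converge in a weighted norm
converges to a regular solution. -/
theorem exists_isRegularSol_of_cauchy {q : FrozenCoeff d} {T B κ : ℝ} (hT : 0 < T)
    (hq : q.BoundedOn B (Icc (-1) T)) (hB : 0 ≤ B) (hκ : 0 ≤ κ)
    (hC : ∀ t s : ℝ, 0 ≤ t → t < s → s ≤ T → (q.covI t s).PosDef)
    {u : ℕ → ℝ → Sm d} (hu : ∀ N, u N ∈ trigSol q T)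
    (hcauchy : ∀ N M, N ≤ M → ∀ z, |(u N T : Space d → ℝ) z - (u M T : Space d → ℝ) z| ≤
      (2 / ((N : ℝ) + 1)) * weight κ z) :
    ∃ V : ℝ → Sm d, IsRegularSol q T V ∧ ∀ t ∈ Ioo (-1) T, ∀ z,
      Filter.Tendsto (fun N => (u N t : Space d → ℝ) z) Filter.atTop
        (nhds ((V t : Space d → ℝ) z)) := by
  have hdiff : ∀ β : MultiIndex d, ∀ T', 0 ≤ T' → T' < T → ∃ K : ℝ, 0 ≤ K ∧ ∀ N M, N ≤ M →
      ∀ t ∈ Icc (-1) T', ∀ z, |(smMultiDeriv β (u N t) : Space d → ℝ) z -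
        (smMultiDeriv β (u M t) : Space d → ℝ) z| ≤
          K * (2 / ((N : ℝ) + 1)) * weight (2 * κ) z := by
    intro β T' h0 hT'
    obtain ⟨K, hK0, hK⟩ := exists_abs_smMultiDeriv_le hq hB hκ (by norm_num) hC β h0 hT'
    refine ⟨K, hK0, fun N M hNM t ht z => ?_⟩
    -- Linearity: the difference is again a trigonometric solution, so its derivatives are
    -- controlled by its terminal value.
    have h := hK (u N - u M) (sub_mem (hu N) (hu M)) _ (by positivity) (hcauchy N M hNM) t ht z
    have e : smMultiDeriv β ((u N - u M) t) =
        smMultiDeriv β (u N t) - smMultiDeriv β (u M t) := map_sub _ _ _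
    rw [e] at h
    exact h
  have hrate : ∀ L : ℝ, Filter.Tendsto (fun N : ℕ => L * (2 / ((N : ℝ) + 1))) Filter.atTop
      (nhds 0) := by
    intro L
    have h1 : Filter.Tendsto (fun N : ℕ => 2 * (1 / ((N : ℝ) + 1))) Filter.atTop
        (nhds (2 * 0)) := tendsto_one_div_add_atTop_nhds_zero_nat.const_mul 2
    simpa [div_eq_mul_inv] using h1.const_mul L
  -- Limits of all derivatives are selected at once; `w β` is the candidate for `∂^β` of the limit,
  -- with no meaning outside the time interval.
  have hex : ∀ (β : MultiIndex d) (p : ℝ × Space d), ∃ l : ℝ, p.1 ∈ Ico (-1) T → Filter.Tendsto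
      (fun N => (smMultiDeriv β (u N p.1) : Space d → ℝ) p.2) Filter.atTop (nhds l) := by
    rintro β ⟨t, z⟩
    by_cases ht : t ∈ Ico (-1) T
    · obtain ⟨K, hK0, hK⟩ := hdiff β (max t 0) (le_max_right _ _) (max_lt ht.2 hT)
      have hc : CauchySeq fun N => (smMultiDeriv β (u N t) : Space d → ℝ) z := by
        refine cauchySeq_of_le_tendsto_0'
          (fun N : ℕ => K * weight (2 * κ) z * (2 / ((N : ℝ) + 1))) (fun N M hNM => ?_) (hrate _)
        rw [Real.dist_eq]
        exact (hK N M hNM t ⟨ht.1, le_max_left _ _⟩ z).trans_eq (by ring)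
      obtain ⟨l, hl⟩ := cauchySeq_tendsto_of_complete hc
      exact ⟨l, fun _ => hl⟩
    · exact ⟨0, fun h => absurd h ht⟩
  choose w hw using hex
  have hlim : ∀ β, ∀ t ∈ Ico (-1) T, ∀ z, Filter.Tendsto
      (fun N => (smMultiDeriv β (u N t) : Space d → ℝ) z) Filter.atTop (nhds (w β (t, z))) :=
    fun β t ht z => hw β (t, z) ht
  have hbound : ∀ β : MultiIndex d, ∀ T', 0 ≤ T' → T' < T → ∃ K : ℝ, 0 ≤ K ∧ ∀ N : ℕ,
      ∀ t ∈ Icc (-1) T', ∀ z, |w β (t, z) - (smMultiDeriv β (u N t) : Space d → ℝ) z| ≤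
          K * (2 / ((N : ℝ) + 1)) * weight (2 * κ) z := by
    intro β T' h0 hT'
    obtain ⟨K, hK0, hK⟩ := hdiff β T' h0 hT'
    refine ⟨K, hK0, fun N t ht z => ?_⟩
    refine le_of_tendsto
      ((hlim β t ⟨ht.1, ht.2.trans_lt hT'⟩ z).sub_const _).abs ?_
    filter_upwards [Filter.eventually_ge_atTop N] with M hM
    rw [abs_sub_comm]
    exact hK N M hM t ht z
  have hκ2 : 0 ≤ 2 * κ := by positivity
  have hopen : IsOpen (Ioo (-1) T ×ˢ (univ : Set (Space d))) := isOpen_Ioo.prod isOpen_univ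
  have hcontw : ∀ β, ContinuousOn (w β) (Ioo (-1) T ×ˢ univ) := fun β =>
    (tendstoLocallyUniformlyOn_of_weighted_bound hT hκ2
      (F := fun N p => (smMultiDeriv β (u N p.1) : Space d → ℝ) p.2) (G := w β)
      fun T' h0 hT' => hbound β T' h0 hT').continuousOn
      (Filter.Frequently.of_forall fun N =>
        (trigSol_continuous (trigSol_smMultiDeriv (hu N) β)).continuousOn)
  -- Locally uniform convergence of the gradients identifies the derivatives of `w β` with the
  -- limits at the next multi-indices.
  have hfderiv : ∀ β, ∀ t ∈ Ioo (-1) T, ∀ z, HasFDerivAt (fun z => w β (t, z))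
      (∑ j, w (β + Pi.single j 1) (t, z) • (ContinuousLinearMap.proj j : Space d →L[ℝ] ℝ)) z := by
    intro β t ht z
    have hLU := tendstoLocallyUniformlyOn_of_weighted_bound hT hκ2
      (F := fun N p => ∑ j, (smMultiDeriv (β + Pi.single j 1) (u N p.1) : Space d → ℝ) p.2 •
        (ContinuousLinearMap.proj j : Space d →L[ℝ] ℝ))
      (G := fun p => ∑ j, w (β + Pi.single j 1) p •
        (ContinuousLinearMap.proj j : Space d →L[ℝ] ℝ)) (by
      intro T' h0 hT'
      choose K hK0 hK using fun j : Fin (d + 1) => hbound (β + Pi.single j 1) T' h0 hT'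
      refine ⟨∑ j, K j * ‖(ContinuousLinearMap.proj j : Space d →L[ℝ] ℝ)‖,
        Finset.sum_nonneg fun j _ => mul_nonneg (hK0 j) (norm_nonneg _), fun N t ht z => ?_⟩
      rw [dist_eq_norm, ← Finset.sum_sub_distrib, Finset.sum_mul, Finset.sum_mul]
      refine (norm_sum_le _ _).trans (Finset.sum_le_sum fun j _ => ?_)
      have e : ∀ (a b : ℝ) (P : Space d →L[ℝ] ℝ), ‖a • P - b • P‖ = |a - b| * ‖P‖ :=
        fun a b P => by
          have h : a • P - b • P = (a - b) • P := (sub_smul a b P).symm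
          rw [h, norm_smul, Real.norm_eq_abs]
      refine (e _ _ _).trans_le ?_
      calc _ ≤ K j * (2 / ((N : ℝ) + 1)) * weight (2 * κ) z *
            ‖(ContinuousLinearMap.proj j : Space d →L[ℝ] ℝ)‖ :=
            mul_le_mul_of_nonneg_right (hK j N t ht z) (norm_nonneg _)
        _ = _ := by ring)
    have hLU' := hLU.comp (t := univ) (fun z : Space d => (t, z)) (fun z _ => ⟨ht, mem_univ z⟩)
      (Continuous.prodMk_right t).continuousOn
    refine hasFDerivAt_of_tendstoLocallyUniformlyOn isOpen_univ hLU'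
      (f := fun N z => (smMultiDeriv β (u N t) : Space d → ℝ) z) (fun N z _ => ?_)
      (fun z _ => hlim β t ⟨ht.1.le, ht.2⟩ z) (mem_univ z)
    have := hasFDerivAt_of_smDeriv (smMultiDeriv β (u N t)) z
    simpa only [Function.comp_apply, smMultiDeriv_add_single, Module.End.mul_apply] using this
  have hsmooth : ∀ t ∈ Ioo (-1) T, ∀ n : ℕ, ∀ β, ContDiff ℝ n fun z => w β (t, z) := by
    intro t ht n
    induction n with
    | zero =>
      intro β
      exact contDiff_zero.2 (continuous_iff_continuousAt.2 fun z =>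
        (hfderiv β t ht z).continuousAt)
    | succ n ih =>
      intro β
      push_cast
      exact contDiff_succ_iff_hasFDerivAt.2 ⟨_, ContDiff.sum fun j _ =>
        (ih (β + Pi.single j 1)).smul contDiff_const, hfderiv β t ht⟩
  classical
  let V : ℝ → Sm d := fun t => if ht : t ∈ Ioo (-1) T then
    ⟨fun z => w 0 (t, z), mem_smoothAlg.2 (contDiff_infty.2 fun n => hsmooth t ht n 0)⟩ else 0
  have hV : ∀ β, ∀ t ∈ Ioo (-1) T, ∀ z,
      (smMultiDeriv β (V t) : Space d → ℝ) z = w β (t, z) := by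
    intro β t ht
    induction β using MultiIndex.induction with
    | h0 =>
      intro z
      rw [smMultiDeriv, ordPow_zero, Module.End.one_apply]
      simp only [V]
      rw [dif_pos ht]
    | h1 β j ih =>
      intro z
      rw [smMultiDeriv_add_single, Module.End.mul_apply, coe_smDeriv]
      have : (smMultiDeriv β (V t) : Space d → ℝ) = fun z => w β (t, z) := funext ih
      rw [this]
      simp only [partialDeriv]
      rw [(hfderiv β t ht z).fderiv]
      simp [Pi.single_apply]
  refine ⟨V, ⟨fun β => ?_, fun β T' hT' => ?_, fun β t ht z => ?_⟩, fun t ht z => ?_⟩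
  · exact (hcontw β).congr fun p hp => hV β p.1 hp.1 p.2
  · rcases lt_or_ge T' 0 with hneg | h0
    · exact ⟨0, 0, fun t ht => absurd (ht.1.trans ht.2) (not_le.2 hneg)⟩
    obtain ⟨K, hK0, hK⟩ := hbound β T' h0 hT'
    obtain ⟨K', hK'⟩ := trigSol_exists_bound (trigSol_smMultiDeriv (hu 0) β) 0 T'
    refine ⟨K' + K * 2 * (d + 1), 2 * κ, fun t ht z => ?_⟩
    have ht' : t ∈ Icc (-1) T' := ⟨by linarith [ht.1], ht.2⟩
    rw [hV β t ⟨by linarith [ht.1], ht.2.trans_lt hT'⟩ z]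
    have h1 := hK 0 t ht' z
    have h2 := hK' t ht z
    have h3 := weight_le_exp_norm hκ2 z
    have h4 : 1 ≤ Real.exp (2 * κ * ‖z‖) := Real.one_le_exp (by positivity)
    have h5 := abs_sub_abs_le_abs_sub (w β (t, z)) ((smMultiDeriv β (u 0 t) : Space d → ℝ) z)
    simp only [CharP.cast_eq_zero, zero_add, div_one] at h1
    have h6 := (abs_nonneg _).trans h2
    have h7 := mul_le_mul_of_nonneg_left h3 (mul_nonneg hK0 zero_le_two)
    have h8 := mul_le_mul_of_nonneg_left h4 h6
    nlinarith
  -- The time derivatives `-gen` of the approximants are combinations, with bounded coefficients, of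
  -- finitely many spatial derivatives, so they converge locally uniformly as well.
  · have hLU := tendstoLocallyUniformlyOn_of_weighted_bound hT hκ2
      (F := fun N p => -(gen q p.1 (smMultiDeriv β (u N p.1)) : Space d → ℝ) p.2)
      (G := fun p => -(q.rate p.1 * w β p + ∑ j, q.drift p.1 j * w (β + Pi.single j 1) p +
        (1 / 2) * ∑ j, ∑ l, q.cov p.1 j l * w (β + Pi.single l 1 + Pi.single j 1) p)) (by
      intro T' h0 hT'
      obtain ⟨K₀, hK₀0, hK₀⟩ := hbound β T' h0 hT'
      choose K₁ hK₁0 hK₁ using fun j : Fin (d + 1) => hbound (β + Pi.single j 1) T' h0 hT'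
      choose K₂ hK₂0 hK₂ using fun j l : Fin (d + 1) =>
        hbound (β + Pi.single l 1 + Pi.single j 1) T' h0 hT'
      choose A hA using fun j l => isCompact_Icc.exists_bound_of_continuousOn
        (s := Icc (-1) T') (q.continuous_cov j l).continuousOn
      have hA0 : ∀ j l, 0 ≤ A j l := fun j l =>
        (norm_nonneg _).trans (hA j l 0 ⟨by norm_num, h0⟩)
      refine ⟨B * K₀ + ∑ j, B * K₁ j + (1 / 2) * ∑ j, ∑ l, A j l * K₂ j l,
        add_nonneg (add_nonneg (by positivity)
          (Finset.sum_nonneg fun j _ => mul_nonneg hB (hK₁0 j)))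
          (mul_nonneg (by norm_num) (Finset.sum_nonneg fun j _ => Finset.sum_nonneg fun l _ =>
            mul_nonneg (hA0 j l) (hK₂0 j l))), fun N t ht z => ?_⟩
      have htT : t ∈ Icc (-1) T := ⟨ht.1, ht.2.trans hT'.le⟩
      have hmul : ∀ {a x b y X : ℝ}, |a| ≤ b → |x - y| ≤ X → |a * x - a * y| ≤ b * X :=
        fun {a x b y X} h1 h2 => by
          rw [← mul_sub, abs_mul]
          exact mul_le_mul h1 h2 (abs_nonneg _) ((abs_nonneg _).trans h1)
      rw [Real.dist_eq, gen_smMultiDeriv_apply, neg_sub_neg, abs_sub_comm, add_mul, add_mul,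
        add_mul, add_mul]
      have e : ∀ a b c a' b' c' : ℝ, (a + b + 1 / 2 * c) - (a' + b' + 1 / 2 * c') =
        (a - a') + (b - b') + 1 / 2 * (c - c') := by intros; ring
      rw [e]
      refine (abs_add_le _ _).trans (add_le_add ((abs_add_le _ _).trans (add_le_add ?_ ?_)) ?_)
      · exact (hmul (hq.rate t htT) (hK₀ N t ht z)).trans_eq (by ring)
      · rw [← Finset.sum_sub_distrib, Finset.sum_mul, Finset.sum_mul]
        refine (Finset.abs_sum_le_sum_abs _ _).trans (Finset.sum_le_sum fun j _ => ?_)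
        exact (hmul (hq.drift t htT j) (hK₁ j N t ht z)).trans_eq (by ring)
      · rw [abs_mul, abs_of_pos (by norm_num : (0 : ℝ) < 1 / 2), mul_assoc, mul_assoc]
        refine mul_le_mul_of_nonneg_left ?_ (by norm_num)
        rw [← Finset.sum_sub_distrib, Finset.sum_mul]
        refine (Finset.abs_sum_le_sum_abs _ _).trans (Finset.sum_le_sum fun j _ => ?_)
        rw [← Finset.sum_sub_distrib, Finset.sum_mul]
        refine (Finset.abs_sum_le_sum_abs _ _).trans (Finset.sum_le_sum fun l _ => ?_)
        exact (hmul (hA j l t ht) (hK₂ j l N t ht z)).trans_eq (by ring))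
    have hLU' := hLU.comp (t := Ioo (-1) T) (fun s : ℝ => (s, z)) (fun s hs => ⟨hs, mem_univ z⟩)
      (Continuous.prodMk_left z).continuousOn
    have hd : HasDerivAt (fun s => w β (s, z)) _ t :=
      hasDerivAt_of_tendstoLocallyUniformlyOn isOpen_Ioo hLU'
        (f := fun N s => (smMultiDeriv β (u N s) : Space d → ℝ) z)
        (Filter.Eventually.of_forall fun N s _ =>
          trigSol_hasDerivAt (trigSol_smMultiDeriv (hu N) β) s z)
        (fun s hs => hlim β s ⟨hs.1.le, hs.2⟩ z) ht
    refine (hd.congr_of_eventuallyEq ?_).congr_deriv ?_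
    · filter_upwards [isOpen_Ioo.mem_nhds ht] with s hs using hV β s hs z
    · rw [gen_comm_smMultiDeriv, gen_smMultiDeriv_apply]
      simp only [hV _ t ht, Function.comp_apply]
  · have h := hlim 0 t ⟨ht.1.le, ht.2⟩ z
    rw [← hV 0 t ht z] at h
    simpa [ordPow_zero] using h

/-- A classical solution of the homogeneous equation is smooth before the terminal time. -/
theorem exists_isRegularSol_eq {q : FrozenCoeff d} {T B : ℝ} (hT : 0 < T)
    (hq : q.BoundedOn B (Icc (-1) T))
    (hC : ∀ t s : ℝ, 0 ≤ t → t < s → s ≤ T → (q.covI t s).PosDef)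
    {v : ℝ → Space d → ℝ}
    (hcont : ContinuousOn (fun p : ℝ × Space d => v p.1 p.2) (Icc 0 T ×ˢ univ))
    (hC2 : ∀ t ∈ Ico 0 T, ContDiff ℝ 2 (v t))
    (hgrowth : ∃ K c : ℝ, ∀ t ∈ Icc 0 T, ∀ z, |v t z| ≤ K * Real.exp (c * ‖z‖))
    (hd : ∀ t ∈ Ico 0 T, ∀ z,
      HasDerivWithinAt (fun s => v s z) (-genFn q t (v t) z) (Icc 0 T) t) :
    ∃ V : ℝ → Sm d, IsRegularSol q T V ∧ ∀ t ∈ Ico 0 T, (V t : Space d → ℝ) = v t := by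
  have hB : 0 ≤ B := (abs_nonneg _).trans (hq.rate T ⟨by linarith, le_rfl⟩)
  have hTI : T ∈ Icc 0 T := ⟨hT.le, le_rfl⟩
  obtain ⟨K, c, hKc⟩ := hgrowth
  have hK : 0 ≤ K := by
    have := (abs_nonneg _).trans (hKc T hTI 0)
    simpa using this
  let c' : ℝ := max c 0
  let κ : ℝ := c' + 1
  have hc' : 0 ≤ c' := le_max_right _ _
  have hκ : 0 ≤ κ := by positivity
  have hφ : Continuous (v T) :=
    (hcont.comp_continuous (Continuous.prodMk_right T) fun z => ⟨hTI, mem_univ z⟩)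
  have hφg : ∀ z, |v T z| ≤ K * Real.exp (c' * ‖z‖) := fun z =>
    (hKc T hTI z).trans (by gcongr; exact le_max_left _ _)
  have happ : ∀ N : ℕ, ∃ u ∈ trigSol q T, ∀ z,
      |v T z - (u T : Space d → ℝ) z| ≤ (1 / ((N : ℝ) + 1)) * weight κ z := by
    intro N
    obtain ⟨p, hp, hpz⟩ := exists_trigPoly_near hφ hφg hc' (lt_add_one c')
      (Nat.one_div_pos_of_nat (α := ℝ) (n := N))
    obtain ⟨u, hu, rfl⟩ := exists_trigSol_of_trigPoly q T hp
    exact ⟨u, hu, hpz⟩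
  choose u hu hunear using happ
  obtain ⟨V, hV, hVlim⟩ := exists_isRegularSol_of_cauchy hT hq hB hκ hC hu (by
    intro N M hNM z
    have h1 := hunear N z
    have h2 := hunear M z
    have h3 : (1 / ((M : ℝ) + 1)) * weight κ z ≤ (1 / ((N : ℝ) + 1)) * weight κ z :=
      mul_le_mul_of_nonneg_right (Nat.one_div_le_one_div hNM) (weight_pos _ _).le
    have h4 : 2 / ((N : ℝ) + 1) * weight κ z = 2 * (1 / ((N : ℝ) + 1) * weight κ z) := by ring
    rw [h4]
    rw [abs_le] at h1 h2 ⊢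
    constructor <;> linarith)
  refine ⟨V, hV, fun t ht => funext fun z => ?_⟩
  refine tendsto_nhds_unique (hVlim t ⟨by linarith [ht.1], ht.2⟩ z) ?_
  -- The signs `σ = 1` and `σ = -1` turn the one-sided maximum principle into a two-sided bound on
  -- the difference from the approximating solutions.
  have hmp : ∀ N : ℕ, ∀ σ : ℝ, |σ| = 1 → σ * (v t z - (u N t : Space d → ℝ) z) ≤
      (1 / ((N : ℝ) + 1)) * (Real.exp (growthRate B κ * (T - t)) * weight κ z) := by
    intro N σ hσ
    have hsm : ∀ s ∈ Ico 0 T, (fun z => σ * (v s z - (u N s : Space d → ℝ) z)) =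
        σ • (v s + (-1 : ℝ) • (u N s : Space d → ℝ)) := fun s _ => by
      ext z
      simp only [Pi.smul_apply, Pi.add_apply, smul_eq_mul]
      ring
    refine le_barrier_of_subsolution q (t₀ := 0) (t₁ := T) (B := B)
      ⟨fun t ht => hq.rate t ⟨by linarith [ht.1], ht.2⟩,
        fun t ht => hq.drift t ⟨by linarith [ht.1], ht.2⟩,
        fun t ht => hq.cov t ⟨by linarith [ht.1], ht.2⟩⟩ hκ
      Nat.one_div_pos_of_nat.le (w := fun s z => σ * (v s z - (u N s : Space d → ℝ) z))
      (w' := fun s z => σ * (-genFn q s (v s) z - -(gen q s (u N s) : Space d → ℝ) z))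
      ?_ ?_ ?_ ?_ ?_ ?_ t ⟨ht.1, ht.2.le⟩ z
    · exact continuousOn_const.mul (hcont.sub (trigSol_continuous (hu N)).continuousOn)
    · intro s hs
      exact contDiff_const.mul ((hC2 s hs).sub (Sm.contDiff_two _))
    · obtain ⟨K', hK'⟩ := trigSol_exists_bound (hu N) 0 T
      refine ⟨K + K', c', fun s hs x => ?_⟩
      have h1 := hKc s hs x
      have h2 := hK' s hs x
      have h3 : 1 ≤ Real.exp (c' * ‖x‖) := Real.one_le_exp (by positivity)
      have h4 : K * Real.exp (c * ‖x‖) ≤ K * Real.exp (c' * ‖x‖) := by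
        gcongr; exact le_max_left _ _
      have h5 := (abs_nonneg _).trans h2
      have h6 := mul_le_mul_of_nonneg_left h3 h5
      calc σ * (v s x - (u N s : Space d → ℝ) x)
          ≤ |σ * (v s x - (u N s : Space d → ℝ) x)| := le_abs_self _
        _ = |v s x - (u N s : Space d → ℝ) x| := by rw [abs_mul, hσ, one_mul]
        _ ≤ |v s x| + |(u N s : Space d → ℝ) x| := abs_sub _ _
        _ ≤ _ := by linarith
    · intro s hs x
      exact ((hd s hs x).sub (trigSol_hasDerivAt (hu N) s x).hasDerivWithinAt).const_mul σ
    · intro s hs x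
      have h2 : ContDiff ℝ 2 ((-1 : ℝ) • (u N s : Space d → ℝ)) :=
        contDiff_const.smul (Sm.contDiff_two _)
      have h3 : ContDiff ℝ 2 (v s + (-1 : ℝ) • (u N s : Space d → ℝ)) := (hC2 s hs).add h2
      rw [hsm s hs, genFn_smul q s σ h3, genFn_add q s (hC2 s hs) h2,
        genFn_smul q s _ (Sm.contDiff_two _), coe_gen]
      linarith
    · intro x
      have h1 := hunear N x
      calc σ * (v T x - (u N T : Space d → ℝ) x)
          ≤ |σ * (v T x - (u N T : Space d → ℝ) x)| := le_abs_self _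
        _ = |v T x - (u N T : Space d → ℝ) x| := by rw [abs_mul, hσ, one_mul]
        _ ≤ _ := h1
  rw [tendsto_iff_dist_tendsto_zero]
  have hzero : Filter.Tendsto (fun N : ℕ => (1 / ((N : ℝ) + 1)) *
      (Real.exp (growthRate B κ * (T - t)) * weight κ z)) Filter.atTop (nhds 0) := by
    simpa only [zero_mul] using tendsto_one_div_add_atTop_nhds_zero_nat.mul_const
      (Real.exp (growthRate B κ * (T - t)) * weight κ z)
  refine squeeze_zero (fun _ => dist_nonneg) (fun N => ?_) hzero
  have h1 := hmp N 1 (by simp)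
  have h2 := hmp N (-1) (by simp)
  rw [Real.dist_eq, abs_le]
  constructor <;> linarith

/-! ### Differential operators with polynomial coefficients -/

/-- Polynomials in the coordinates. -/
def polyAlg (d : ℕ) : Subalgebra ℝ (Sm d) := Algebra.adjoin ℝ (range coordFn)

theorem coordFn_mem_polyAlg (j : Fin (d + 1)) : coordFn j ∈ polyAlg d :=
  Algebra.subset_adjoin ⟨j, rfl⟩

theorem smDeriv_mem_polyAlg (j : Fin (d + 1)) {p : Sm d} (hp : p ∈ polyAlg d) :
    smDeriv j p ∈ polyAlg d := by
  induction hp using Algebra.adjoin_induction with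
  | mem x hx =>
    obtain ⟨l, rfl⟩ := hx
    rw [smDeriv_coordFn]
    split_ifs
    · exact one_mem _
    · exact zero_mem _
  | algebraMap r =>
    rw [Algebra.algebraMap_eq_smul_one, map_smul, smDeriv_one, smul_zero]
    exact zero_mem _
  | add x y _ _ hx hy => rw [map_add]; exact add_mem hx hy
  | mul x y hx' hy' hx hy =>
    rw [smDeriv_mul]
    exact add_mem (mul_mem hx' hy) (mul_mem hy' hx)

theorem exists_growth_of_polyAlg {p : Sm d} (hp : p ∈ polyAlg d) :
    ∃ K c : ℝ, ∀ z, |(p : Space d → ℝ) z| ≤ K * Real.exp (c * ‖z‖) := by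
  induction hp using Algebra.adjoin_induction with
  | mem x hx =>
    obtain ⟨l, rfl⟩ := hx
    refine ⟨1, 1, fun z => ?_⟩
    rw [one_mul, one_mul, coordFn_apply]
    have h1 : |z l| ≤ ‖z‖ := norm_le_pi_norm z l
    have h2 := Real.add_one_le_exp ‖z‖
    linarith
  | algebraMap r => exact ⟨|r|, 0, fun z => by simp [Algebra.algebraMap_eq_smul_one]⟩
  | add x y _ _ hx hy =>
    obtain ⟨K, c, h⟩ := hx
    obtain ⟨K', c', h'⟩ := hy
    refine ⟨|K| + |K'|, max c c', fun z => ?_⟩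
    have e1 : Real.exp (c * ‖z‖) ≤ Real.exp (max c c' * ‖z‖) :=
      Real.exp_le_exp.2 (mul_le_mul_of_nonneg_right (le_max_left _ _) (norm_nonneg _))
    have e2 : Real.exp (c' * ‖z‖) ≤ Real.exp (max c c' * ‖z‖) :=
      Real.exp_le_exp.2 (mul_le_mul_of_nonneg_right (le_max_right _ _) (norm_nonneg _))
    calc |(x : Space d → ℝ) z + (y : Space d → ℝ) z|
        ≤ K * Real.exp (c * ‖z‖) + K' * Real.exp (c' * ‖z‖) :=
          (abs_add_le _ _).trans (add_le_add (h z) (h' z))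
      _ ≤ |K| * Real.exp (c * ‖z‖) + |K'| * Real.exp (c' * ‖z‖) := by
          gcongr <;> exact le_abs_self _
      _ ≤ |K| * Real.exp (max c c' * ‖z‖) + |K'| * Real.exp (max c c' * ‖z‖) := by gcongr
      _ = _ := by ring
  | mul x y _ _ hx hy =>
    obtain ⟨K, c, h⟩ := hx
    obtain ⟨K', c', h'⟩ := hy
    refine ⟨K * K', c + c', fun z => ?_⟩
    calc |(x : Space d → ℝ) z * (y : Space d → ℝ) z|
        ≤ (K * Real.exp (c * ‖z‖)) * (K' * Real.exp (c' * ‖z‖)) := by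
          rw [abs_mul]
          exact mul_le_mul (h z) (h' z) (abs_nonneg _) ((abs_nonneg _).trans (h z))
      _ = _ := by rw [add_mul, Real.exp_add]; ring

/-- The algebra of operators generated by the partial derivatives and the multiplications by the
coordinates. -/
def weylAlg (d : ℕ) : Subalgebra ℝ (SmOp d) :=
  Algebra.adjoin ℝ (range smDeriv ∪ range coordOp)

theorem smDeriv_mem_weylAlg (j : Fin (d + 1)) : smDeriv j ∈ weylAlg d :=
  Algebra.subset_adjoin (Or.inl ⟨j, rfl⟩)

theorem coordOp_mem_weylAlg (j : Fin (d + 1)) : coordOp j ∈ weylAlg d :=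
  Algebra.subset_adjoin (Or.inr ⟨j, rfl⟩)

theorem smMultiDeriv_mem_weylAlg (β : MultiIndex d) : smMultiDeriv β ∈ weylAlg d := by
  induction β using MultiIndex.induction with
  | h0 => rw [smMultiDeriv, ordPow_zero]; exact one_mem _
  | h1 β j ih => rw [smMultiDeriv_add_single]; exact mul_mem (smDeriv_mem_weylAlg j) ih

/-- Operators in normal form: combinations of `p(z) ∂^β` with polynomials `p`. -/
def normalForms (d : ℕ) : Submodule ℝ (SmOp d) :=
  Submodule.span ℝ {P | ∃ p ∈ polyAlg d, ∃ β, P = mulOp p * smMultiDeriv β}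

theorem smDeriv_mul_mem_normalForms (j : Fin (d + 1)) {P : SmOp d} (hP : P ∈ normalForms d) :
    smDeriv j * P ∈ normalForms d := by
  induction hP using Submodule.span_induction with
  | mem x hx =>
    obtain ⟨p, hp, β, rfl⟩ := hx
    rw [← mul_assoc, smDeriv_mul_mulOp, add_mul, mul_assoc, ← smMultiDeriv_add_single]
    exact add_mem (Submodule.subset_span ⟨p, hp, _, rfl⟩)
      (Submodule.subset_span ⟨_, smDeriv_mem_polyAlg j hp, _, rfl⟩)
  | zero => rw [mul_zero]; exact zero_mem _
  | add x y _ _ hx hy => rw [mul_add]; exact add_mem hx hy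
  | smul a x _ hx => rw [mul_smul_comm]; exact Submodule.smul_mem _ _ hx

theorem coordOp_mul_mem_normalForms (j : Fin (d + 1)) {P : SmOp d} (hP : P ∈ normalForms d) :
    coordOp j * P ∈ normalForms d := by
  induction hP using Submodule.span_induction with
  | mem x hx =>
    obtain ⟨p, hp, β, rfl⟩ := hx
    have h : coordOp j * (mulOp p * smMultiDeriv β) = mulOp (coordFn j * p) * smMultiDeriv β := by
      ext1 f
      simp only [Module.End.mul_apply, LinearMap.mulLeft_apply, mul_assoc]
    rw [h]
    exact Submodule.subset_span ⟨_, mul_mem (coordFn_mem_polyAlg j) hp, _, rfl⟩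
  | zero => rw [mul_zero]; exact zero_mem _
  | add x y _ _ hx hy => rw [mul_add]; exact add_mem hx hy
  | smul a x _ hx => rw [mul_smul_comm]; exact Submodule.smul_mem _ _ hx

/-- Left multiplication by each generator preserves normal forms, a derivative being moved past a
polynomial by the Leibniz rule. This reduces statements about all operators of the algebra to the
operators `p(z) ∂^β`. -/
theorem weylAlg_le_normalForms {P : SmOp d} (hP : P ∈ weylAlg d) : P ∈ normalForms d := by
  have h1 : (1 : SmOp d) ∈ normalForms d := by
    refine Submodule.subset_span ⟨1, one_mem _, 0, ?_⟩
    rw [smMultiDeriv, ordPow_zero, mul_one]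
    ext1 f
    simp
  -- Quantifying over right factors lets the induction treat products as successive left
  -- multiplications.
  suffices h : ∀ R ∈ normalForms d, P * R ∈ normalForms d by simpa using h 1 h1
  induction hP using Algebra.adjoin_induction with
  | mem x hx =>
    intro R hR
    rcases hx with ⟨j, rfl⟩ | ⟨j, rfl⟩
    · exact smDeriv_mul_mem_normalForms j hR
    · exact coordOp_mul_mem_normalForms j hR
  | algebraMap r =>
    intro R hR
    rw [← Algebra.smul_def]
    exact Submodule.smul_mem _ _ hR
  | add x y _ _ hx hy =>
    intro R hR
    rw [add_mul]
    exact add_mem (hx R hR) (hy R hR)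
  | mul x y _ _ hx hy =>
    intro R hR
    rw [mul_assoc]
    exact hx _ (hy R hR)

theorem exists_coeff_of_normalForms {P : SmOp d} (hP : P ∈ normalForms d) :
    ∃ (B : Finset (MultiIndex d)) (c : MultiIndex d → Sm d),
      P = ∑ β ∈ B, mulOp (c β) * smMultiDeriv β := by
  classical
  -- Padding with zero coefficients brings two sums to a common index set.
  have hext : ∀ (B B' : Finset (MultiIndex d)) (c : MultiIndex d → Sm d), B ⊆ B' →
      ∑ β ∈ B, mulOp (c β) * smMultiDeriv β =
        ∑ β ∈ B', mulOp (if β ∈ B then c β else 0) * smMultiDeriv β := by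
    intro B B' c hB
    rw [← Finset.sum_subset hB (f := fun β => mulOp (if β ∈ B then c β else 0) * smMultiDeriv β)]
    · exact Finset.sum_congr rfl fun β hβ => by rw [if_pos hβ]
    · intro β _ hβ
      rw [if_neg hβ]
      ext1 f
      simp
  induction hP using Submodule.span_induction with
  | mem x hx =>
    obtain ⟨p, hp, β, rfl⟩ := hx
    exact ⟨{β}, fun _ => p, by simp⟩
  | zero => exact ⟨∅, fun _ => 0, by simp⟩
  | add x y _ _ hx hy =>
    obtain ⟨B, c, rfl⟩ := hx
    obtain ⟨B', c', rfl⟩ := hy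
    refine ⟨B ∪ B', fun β => (if β ∈ B then c β else 0) + (if β ∈ B' then c' β else 0), ?_⟩
    rw [hext B (B ∪ B') c Finset.subset_union_left, hext B' (B ∪ B') c' Finset.subset_union_right,
      ← Finset.sum_add_distrib]
    refine Finset.sum_congr rfl fun β _ => ?_
    ext1 f
    simp [add_mul]
  | smul a x _ hx =>
    obtain ⟨B, c, rfl⟩ := hx
    refine ⟨B, fun β => a • c β, ?_⟩
    rw [Finset.smul_sum]
    refine Finset.sum_congr rfl fun β _ => ?_
    ext1 f
    simp

theorem isLinearDiffOp_of_weylAlg {L : Op d} {P : SmOp d} (hP : P ∈ weylAlg d)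
    (hL : ∀ f : Sm d, L f = (P f : Space d → ℝ)) : IsLinearDiffOp L := by
  obtain ⟨B, c, rfl⟩ := exists_coeff_of_normalForms (weylAlg_le_normalForms hP)
  refine ⟨B, fun β => c β, fun β _ => (c β).contDiff, fun f hf z => ?_⟩
  have h := congrFun (hL ⟨f, mem_smoothAlg.2 hf⟩) z
  change L f z = _ at h
  rw [h, LinearMap.sum_apply, Sm.coe_sum]
  refine Finset.sum_congr rfl fun β _ => ?_
  have h2 := multiDeriv_coe β ⟨f, mem_smoothAlg.2 hf⟩
  change multiDeriv β f = _ at h2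
  rw [h2]
  rfl

/-! ### Operators preserving regular solutions -/

section
variable {q : FrozenCoeff d} {T : ℝ} {V W : ℝ → Sm d}

theorem mulOp_mul_apply (p : Sm d) (P : SmOp d) (f : Sm d) (z : Space d) :
    ((mulOp p * P) f : Space d → ℝ) z = (p : Space d → ℝ) z * (P f : Space d → ℝ) z := rfl

theorem IsRegularSol.cont_weylAlg (hV : IsRegularSol q T V) {P : SmOp d} (hP : P ∈ weylAlg d) :
    ContinuousOn (fun p : ℝ × Space d => (P (V p.1) : Space d → ℝ) p.2)
      (Ioo (-1) T ×ˢ univ) := by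
  have hP' := weylAlg_le_normalForms hP
  clear hP
  induction hP' using Submodule.span_induction with
  | mem x hx =>
    obtain ⟨p, hp, β, rfl⟩ := hx
    simp only [mulOp_mul_apply]
    exact (p.contDiff.continuous.comp continuous_snd).continuousOn.mul (hV.cont β)
  | zero => exact continuousOn_const
  | add x y _ _ hx hy => exact hx.add hy
  | smul a x _ hx => exact hx.const_smul a

theorem exp_growth_add {f g : ℝ → Space d → ℝ} {s : Set ℝ}
    (hf : ∃ K c : ℝ, ∀ t ∈ s, ∀ z, |f t z| ≤ K * Real.exp (c * ‖z‖))
    (hg : ∃ K c : ℝ, ∀ t ∈ s, ∀ z, |g t z| ≤ K * Real.exp (c * ‖z‖)) :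
    ∃ K c : ℝ, ∀ t ∈ s, ∀ z, |f t z + g t z| ≤ K * Real.exp (c * ‖z‖) := by
  obtain ⟨K, c, h⟩ := hf
  obtain ⟨K', c', h'⟩ := hg
  refine ⟨|K| + |K'|, max c c', fun t ht z => ?_⟩
  have e1 : Real.exp (c * ‖z‖) ≤ Real.exp (max c c' * ‖z‖) :=
    Real.exp_le_exp.2 (mul_le_mul_of_nonneg_right (le_max_left _ _) (norm_nonneg _))
  have e2 : Real.exp (c' * ‖z‖) ≤ Real.exp (max c c' * ‖z‖) :=
    Real.exp_le_exp.2 (mul_le_mul_of_nonneg_right (le_max_right _ _) (norm_nonneg _))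
  calc |f t z + g t z|
      ≤ K * Real.exp (c * ‖z‖) + K' * Real.exp (c' * ‖z‖) :=
        (abs_add_le _ _).trans (add_le_add (h t ht z) (h' t ht z))
    _ ≤ |K| * Real.exp (c * ‖z‖) + |K'| * Real.exp (c' * ‖z‖) := by
        gcongr <;> exact le_abs_self _
    _ ≤ |K| * Real.exp (max c c' * ‖z‖) + |K'| * Real.exp (max c c' * ‖z‖) := by gcongr
    _ = _ := by ring

theorem exp_growth_mul {b : ℝ → ℝ} {f : ℝ → Space d → ℝ} {s : Set ℝ}
    (hb : ∃ K : ℝ, ∀ t ∈ s, |b t| ≤ K)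
    (hf : ∃ K c : ℝ, ∀ t ∈ s, ∀ z, |f t z| ≤ K * Real.exp (c * ‖z‖)) :
    ∃ K c : ℝ, ∀ t ∈ s, ∀ z, |b t * f t z| ≤ K * Real.exp (c * ‖z‖) := by
  obtain ⟨B, hB⟩ := hb
  obtain ⟨K, c, h⟩ := hf
  refine ⟨B * K, c, fun t ht z => ?_⟩
  rw [abs_mul, mul_assoc]
  exact mul_le_mul (hB t ht) (h t ht z) (abs_nonneg _) ((abs_nonneg _).trans (hB t ht))

theorem exp_growth_sum {ι : Type*} (s' : Finset ι) {f : ι → ℝ → Space d → ℝ} {s : Set ℝ}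
    (hf : ∀ i ∈ s', ∃ K c : ℝ, ∀ t ∈ s, ∀ z, |f i t z| ≤ K * Real.exp (c * ‖z‖)) :
    ∃ K c : ℝ, ∀ t ∈ s, ∀ z, |∑ i ∈ s', f i t z| ≤ K * Real.exp (c * ‖z‖) := by
  classical
  induction s' using Finset.induction_on with
  | empty => exact ⟨0, 0, by simp⟩
  | insert i s' hi ih =>
    simp only [Finset.sum_insert hi]
    exact exp_growth_add (hf i (Finset.mem_insert_self _ _))
      (ih fun j hj => hf j (Finset.mem_insert_of_mem hj))

theorem IsRegularSol.growth_weylAlg (hV : IsRegularSol q T V) {P : SmOp d} (hP : P ∈ weylAlg d)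
    {T' : ℝ} (hT' : T' < T) : ∃ K c : ℝ, ∀ t ∈ Icc 0 T', ∀ z,
      |(P (V t) : Space d → ℝ) z| ≤ K * Real.exp (c * ‖z‖) := by
  have hP' := weylAlg_le_normalForms hP
  clear hP
  induction hP' using Submodule.span_induction with
  | mem x hx =>
    obtain ⟨p, hp, β, rfl⟩ := hx
    obtain ⟨K, c, h⟩ := exists_growth_of_polyAlg hp
    obtain ⟨K', c', h'⟩ := hV.growth β T' hT'
    refine ⟨K * K', c + c', fun t ht z => ?_⟩
    rw [mulOp_mul_apply, abs_mul]
    calc _ ≤ (K * Real.exp (c * ‖z‖)) * (K' * Real.exp (c' * ‖z‖)) :=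
          mul_le_mul (h z) (h' t ht z) (abs_nonneg _) ((abs_nonneg _).trans (h z))
      _ = _ := by rw [add_mul, Real.exp_add]; ring
  | zero => exact ⟨0, 0, by simp⟩
  | add x y _ _ hx hy => exact exp_growth_add hx hy
  | smul a x _ hx => exact exp_growth_mul (b := fun _ => a) ⟨|a|, fun _ _ => le_rfl⟩ hx

/-- Here `P` is constant in time and need not commute with the generator, so the derivative carries
`P` outside `gen`; in general `P (V t)` is not a solution. -/
theorem IsRegularSol.deriv_weylAlg (hV : IsRegularSol q T V) {P : SmOp d} (hP : P ∈ weylAlg d)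
    {t : ℝ} (ht : t ∈ Ioo (-1) T) (z : Space d) :
    HasDerivAt (fun s => (P (V s) : Space d → ℝ) z)
      (-(P (gen q t (V t)) : Space d → ℝ) z) t := by
  have hP' := weylAlg_le_normalForms hP
  clear hP
  induction hP' using Submodule.span_induction with
  | mem x hx =>
    obtain ⟨p, hp, β, rfl⟩ := hx
    simp only [mulOp_mul_apply]
    exact ((hV.deriv β t ht z).const_mul _).congr_deriv (by ring)
  | zero => exact (hasDerivAt_const t (0 : ℝ)).congr_deriv (by simp)
  | add x y _ _ hx hy =>
    refine (hx.add hy).congr_deriv ?_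
    simp only [LinearMap.add_apply, Subalgebra.coe_add, Pi.add_apply]
    ring
  | smul a x _ hx =>
    refine (hx.const_mul a).congr_deriv ?_
    simp only [LinearMap.smul_apply, Subalgebra.coe_smul, Pi.smul_apply, smul_eq_mul]
    ring

theorem IsRegularSol.add (hV : IsRegularSol q T V) (hW : IsRegularSol q T W) :
    IsRegularSol q T fun t => V t + W t where
  cont β := by
    simp only [map_add]
    exact (hV.cont β).add (hW.cont β)
  growth β T' hT' := by
    simp only [map_add]
    exact exp_growth_add (hV.growth β T' hT') (hW.growth β T' hT')
  deriv β t ht z := by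
    simp only [map_add]
    refine ((hV.deriv β t ht z).add (hW.deriv β t ht z)).congr_deriv ?_
    simp only [Subalgebra.coe_add, Pi.add_apply]
    ring

theorem IsRegularSol.const_smul (hV : IsRegularSol q T V) (a : ℝ) :
    IsRegularSol q T fun t => a • V t where
  cont β := by
    simp only [map_smul]
    exact (hV.cont β).const_smul a
  growth β T' hT' := by
    simp only [map_smul]
    exact exp_growth_mul (b := fun _ => a) ⟨|a|, fun _ _ => le_rfl⟩ (hV.growth β T' hT')
  deriv β t ht z := by
    simp only [map_smul]
    refine ((hV.deriv β t ht z).const_mul a).congr_deriv ?_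
    simp only [Subalgebra.coe_smul, Pi.smul_apply, smul_eq_mul]
    ring

theorem IsRegularSol.smDeriv (hV : IsRegularSol q T V) (j : Fin (d + 1)) :
    IsRegularSol q T fun t => smDeriv j (V t) := by
  have h : ∀ β : MultiIndex d, smMultiDeriv β * PolyExpansion.smDeriv j ∈ weylAlg d := fun β =>
    mul_mem (smMultiDeriv_mem_weylAlg β) (smDeriv_mem_weylAlg j)
  refine ⟨fun β => hV.cont_weylAlg (h β), fun β T' hT' => hV.growth_weylAlg (h β) hT',
    fun β t ht z => (hV.deriv_weylAlg (h β) ht z).congr_deriv ?_⟩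
  have := LinearMap.congr_fun (gen_comm_smDeriv q t j).eq (V t)
  simp only [Module.End.mul_apply] at this ⊢
  rw [this]

/-- The operator `z_j - ∫_0^t drift_j - ∑ₗ (∫_0^t cov_{jl}) ∂_l`, which commutes with
`∂_t + gen`. -/
def shiftOp (q : FrozenCoeff d) (j : Fin (d + 1)) (t : ℝ) : SmOp d :=
  coordOp j + (-∫ r in (0 : ℝ)..t, q.drift r j) • 1 +
    ∑ l, (-∫ r in (0 : ℝ)..t, q.cov r j l) • smDeriv l

theorem shiftOp_mem_weylAlg (q : FrozenCoeff d) (j : Fin (d + 1)) (t : ℝ) :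
    shiftOp q j t ∈ weylAlg d := by
  exact add_mem (add_mem (coordOp_mem_weylAlg j) (Subalgebra.smul_mem _ (one_mem _) _))
    (sum_mem fun l _ => Subalgebra.smul_mem _ (smDeriv_mem_weylAlg l) _)

/-- The commutator with `z_j` removes one derivative from each term. In the second order part either
derivative can be hit, and by symmetry the two equal contributions absorb the factor `1/2`. -/
theorem gen_mul_coordOp (q : FrozenCoeff d) (t : ℝ) (j : Fin (d + 1)) :
    gen q t * coordOp j =
      coordOp j * gen q t + q.drift t j • 1 + ∑ l, q.cov t j l • smDeriv l := by
  have h1 : ∀ i, (smDeriv i * coordOp j : SmOp d) =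
      coordOp j * smDeriv i + (if i = j then (1 : ℝ) else 0) • 1 := fun i => by
    rw [smDeriv_mul_coordOp]
    split_ifs <;> simp
  have h2 : ∀ i l, (smDeriv i * smDeriv l * coordOp j : SmOp d) =
      coordOp j * (smDeriv i * smDeriv l) + ((if i = j then (1 : ℝ) else 0) • smDeriv l +
        (if l = j then (1 : ℝ) else 0) • smDeriv i) := fun i l => by
    rw [mul_assoc, h1, mul_add, ← mul_assoc, h1, add_mul, mul_smul_comm, mul_one, smul_mul_assoc,
      one_mul, mul_assoc, add_assoc]
  have h3 : ∑ i, ∑ l, q.cov t i l • (if i = j then (1 : ℝ) else 0) • (smDeriv l : SmOp d) =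
      ∑ l, q.cov t j l • smDeriv l := by
    rw [Finset.sum_comm]
    refine Finset.sum_congr rfl fun l _ => ?_
    rw [Finset.sum_eq_single j (fun i _ hi => by simp [hi]) (by simp)]
    simp
  have h4 : ∑ i, ∑ l, q.cov t i l • (if l = j then (1 : ℝ) else 0) • (smDeriv i : SmOp d) =
      ∑ l, q.cov t j l • smDeriv l := by
    refine Finset.sum_congr rfl fun i _ => ?_
    rw [Finset.sum_eq_single j (fun l _ hl => by simp [hl]) (by simp), q.cov_symm t i j]
    simp
  have h5 : ∑ i, q.drift t i • (if i = j then (1 : ℝ) else 0) • (1 : SmOp d) =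
      q.drift t j • 1 := by
    rw [Finset.sum_eq_single j (fun i _ hi => by simp [hi]) (by simp)]
    simp
  simp only [gen, add_mul, mul_add, Finset.sum_mul, Finset.mul_sum, smul_mul_assoc,
    mul_smul_comm, one_mul, mul_one, h1, h2, smul_add, Finset.sum_add_distrib, h5]
  rw [h3, h4]
  module

theorem hasDerivAt_integral_right {g : ℝ → ℝ} (hg : Continuous g) (t : ℝ) :
    HasDerivAt (fun t => ∫ r in (0 : ℝ)..t, g r) (g t) t :=
  intervalIntegral.integral_hasDerivAt_right (hg.intervalIntegrable 0 t)
    (hg.stronglyMeasurableAtFilter _ _) hg.continuousAt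

/-- The time derivative of the coefficients of `shiftOp` cancels the commutator of the generator
with `z_j`, so the image is again a solution. -/
theorem IsRegularSol.shiftOp (hV : IsRegularSol q T V) (j : Fin (d + 1)) :
    IsRegularSol q T fun t => shiftOp q j t (V t) := by
  have hX : ∀ β : MultiIndex d, smMultiDeriv β * coordOp j ∈ weylAlg d := fun β =>
    mul_mem (smMultiDeriv_mem_weylAlg β) (coordOp_mem_weylAlg j)
  have hD : ∀ (β : MultiIndex d) l, smMultiDeriv β * PolyExpansion.smDeriv l ∈ weylAlg d :=
    fun β l => mul_mem (smMultiDeriv_mem_weylAlg β) (smDeriv_mem_weylAlg l)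
  have hm := hasDerivAt_integral_right (q.continuous_drift j)
  have hc := fun l => hasDerivAt_integral_right (q.continuous_cov j l)
  have hmc : Continuous fun t => ∫ r in (0 : ℝ)..t, q.drift r j :=
    continuous_iff_continuousAt.2 fun t => (hm t).continuousAt
  have hcc : ∀ l, Continuous fun t => ∫ r in (0 : ℝ)..t, q.cov r j l := fun l =>
    continuous_iff_continuousAt.2 fun t => (hc l t).continuousAt
  have hbd : ∀ g : ℝ → ℝ, Continuous g → ∀ T' : ℝ, ∃ K : ℝ, ∀ t ∈ Icc 0 T', |g t| ≤ K :=
    fun g hg T' => isCompact_Icc.exists_bound_of_continuousOn hg.continuousOn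
  have key : ∀ (β : MultiIndex d) (t : ℝ) (z : Space d),
      (smMultiDeriv β (PolyExpansion.shiftOp q j t (V t)) : Space d → ℝ) z =
        ((smMultiDeriv β * coordOp j) (V t) : Space d → ℝ) z +
          ((-∫ r in (0 : ℝ)..t, q.drift r j) * (smMultiDeriv β (V t) : Space d → ℝ) z +
          ∑ l, (-∫ r in (0 : ℝ)..t, q.cov r j l) *
            ((smMultiDeriv β * PolyExpansion.smDeriv l) (V t) : Space d → ℝ) z) := by
    intro β t z
    simp only [PolyExpansion.shiftOp, LinearMap.add_apply, LinearMap.smul_apply,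
      LinearMap.sum_apply, map_add, map_smul, map_sum, Module.End.one_apply, Module.End.mul_apply,
      Subalgebra.coe_add, Subalgebra.coe_smul, Pi.add_apply, Pi.smul_apply, smul_eq_mul,
      Sm.coe_sum, neg_mul, Finset.sum_neg_distrib]
    ring
  refine ⟨fun β => ?_, fun β T' hT' => ?_, fun β t ht z => ?_⟩
  · simp only [key]
    have hfst : Continuous (Prod.fst : ℝ × Space d → ℝ) := continuous_fst
    exact (hV.cont_weylAlg (hX β)).add (((hmc.comp hfst).neg.continuousOn.mul (hV.cont β)).add
      (continuousOn_finsetSum _ fun l _ =>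
        ((hcc l).comp hfst).neg.continuousOn.mul (hV.cont_weylAlg (hD β l))))
  · simp only [key]
    exact exp_growth_add (hV.growth_weylAlg (hX β) hT') (exp_growth_add
      (exp_growth_mul (hbd _ hmc.neg T') (hV.growth β T' hT'))
      (exp_growth_sum _ fun l _ =>
        exp_growth_mul (hbd _ (hcc l).neg T') (hV.growth_weylAlg (hD β l) hT')))
  · simp only [key]
    refine ((hV.deriv_weylAlg (hX β) ht z).add (((hm t).neg.mul (hV.deriv β t ht z)).add
      (HasDerivAt.fun_sum fun l _ =>
        (hc l t).neg.mul (hV.deriv_weylAlg (hD β l) ht z)))).congr_deriv ?_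
    have hg : gen q t (PolyExpansion.shiftOp q j t (V t)) = coordOp j (gen q t (V t)) +
        q.drift t j • V t + ∑ l, q.cov t j l • PolyExpansion.smDeriv l (V t) +
        (-∫ r in (0 : ℝ)..t, q.drift r j) • gen q t (V t) +
        ∑ l, (-∫ r in (0 : ℝ)..t, q.cov r j l) • PolyExpansion.smDeriv l (gen q t (V t)) := by
      have h1 := LinearMap.congr_fun (gen_mul_coordOp q t j) (V t)
      have h2 := fun l => LinearMap.congr_fun (gen_comm_smDeriv q t l).eq (V t)
      simp only [Module.End.mul_apply, LinearMap.add_apply, LinearMap.smul_apply,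
        Module.End.one_apply, LinearMap.sum_apply] at h1 h2
      simp only [PolyExpansion.shiftOp, LinearMap.add_apply, LinearMap.smul_apply,
        LinearMap.sum_apply, map_add, map_smul, map_sum, Module.End.one_apply, h1, h2]
    rw [hg]
    simp only [map_add, map_smul, map_sum, Module.End.mul_apply,
      Subalgebra.coe_add, Subalgebra.coe_smul, Pi.add_apply,
      Pi.smul_apply, Pi.neg_apply, smul_eq_mul, Sm.coe_sum, neg_mul, mul_neg, neg_neg,
      Finset.sum_add_distrib, Finset.sum_neg_distrib]
    ring

/-- Time-dependent operators generated by the partial derivatives and the shifted coordinates. -/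
def flowAlg (q : FrozenCoeff d) : Subalgebra ℝ (ℝ → SmOp d) :=
  Algebra.adjoin ℝ (range (shiftOp q) ∪ range fun j _ => PolyExpansion.smDeriv j)

theorem shiftOp_mem_flowAlg (j : Fin (d + 1)) : PolyExpansion.shiftOp q j ∈ flowAlg q :=
  Algebra.subset_adjoin (Or.inl ⟨j, rfl⟩)

theorem smDeriv_mem_flowAlg (j : Fin (d + 1)) :
    (fun _ => PolyExpansion.smDeriv j) ∈ flowAlg q :=
  Algebra.subset_adjoin (Or.inr ⟨j, rfl⟩)

theorem IsRegularSol.flowAlg {Q : ℝ → SmOp d} (hQ : Q ∈ flowAlg q) (hV : IsRegularSol q T V) :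
    IsRegularSol q T fun t => Q t (V t) := by
  -- A product acts by composition, so the first factor must be applied to the solution produced by
  -- the second.
  induction hQ using Algebra.adjoin_induction generalizing V with
  | mem x hx =>
    rcases hx with ⟨j, rfl⟩ | ⟨j, rfl⟩
    · exact hV.shiftOp j
    · exact hV.smDeriv j
  | algebraMap r => exact hV.const_smul r
  | add x y _ _ hx hy => exact (hx hV).add (hy hV)
  | mul x y _ _ hx hy => exact hx (hy hV)

theorem mem_weylAlg_of_flowAlg {Q : ℝ → SmOp d} (hQ : Q ∈ PolyExpansion.flowAlg q) (t : ℝ) :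
    Q t ∈ weylAlg d := by
  induction hQ using Algebra.adjoin_induction with
  | mem x hx =>
    rcases hx with ⟨j, rfl⟩ | ⟨j, rfl⟩
    · exact shiftOp_mem_weylAlg q j t
    · exact smDeriv_mem_weylAlg j
  | algebraMap r => exact Subalgebra.algebraMap_mem _ r
  | add x y _ _ hx hy => exact add_mem hx hy
  | mul x y _ _ hx hy => exact mul_mem hx hy

end

/-! ### Iterated integrals -/

theorem continuous_cons {X : Type*} [TopologicalSpace X] {k : ℕ} {f : X → ℝ} {g : X → Fin k → ℝ}
    (hf : Continuous f) (hg : Continuous g) :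
    Continuous fun x => (Fin.cons (f x) (g x) : Fin (k + 1) → ℝ) := by
  refine continuous_pi fun j => Fin.cases ?_ (fun j => ?_) j
  · simpa using hf
  · simp only [Fin.cons_succ]
    exact (continuous_apply j).comp hg

/-- The parameter space is arbitrary because each induction step moves the outer integration
variable into the parameters. -/
theorem continuous_iteratedIntegral {X : Type*} [TopologicalSpace X] (T : ℝ) (k : ℕ)
    {F : X → (Fin k → ℝ) → ℝ} (hF : Continuous fun p : X × (Fin k → ℝ) => F p.1 p.2) :
    Continuous fun p : X × ℝ => iteratedIntegral T k p.2 (F p.1) := by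
  induction k generalizing X with
  | zero =>
    simp only [iteratedIntegral]
    exact hF.comp (continuous_fst.prodMk continuous_const)
  | succ k ih =>
    have h1 : Continuous fun p : (X × ℝ) × (Fin k → ℝ) => F p.1.1 (Fin.cons p.1.2 p.2) := by
      refine hF.comp ((continuous_fst.comp continuous_fst).prodMk ?_)
      exact continuous_cons (continuous_snd.comp continuous_fst) continuous_snd
    have h2 := ih (F := fun (y : X × ℝ) τ => F y.1 (Fin.cons y.2 τ)) h1
    have h3 : Continuous fun p : (X × ℝ) × ℝ =>
        iteratedIntegral T k p.2 fun τ => F p.1.1 (Fin.cons p.2 τ) :=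
      h2.comp (((continuous_fst.comp continuous_fst).prodMk continuous_snd).prodMk continuous_snd)
    have h4 := (intervalIntegral.continuous_parametric_intervalIntegral_of_continuous
      (μ := MeasureTheory.volume) (a₀ := T) (f := fun (p : X × ℝ) s =>
        iteratedIntegral T k s fun τ => F p.1 (Fin.cons s τ)) h3 (s := fun p => p.2)
      continuous_snd).neg
    refine h4.congr fun p => ?_
    simp only [iteratedIntegral]
    rw [intervalIntegral.integral_symm]
    rfl

theorem continuous_iteratedIntegral_cons (T : ℝ) (k : ℕ) {c : (Fin (k + 1) → ℝ) → ℝ}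
    (hc : Continuous c) :
    Continuous fun s => iteratedIntegral T k s fun τ => c (Fin.cons s τ) := by
  have h := continuous_iteratedIntegral T k (F := fun (s : ℝ) τ => c (Fin.cons s τ))
    (hc.comp (continuous_cons continuous_fst continuous_snd))
  exact h.comp (continuous_id.prodMk continuous_id)

theorem continuous_iteratedIntegral_left (T : ℝ) (k : ℕ) {c : (Fin k → ℝ) → ℝ}
    (hc : Continuous c) : Continuous fun s => iteratedIntegral T k s c := by
  have h := continuous_iteratedIntegral T k (F := fun (_ : Unit) => c) (hc.comp continuous_snd)
  exact h.comp ((continuous_const (y := ())).prodMk continuous_id)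

theorem hasDerivAt_iteratedIntegral_succ (T : ℝ) (k : ℕ) {c : (Fin (k + 1) → ℝ) → ℝ}
    (hc : Continuous c) (t : ℝ) :
    HasDerivAt (fun t => iteratedIntegral T (k + 1) t c)
      (-iteratedIntegral T k t fun τ => c (Fin.cons t τ)) t :=
  hasDerivAt_integral_left (continuous_iteratedIntegral_cons T k hc) T t

theorem iteratedIntegral_succ_self (T : ℝ) (k : ℕ) (c : (Fin (k + 1) → ℝ) → ℝ) :
    iteratedIntegral T (k + 1) T c = 0 :=
  intervalIntegral.integral_same

theorem iteratedIntegral_sum {ι : Type*} [Fintype ι] (T : ℝ) (k : ℕ) (t : ℝ)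
    {c : ι → (Fin k → ℝ) → ℝ} (hc : ∀ i, Continuous (c i)) (x : ι → ℝ) :
    iteratedIntegral T k t (fun τ => ∑ i, c i τ * x i) =
      ∑ i, iteratedIntegral T k t (c i) * x i := by
  induction k generalizing t with
  | zero => rfl
  | succ k ih =>
    simp only [iteratedIntegral]
    have h : ∀ s, iteratedIntegral T k s (fun τ => ∑ i, c i (Fin.cons s τ) * x i) =
        ∑ i, iteratedIntegral T k s (fun τ => c i (Fin.cons s τ)) * x i := fun s =>
      ih s (c := fun i τ => c i (Fin.cons s τ)) fun i =>
        (hc i).comp (continuous_cons continuous_const continuous_id)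
    simp only [h]
    have hi : ∀ i, Continuous fun s =>
        iteratedIntegral T k s (fun τ => c i (Fin.cons s τ)) * x i := fun i =>
      (continuous_iteratedIntegral_cons T k (hc i)).mul continuous_const
    rw [intervalIntegral.integral_finsetSum fun i _ => (hi i).intervalIntegrable _ _]
    simp only [intervalIntegral.integral_mul_const]

/-- Only times in `[t,T]` are visited. This suffices to replace the original coefficients by their
extensions, which agree with them on `[0,T]` only. -/
theorem iteratedIntegral_congr {T : ℝ} {k : ℕ} {t : ℝ} (ht : t ≤ T) {F G : (Fin k → ℝ) → ℝ}
    (h : ∀ τ : Fin k → ℝ, (∀ j, τ j ∈ Icc t T) → F τ = G τ) :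
    iteratedIntegral T k t F = iteratedIntegral T k t G := by
  induction k generalizing t with
  | zero => exact h _ fun j => j.elim0
  | succ k ih =>
    simp only [iteratedIntegral]
    refine intervalIntegral.integral_congr fun s hs => ?_
    rw [uIcc_of_le ht] at hs
    refine ih hs.2 fun τ hτ => h _ fun j => ?_
    refine Fin.cases ?_ (fun j => ?_) j
    · exact hs
    · exact ⟨hs.1.trans (hτ j).1, (hτ j).2⟩

/-! ### Families of operators with separated variables -/

/-- The family `F x t` is a finite sum `∑ cᵢ(x) Qᵢ(t)` with continuous `cᵢ` and operators `Qᵢ`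
preserving regular solutions. -/
def IsSeparable {X : Type*} [TopologicalSpace X] (q : FrozenCoeff d) (F : X → ℝ → SmOp d) : Prop :=
  ∃ (ι : Type) (_ : Fintype ι) (c : ι → X → ℝ) (Q : ι → ℝ → SmOp d),
    (∀ i, Continuous (c i)) ∧ (∀ i, Q i ∈ flowAlg q) ∧ ∀ x t, F x t = ∑ i, c i x • Q i t

namespace IsSeparable
variable {X : Type*} [TopologicalSpace X] {q : FrozenCoeff d} {F G : X → ℝ → SmOp d}

theorem of_mem {Q : ℝ → SmOp d} (hQ : Q ∈ flowAlg q) : IsSeparable q fun _ : X => Q :=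
  ⟨Unit, inferInstance, fun _ _ => 1, fun _ => Q, fun _ => continuous_const, fun _ => hQ,
    fun _ _ => by simp⟩

theorem one : IsSeparable q fun (_ : X) (_ : ℝ) => (1 : SmOp d) :=
  of_mem (one_mem (flowAlg q))

theorem zero : IsSeparable q fun (_ : X) (_ : ℝ) => (0 : SmOp d) :=
  of_mem (zero_mem (flowAlg q))

theorem add (hF : IsSeparable q F) (hG : IsSeparable q G) :
    IsSeparable q fun x t => F x t + G x t := by
  obtain ⟨ι, _, c, Q, hc, hQ, h⟩ := hF
  obtain ⟨ι', _, c', Q', hc', hQ', h'⟩ := hG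
  refine ⟨ι ⊕ ι', inferInstance, Sum.elim c c', Sum.elim Q Q', ?_, ?_, fun x t => ?_⟩
  · rintro (i | i)
    exacts [hc i, hc' i]
  · rintro (i | i)
    exacts [hQ i, hQ' i]
  · simp [h, h']

theorem mul (hF : IsSeparable q F) (hG : IsSeparable q G) :
    IsSeparable q fun x t => F x t * G x t := by
  obtain ⟨ι, _, c, Q, hc, hQ, h⟩ := hF
  obtain ⟨ι', _, c', Q', hc', hQ', h'⟩ := hG
  refine ⟨ι × ι', inferInstance, fun i x => c i.1 x * c' i.2 x, fun i => Q i.1 * Q' i.2,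
    fun i => (hc i.1).mul (hc' i.2), fun i => mul_mem (hQ i.1) (hQ' i.2), fun x t => ?_⟩
  change F x t * G x t = _
  rw [h, h', Fintype.sum_prod_type, Finset.sum_mul]
  refine Finset.sum_congr rfl fun i _ => ?_
  rw [Finset.mul_sum]
  refine Finset.sum_congr rfl fun j _ => ?_
  rw [smul_mul_smul_comm]
  rfl

theorem smul (hF : IsSeparable q F) {b : X → ℝ} (hb : Continuous b) :
    IsSeparable q fun x t => b x • F x t := by
  obtain ⟨ι, _, c, Q, hc, hQ, h⟩ := hF
  exact ⟨ι, inferInstance, fun i x => b x * c i x, Q, fun i => hb.mul (hc i), hQ, fun x t => by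
    simp only [h, Finset.smul_sum, smul_smul]⟩

theorem sum {κ : Type*} (s : Finset κ) {F : κ → X → ℝ → SmOp d}
    (hF : ∀ i ∈ s, IsSeparable q (F i)) : IsSeparable q fun x t => ∑ i ∈ s, F i x t := by
  classical
  induction s using Finset.induction_on with
  | empty => simpa using zero
  | insert i s hi ih =>
    simp only [Finset.sum_insert hi]
    exact (hF i (Finset.mem_insert_self _ _)).add
      (ih fun j hj => hF j (Finset.mem_insert_of_mem hj))

theorem pow (hF : IsSeparable q F) (n : ℕ) : IsSeparable q fun x t => F x t ^ n := by
  induction n with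
  | zero => simpa using one
  | succ n ih =>
    simp only [pow_succ]
    exact ih.mul hF

theorem list_prod {κ : Type*} (l : List κ) {F : κ → X → ℝ → SmOp d}
    (hF : ∀ i, IsSeparable q (F i)) :
    IsSeparable q fun x t => (l.map fun i => F i x t).prod := by
  induction l with
  | nil => simpa using one
  | cons i l ih =>
    simp only [List.map_cons, List.prod_cons]
    exact (hF i).mul ih

theorem comp {Y : Type*} [TopologicalSpace Y] (hF : IsSeparable q F) {g : Y → X}
    (hg : Continuous g) : IsSeparable q fun y t => F (g y) t := by
  obtain ⟨ι, _, c, Q, hc, hQ, h⟩ := hF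
  exact ⟨ι, inferInstance, fun i y => c i (g y), Q, fun i => (hc i).comp hg, hQ,
    fun y t => h (g y) t⟩

end IsSeparable

section
variable {q : FrozenCoeff d} {k : ℕ}

/-- Integration affects only the scalar coefficients, so the result stays in `flowAlg`. The starting
point `r` of the integrals is kept apart from the time `t` of the operators: for fixed `r` solutions
go to solutions, and on the diagonal one gets `𝓛_n(t,T)`. -/
theorem exists_operatorIntegral (T : ℝ) {F : (Fin k → ℝ) → ℝ → SmOp d} (hF : IsSeparable q F) :
    ∃ I : ℝ → ℝ → SmOp d, (∀ r, I r ∈ flowAlg q) ∧ ∀ r t f z,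
      (I r t f : Space d → ℝ) z =
        iteratedIntegral T k r fun τ => (F τ t f : Space d → ℝ) z := by
  obtain ⟨ι, _, c, Q, hc, hQ, h⟩ := hF
  refine ⟨fun r => ∑ i, iteratedIntegral T k r (c i) • Q i,
    fun r => sum_mem fun i _ => Subalgebra.smul_mem _ (hQ i) _, fun r t f z => ?_⟩
  simp only [h, LinearMap.sum_apply, LinearMap.smul_apply, Sm.coe_sum, Subalgebra.coe_smul,
    Pi.smul_apply, smul_eq_mul, Finset.sum_apply]
  rw [iteratedIntegral_sum T k r hc]

/-- The iterated integral from `r` of a separable family. -/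
def operatorIntegral (T : ℝ) {F : (Fin k → ℝ) → ℝ → SmOp d} (hF : IsSeparable q F) :
    ℝ → ℝ → SmOp d := (exists_operatorIntegral T hF).choose

theorem operatorIntegral_mem (T : ℝ) {F : (Fin k → ℝ) → ℝ → SmOp d} (hF : IsSeparable q F)
    (r : ℝ) : operatorIntegral T hF r ∈ flowAlg q :=
  (exists_operatorIntegral T hF).choose_spec.1 r

theorem operatorIntegral_apply (T : ℝ) {F : (Fin k → ℝ) → ℝ → SmOp d} (hF : IsSeparable q F)
    (r t : ℝ) (f : Sm d) (z : Space d) : (operatorIntegral T hF r t f : Space d → ℝ) z =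
      iteratedIntegral T k r fun τ => (F τ t f : Space d → ℝ) z :=
  (exists_operatorIntegral T hF).choose_spec.2 r t f z

theorem continuous_separable_apply {F : (Fin k → ℝ) → ℝ → SmOp d} (hF : IsSeparable q F)
    (t : ℝ) (f : Sm d) (z : Space d) : Continuous fun τ => (F τ t f : Space d → ℝ) z := by
  obtain ⟨ι, _, c, Q, hc, hQ, h⟩ := hF
  simp only [h, LinearMap.sum_apply, LinearMap.smul_apply, Sm.coe_sum, Subalgebra.coe_smul,
    Pi.smul_apply, smul_eq_mul]
  exact continuous_finsetSum _ fun i _ => (hc i).mul continuous_const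

/-- Product rule on the diagonal: the lower limit yields minus the integrand with first time equal
to `t`, and each `Q i` applied to `V` solves the homogeneous equation. -/
theorem hasDerivAt_operatorIntegral {T : ℝ} {F : (Fin (k + 1) → ℝ) → ℝ → SmOp d}
    (hF : IsSeparable q F) {V : ℝ → Sm d} (hV : IsRegularSol q T V) {t : ℝ}
    (ht : t ∈ Ioo (-1) T) (z : Space d) :
    HasDerivAt (fun s => (operatorIntegral T hF s s (V s) : Space d → ℝ) z)
      (-(iteratedIntegral T k t fun τ => (F (Fin.cons t τ) t (V t) : Space d → ℝ) z) -
        (gen q t (operatorIntegral T hF t t (V t)) : Space d → ℝ) z) t := by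
  obtain ⟨ι, _, c, Q, hc, hQ, h⟩ := id hF
  have e : ∀ r s f, operatorIntegral T hF r s f =
      ∑ i, iteratedIntegral T (k + 1) r (c i) • Q i s f := by
    intro r s f
    ext z
    rw [operatorIntegral_apply]
    simp only [h, LinearMap.sum_apply, LinearMap.smul_apply, Sm.coe_sum, Subalgebra.coe_smul,
      Pi.smul_apply, smul_eq_mul]
    rw [iteratedIntegral_sum T (k + 1) r hc]
  have hQV : ∀ i, HasDerivAt (fun s => (Q i s (V s) : Space d → ℝ) z)
      (-(gen q t (Q i t (V t)) : Space d → ℝ) z) t := fun i => by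
    simpa [ordPow_zero] using (hV.flowAlg (hQ i)).deriv 0 t ht z
  have hd := HasDerivAt.fun_sum (u := Finset.univ) fun i _ =>
    (hasDerivAt_iteratedIntegral_succ T k (hc i) t).mul (hQV i)
  have hfun : (fun s => (operatorIntegral T hF s s (V s) : Space d → ℝ) z) =
      fun s => ∑ i, iteratedIntegral T (k + 1) s (c i) * (Q i s (V s) : Space d → ℝ) z := by
    ext s
    simp [e]
  rw [hfun]
  refine hd.congr_deriv ?_
  rw [Finset.sum_add_distrib, e, map_sum]
  simp only [h, LinearMap.sum_apply, LinearMap.smul_apply, Sm.coe_sum, Subalgebra.coe_smul,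
    Pi.smul_apply, smul_eq_mul, map_smul]
  rw [iteratedIntegral_sum T k t (c := fun i τ => c i (Fin.cons t τ))
    fun i => (hc i).comp (continuous_cons continuous_const continuous_id)]
  simp only [neg_mul, mul_neg, Finset.sum_neg_distrib]
  ring

/-- A fixed operator passes through the iterated integral of a separable family. -/
theorem iteratedIntegral_mul_left {T : ℝ} {F : (Fin k → ℝ) → ℝ → SmOp d}
    (hF : IsSeparable q F) (P : SmOp d) (r t : ℝ) (f : Sm d) (z : Space d) :
    iteratedIntegral T k r (fun τ => (P (F τ t f) : Space d → ℝ) z) =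
      (P (operatorIntegral T hF r t f) : Space d → ℝ) z := by
  obtain ⟨ι, _, c, Q, hc, hQ, h⟩ := id hF
  have e : operatorIntegral T hF r t f = ∑ i, iteratedIntegral T k r (c i) • Q i t f := by
    ext z
    rw [operatorIntegral_apply]
    simp only [h, LinearMap.sum_apply, LinearMap.smul_apply, Sm.coe_sum, Subalgebra.coe_smul,
      Pi.smul_apply, smul_eq_mul]
    rw [iteratedIntegral_sum T k r hc]
  rw [e]
  simp only [h, LinearMap.sum_apply, LinearMap.smul_apply, Sm.coe_sum, Subalgebra.coe_smul,
    Pi.smul_apply, smul_eq_mul, map_sum, map_smul]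
  rw [iteratedIntegral_sum T k r hc]

end

/-! ### The expansion operators -/

/-- Continuous Taylor coefficients `coeff α η` of the operator coefficients about a continuous
curve `center`. -/
structure TaylorData (d : ℕ) where
  coeff : MultiIndex d → MultiIndex d → ℝ → ℝ
  center : ℝ → Space d
  continuous_coeff : ∀ α ∈ indicesLeTwo d, ∀ η, Continuous (coeff α η)
  continuous_center : ∀ j, Continuous fun t => center t j

section
variable (q : FrozenCoeff d) (b : TaylorData d)

/-- The components of `𝒵(t,s)` minus the centre at time `s`, on smooth functions. -/
def smCenteredZ (s t : ℝ) (j : Fin (d + 1)) : SmOp d :=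
  shiftOp q j t + ((∫ r in (0 : ℝ)..s, q.drift r j) - b.center s j) • 1 +
    ∑ l, (∫ r in (0 : ℝ)..s, q.cov r j l) • smDeriv l

/-- The operator `𝒢_n(t,s)` on smooth functions. -/
def smG (n : ℕ) (s t : ℝ) : SmOp d :=
  ∑ α ∈ indicesLeTwo d, ∑ η ∈ indicesOfOrder d n,
    ((1 / (multiFactorial η : ℝ)) * b.coeff α η s) •
      (ordPow (smCenteredZ q b s t) η * smMultiDeriv α)

/-- The product `𝒢_{i₁}(t,t₁) ⋯ 𝒢_{i_k}(t,t_k)` on smooth functions. -/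
def smGProd {k : ℕ} (i : Fin k → ℕ) (τ : Fin k → ℝ) (t : ℝ) : SmOp d :=
  ((List.finRange k).map fun j => smG q b (i j) (τ j) t).prod

variable {q b}

theorem continuous_integral_right {g : ℝ → ℝ} (hg : Continuous g) :
    Continuous fun t => ∫ r in (0 : ℝ)..t, g r :=
  continuous_iff_continuousAt.2 fun t => (hasDerivAt_integral_right hg t).continuousAt

/-- The dependence on `t` sits entirely in `shiftOp`; the terms depending on `s` are scalars times
the identity or `∂_l`. -/
theorem isSeparable_smCenteredZ (j : Fin (d + 1)) :
    IsSeparable q fun s t => smCenteredZ q b s t j :=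
  ((IsSeparable.of_mem (shiftOp_mem_flowAlg j)).add (IsSeparable.one.smul
    ((continuous_integral_right (q.continuous_drift j)).sub (b.continuous_center j)))).add
    (IsSeparable.sum _ fun l _ => (IsSeparable.of_mem (smDeriv_mem_flowAlg l)).smul
      (continuous_integral_right (q.continuous_cov j l)))

theorem isSeparable_smG (n : ℕ) : IsSeparable q (smG q b n) := by
  refine IsSeparable.sum _ fun α hα => IsSeparable.sum _ fun η _ => IsSeparable.smul ?_
    (continuous_const.mul (b.continuous_coeff α hα η))
  refine IsSeparable.mul (IsSeparable.list_prod _ fun j =>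
    (isSeparable_smCenteredZ j).pow _) ?_
  exact IsSeparable.list_prod _ fun j => (IsSeparable.of_mem (smDeriv_mem_flowAlg j)).pow _

theorem isSeparable_smGProd {k : ℕ} (i : Fin k → ℕ) :
    IsSeparable q (smGProd q b i) :=
  IsSeparable.list_prod _ fun j => (isSeparable_smG (i j)).comp (continuous_apply j)

theorem smGProd_cons {k : ℕ} (m : ℕ) (i : Fin k → ℕ) (s : ℝ) (τ : Fin k → ℝ) (t : ℝ) :
    smGProd q b (Fin.cons m i : Fin (k + 1) → ℕ) (Fin.cons s τ) t =
      smG q b m s t * smGProd q b i τ t := by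
  simp [smGProd, List.finRange_succ, Function.comp_def]

variable (q b) in
/-- The operators `𝓛_n`, with the iterated integrals starting at `r`. -/
def smL (T : ℝ) (n : ℕ) (r t : ℝ) : SmOp d :=
  ∑ k ∈ Finset.range (n + 1), ∑ i ∈ compositions n k,
    operatorIntegral T (isSeparable_smGProd (q := q) (b := b) i) r t

theorem smL_mem (T : ℝ) (n : ℕ) (r : ℝ) : smL q b T n r ∈ flowAlg q := by
  have h : smL q b T n r = ∑ k ∈ Finset.range (n + 1), ∑ i ∈ compositions n k,
      operatorIntegral T (isSeparable_smGProd (q := q) (b := b) i) r := by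
    ext1 t
    simp [smL, Finset.sum_apply]
  rw [h]
  exact sum_mem fun k _ => sum_mem fun i _ => operatorIntegral_mem T _ r

theorem mem_compositions {n k : ℕ} {i : Fin k → ℕ} :
    i ∈ compositions n k ↔ ∑ j, i j = n ∧ ∀ j, 1 ≤ i j := by
  simp [compositions]

theorem compositions_eq_empty {n k : ℕ} (h : n < k) : compositions n k = ∅ := by
  refine Finset.eq_empty_of_forall_notMem fun i hi => ?_
  obtain ⟨h1, h2⟩ := mem_compositions.1 hi
  have h3 : ∑ _j : Fin k, 1 ≤ ∑ j, i j := Finset.sum_le_sum fun j _ => h2 j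
  simp at h3
  omega

theorem compositions_zero_right {n : ℕ} (hn : 1 ≤ n) : compositions n 0 = ∅ := by
  refine Finset.eq_empty_of_forall_notMem fun i hi => ?_
  obtain ⟨h1, -⟩ := mem_compositions.1 hi
  simp at h1
  omega

/-- Splitting off the first part of a composition; this is the recursion behind the hierarchy. -/
theorem sum_compositions_succ {M : Type*} [AddCommMonoid M] (n k : ℕ)
    (f : (Fin (k + 1) → ℕ) → M) :
    ∑ i ∈ compositions n (k + 1), f i =
      ∑ m ∈ Finset.Icc 1 n, ∑ i ∈ compositions (n - m) k, f (Fin.cons m i) := by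
  rw [Finset.sum_sigma']
  refine Finset.sum_bij' (fun i _ => ⟨i 0, fun j => i j.succ⟩)
    (fun p _ => (Fin.cons p.1 p.2 : Fin (k + 1) → ℕ)) ?_ ?_ ?_ ?_ ?_
  · intro i hi
    obtain ⟨h1, h2⟩ := mem_compositions.1 hi
    rw [Fin.sum_univ_succ] at h1
    simp only [Finset.mem_sigma, Finset.mem_Icc, mem_compositions]
    exact ⟨⟨h2 0, by omega⟩, by omega, fun j => h2 _⟩
  · rintro ⟨m, i⟩ hp
    simp only [Finset.mem_sigma, Finset.mem_Icc, mem_compositions] at hp ⊢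
    obtain ⟨⟨h1, h2⟩, h3, h4⟩ := hp
    refine ⟨?_, fun j => ?_⟩
    · rw [Fin.sum_univ_succ]
      simp only [Fin.cons_zero, Fin.cons_succ, h3]
      omega
    · refine Fin.cases ?_ (fun j => ?_) j
      · exact h1
      · exact h4 j
  · intro i _
    exact Fin.cons_self_tail i
  · rintro ⟨m, i⟩ _
    rfl
  · intro i _
    exact congrArg f (Fin.cons_self_tail i).symm

theorem smL_apply (T : ℝ) (n : ℕ) (r t : ℝ) (f : Sm d) (z : Space d) :
    (smL q b T n r t f : Space d → ℝ) z = ∑ k ∈ Finset.range (n + 1), ∑ i ∈ compositions n k,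
      iteratedIntegral T k r fun τ => (smGProd q b i τ t f : Space d → ℝ) z := by
  simp only [smL, LinearMap.sum_apply, Sm.coe_sum, operatorIntegral_apply]

/-- The empty composition contributes the identity. Including `k = 0` in `smL` makes order zero fit
the recursion, and for `n ≥ 1` that summand is empty. -/
theorem smL_zero (T r t : ℝ) : smL q b T 0 r t = 1 := by
  ext f z
  rw [smL_apply]
  have h : compositions 0 0 = {Fin.elim0} := by
    ext i
    simp only [mem_compositions, Finset.mem_singleton]
    exact ⟨fun _ => Subsingleton.elim _ _, fun _ => ⟨by simp, fun j => j.elim0⟩⟩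
  simp [h, iteratedIntegral, smGProd]

theorem smL_eq_sum_succ {n : ℕ} (hn : 1 ≤ n) (T r t : ℝ) :
    smL q b T n r t = ∑ k ∈ Finset.range n, ∑ i ∈ compositions n (k + 1),
      operatorIntegral T (isSeparable_smGProd (q := q) (b := b) i) r t := by
  rw [smL, Finset.sum_range_succ', compositions_zero_right hn, Finset.sum_empty, add_zero]

/-- The equation satisfied by `𝓛_n(t,T)` applied to a regular solution. -/
theorem hasDerivAt_smL {T : ℝ} {V : ℝ → Sm d} (hV : IsRegularSol q T V) {n : ℕ} (hn : 1 ≤ n)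
    {t : ℝ} (ht : t ∈ Ioo (-1) T) (z : Space d) :
    HasDerivAt (fun s => (smL q b T n s s (V s) : Space d → ℝ) z)
      (-((gen q t (smL q b T n t t (V t)) : Space d → ℝ) z + ∑ m ∈ Finset.Icc 1 n,
        (smG q b m t t (smL q b T (n - m) t t (V t)) : Space d → ℝ) z)) t := by
  have hfun : (fun s => (smL q b T n s s (V s) : Space d → ℝ) z) =
      fun s => ∑ k ∈ Finset.range n, ∑ i ∈ compositions n (k + 1),
        (operatorIntegral T (isSeparable_smGProd (q := q) (b := b) i) s s (V s) :
          Space d → ℝ) z := by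
    ext s
    simp only [smL_eq_sum_succ hn, LinearMap.sum_apply, Sm.coe_sum]
  rw [hfun]
  refine (HasDerivAt.fun_sum fun k _ => HasDerivAt.fun_sum fun i _ =>
    hasDerivAt_operatorIntegral (isSeparable_smGProd i) hV ht z).congr_deriv ?_
  -- With the first time fixed at `t`, the leftmost factor no longer depends on the integration
  -- variables and comes out of the integral.
  have h1 : ∀ k ∈ Finset.range n, ∑ i ∈ compositions n (k + 1),
      iteratedIntegral T k t (fun τ =>
        (smGProd q b i (Fin.cons t τ) t (V t) : Space d → ℝ) z) =
      ∑ m ∈ Finset.Icc 1 n, ∑ i ∈ compositions (n - m) k,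
        (smG q b m t t (operatorIntegral T (isSeparable_smGProd (q := q) (b := b) i) t t (V t)) :
          Space d → ℝ) z := by
    intro k _
    rw [sum_compositions_succ]
    refine Finset.sum_congr rfl fun m _ => Finset.sum_congr rfl fun i _ => ?_
    simp only [smGProd_cons, Module.End.mul_apply]
    exact iteratedIntegral_mul_left _ _ _ _ _ _
  -- Compositions of `n - m` have at most `n - m` parts, so the sum over all `k < n` is the full
  -- order `n - m` operator.
  have h2 : ∀ m ∈ Finset.Icc 1 n, ∑ k ∈ Finset.range n, ∑ i ∈ compositions (n - m) k,
        (smG q b m t t (operatorIntegral T (isSeparable_smGProd (q := q) (b := b) i) t t (V t)) :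
          Space d → ℝ) z =
      (smG q b m t t (smL q b T (n - m) t t (V t)) : Space d → ℝ) z := by
    intro m hm
    rw [Finset.mem_Icc] at hm
    simp only [smL, LinearMap.sum_apply, map_sum, Sm.coe_sum]
    refine (Finset.sum_subset (Finset.range_subset_range.2 (by omega)) fun k _ hk => ?_).symm
    rw [Finset.mem_range, not_lt] at hk
    rw [compositions_eq_empty (by omega), Finset.sum_empty]
  have h3 : (gen q t (smL q b T n t t (V t)) : Space d → ℝ) z =
      ∑ k ∈ Finset.range n, ∑ i ∈ compositions n (k + 1), (gen q t
        (operatorIntegral T (isSeparable_smGProd (q := q) (b := b) i) t t (V t)) :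
          Space d → ℝ) z := by
    simp only [smL_eq_sum_succ hn, LinearMap.sum_apply, map_sum, Sm.coe_sum]
  rw [h3, ← Finset.sum_congr rfl h2, Finset.sum_comm, ← Finset.sum_congr rfl h1]
  simp only [Finset.sum_sub_distrib, Finset.sum_neg_distrib]
  ring

/-- The operators with integrals starting at `r` vanish as `r → T`. -/
theorem tendsto_smL {n : ℕ} (hn : 1 ≤ n) (T t : ℝ) (f : Sm d) (z : Space d) :
    Filter.Tendsto (fun r => (smL q b T n r t f : Space d → ℝ) z) (nhds T) (nhds 0) := by
  simp only [smL_eq_sum_succ hn, LinearMap.sum_apply, Sm.coe_sum, operatorIntegral_apply]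
  have hc : Continuous fun r => ∑ k ∈ Finset.range n, ∑ i ∈ compositions n (k + 1),
      iteratedIntegral T (k + 1) r fun τ => (smGProd q b i τ t f : Space d → ℝ) z :=
    continuous_finsetSum _ fun k _ => continuous_finsetSum _ fun i _ =>
      continuous_iteratedIntegral_left T _
        (continuous_separable_apply (isSeparable_smGProd i) t f z)
  have h := hc.tendsto T
  simpa only [iteratedIntegral_succ_self, Finset.sum_const_zero] using h

end

/-! ### Freezing the coefficients along the curve -/

theorem foldr_iterate_single {ι X : Type*} [DecidableEq ι] (B : ι → X → X) (j : ι) (f : X)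
    {L : List ι} (hL : L.Nodup) :
    L.foldr (fun i g => (B i)^[(Pi.single j 1 : ι → ℕ) i] g) f =
      if j ∈ L then B j f else f := by
  induction L with
  | nil => simp
  | cons i L ih =>
    obtain ⟨hi, hL⟩ := List.nodup_cons.1 hL
    rw [List.foldr_cons, ih hL]
    by_cases hij : i = j
    · subst hij
      simp [hi]
    · have hji : j ≠ i := Ne.symm hij
      simp [hij, hji]

/-- Commutation is needed only when `l` precedes `j` in the list, since the fold then applies the
two operators in the opposite order. -/
theorem foldr_iterate_single_add_single {ι X : Type*} [DecidableEq ι] (B : ι → X → X) (j l : ι)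
    (f : X) (hB : B j (B l f) = B l (B j f)) {L : List ι} (hL : L.Nodup) :
    L.foldr (fun i g => (B i)^[(Pi.single j 1 + Pi.single l 1 : ι → ℕ) i] g) f =
      if j ∈ L then (if l ∈ L then B j (B l f) else B j f) else
        (if l ∈ L then B l f else f) := by
  induction L with
  | nil => simp
  | cons i L ih =>
    obtain ⟨hi, hL⟩ := List.nodup_cons.1 hL
    rw [List.foldr_cons, ih hL]
    by_cases hij : i = j
    · subst hij
      by_cases hil : i = l
      · subst hil
        simp [hi]
      · have hli : l ≠ i := Ne.symm hil
        by_cases h : l ∈ L <;> simp [hi, hil, hli, h]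
    · have hji : j ≠ i := Ne.symm hij
      by_cases hil : i = l
      · subst hil
        by_cases h : j ∈ L <;> simp [hi, hij, hji, h, hB]
      · have hli : l ≠ i := Ne.symm hil
        simp [hij, hji, hil, hli]

theorem multiDeriv_zero (f : Space d → ℝ) : multiDeriv 0 f = f := by
  unfold multiDeriv opMonomial
  induction List.finRange (d + 1) with
  | nil => rfl
  | cons j l ih => rw [List.foldr_cons, ih]; rfl

theorem multiDeriv_single (j : Fin (d + 1)) (f : Space d → ℝ) :
    multiDeriv (Pi.single j 1) f = partialDeriv j f := by
  have h := foldr_iterate_single (partialDeriv (d := d)) j f (List.nodup_finRange (d + 1))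
  rwa [if_pos (List.mem_finRange j)] at h

theorem multiDeriv_single_add_single (j l : Fin (d + 1)) {f : Space d → ℝ}
    (hf : ContDiff ℝ 2 f) :
    multiDeriv (Pi.single j 1 + Pi.single l 1) f = partialDeriv j (partialDeriv l f) := by
  have h := foldr_iterate_single_add_single (partialDeriv (d := d)) j l f
    (partialDeriv_comm hf j l) (List.nodup_finRange (d + 1))
  rwa [if_pos (List.mem_finRange j), if_pos (List.mem_finRange l)] at h

theorem mem_indicesOfOrder {n : ℕ} {α : MultiIndex d} :
    α ∈ indicesOfOrder d n ↔ ∑ j, α j = n := by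
  simp [indicesOfOrder]

theorem mem_indicesLeTwo {α : MultiIndex d} : α ∈ indicesLeTwo d ↔ ∑ j, α j ≤ 2 := by
  simp [indicesLeTwo, mem_indicesOfOrder, Nat.lt_succ_iff]

theorem sum_single (j : Fin (d + 1)) : ∑ i, (Pi.single j 1 : MultiIndex d) i = 1 := by simp

theorem sum_single_add_single (j l : Fin (d + 1)) :
    ∑ i, (Pi.single j 1 + Pi.single l 1 : MultiIndex d) i = 2 := by
  simp [Finset.sum_add_distrib]

theorem indicesOfOrder_zero : indicesOfOrder d 0 = {0} := by
  ext α
  rw [mem_indicesOfOrder, Finset.mem_singleton, Finset.sum_eq_zero_iff]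
  exact ⟨fun h => funext fun j => h j (Finset.mem_univ j), fun h j _ => congrFun h j⟩

theorem exists_eq_add_single {n : ℕ} {α : MultiIndex d} (h : α ∈ indicesOfOrder d (n + 1)) :
    ∃ β ∈ indicesOfOrder d n, ∃ j, α = β + Pi.single j 1 := by
  rw [mem_indicesOfOrder] at h
  induction α using MultiIndex.induction with
  | h0 => simp at h
  | h1 β j _ =>
    refine ⟨β, mem_indicesOfOrder.2 ?_, j, rfl⟩
    simpa [Finset.sum_add_distrib] using h

theorem sum_indicesOfOrder_one (g : MultiIndex d → ℝ) :
    ∑ α ∈ indicesOfOrder d 1, g α = ∑ j, g (Pi.single j 1) := by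
  refine (Finset.sum_bij (fun j _ => Pi.single j 1) (fun j _ => mem_indicesOfOrder.2
    (sum_single j)) (fun i _ j _ h => ?_) (fun α hα => ?_) fun _ _ => rfl).symm
  · by_contra hij
    have := congrFun h i
    simp [hij] at this
  · obtain ⟨β, hβ, j, rfl⟩ := exists_eq_add_single hα
    rw [indicesOfOrder_zero, Finset.mem_singleton] at hβ
    exact ⟨j, Finset.mem_univ j, by simp [hβ]⟩

theorem single_add_single_eq_iff (i j k l : Fin (d + 1)) :
    (Pi.single j 1 + Pi.single l 1 : MultiIndex d) = Pi.single i 1 + Pi.single k 1 ↔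
      (j = i ∧ l = k) ∨ (j = k ∧ l = i) := by
  constructor
  · intro h
    have h1 := congrFun h j
    have h2 := congrFun h l
    have h3 := congrFun h i
    simp only [Pi.add_apply, Pi.single_apply] at h1 h2 h3
    grind
  · rintro (⟨rfl, rfl⟩ | ⟨rfl, rfl⟩)
    · rfl
    · exact add_comm _ _

/-- The map `(j,l) ↦ e_j + e_l` is two-to-one off the diagonal and injective on it. Doubling the
diagonal and halving the sum counts each multi-index once, which is why the covariance matrix
carries a factor `2` on its diagonal. -/
theorem sum_indicesOfOrder_two (g : MultiIndex d → ℝ) :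
    ∑ α ∈ indicesOfOrder d 2, g α =
      (1 / 2) * ∑ j, ∑ l, (if j = l then 2 else 1) * g (Pi.single j 1 + Pi.single l 1) := by
  have e : ∑ j, ∑ l, (if j = l then 2 else 1) * g (Pi.single j 1 + Pi.single l 1) =
      ∑ p : Fin (d + 1) × Fin (d + 1),
        (if p.1 = p.2 then 2 else 1) * g (Pi.single p.1 1 + Pi.single p.2 1) :=
    by rw [Fintype.sum_prod_type]
  rw [e, ← Finset.sum_fiberwise_of_maps_to (t := indicesOfOrder d 2)
      (g := fun p : Fin (d + 1) × Fin (d + 1) => Pi.single p.1 1 + Pi.single p.2 1)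
      fun p _ => mem_indicesOfOrder.2 (sum_single_add_single _ _), Finset.mul_sum]
  refine Finset.sum_congr rfl fun α hα => ?_
  obtain ⟨β, hβ, k, rfl⟩ := exists_eq_add_single hα
  obtain ⟨γ, hγ, i, rfl⟩ := exists_eq_add_single hβ
  rw [indicesOfOrder_zero, Finset.mem_singleton] at hγ
  subst hγ
  rw [zero_add]
  have h : Finset.univ.filter (fun p : Fin (d + 1) × Fin (d + 1) =>
      (Pi.single p.1 1 + Pi.single p.2 1 : MultiIndex d) = Pi.single i 1 + Pi.single k 1) =
      {(i, k), (k, i)} := by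
    ext ⟨j, l⟩
    simp [single_add_single_eq_iff]
  rw [h]
  by_cases hik : i = k
  · subst hik
    simp
  · have h' : (i, k) ≠ (k, i) := fun h => hik (Prod.ext_iff.1 h).1
    rw [Finset.sum_pair h', if_neg hik, if_neg (Ne.symm hik),
      add_comm (Pi.single k 1 : MultiIndex d)]
    ring

theorem sum_indicesLeTwo (g : MultiIndex d → ℝ) :
    ∑ α ∈ indicesLeTwo d, g α = g 0 + ∑ j, g (Pi.single j 1) +
      (1 / 2) * ∑ j, ∑ l, (if j = l then 2 else 1) * g (Pi.single j 1 + Pi.single l 1) := by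
  rw [indicesLeTwo, Finset.sum_biUnion, Finset.sum_range_succ, Finset.sum_range_succ,
    Finset.sum_range_one, indicesOfOrder_zero, Finset.sum_singleton, sum_indicesOfOrder_one,
    sum_indicesOfOrder_two]
  intro m _ n _ hmn
  rw [Function.onFun, Finset.disjoint_left]
  intro α h1 h2
  exact hmn ((mem_indicesOfOrder.1 h1).symm.trans (mem_indicesOfOrder.1 h2))

/-- For fixed `x`, positivity of the integrated forms makes `s ↦ xᵀ (∫_0^s c) x` monotone on
`[0,T]`, and its derivative is the instantaneous form. Thus the assumption on integrated covariances
gives the semidefiniteness required by the maximum principle. -/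
theorem posSemidef_of_integral {n : Type*} [Fintype n] {T : ℝ} (hT : 0 < T)
    {c : ℝ → Matrix n n ℝ} (hc : ∀ j l, Continuous fun t => c t j l)
    (hs : ∀ t j l, c t j l = c t l j)
    (hC : ∀ t s : ℝ, 0 ≤ t → t < s → s ≤ T →
      (Matrix.of fun j l => ∫ r in t..s, c r j l).PosSemidef) {t : ℝ} (ht : t ∈ Icc 0 T) :
    (c t).PosSemidef := by
  apply Matrix.PosSemidef.of_dotProduct_mulVec_nonneg
  · ext j l
    exact hs t l j
  · intro x
    rw [dotProduct_mulVec_eq_sum]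
    have hg : ∀ j l, Continuous fun r => c r j l * (x j * x l) := fun j l =>
      (hc j l).mul continuous_const
    have hd : ∀ t, HasDerivAt (fun s => ∑ j, ∑ l, (∫ r in (0 : ℝ)..s, c r j l) * (x j * x l))
        (∑ j, ∑ l, c t j l * (x j * x l)) t := fun t =>
      HasDerivAt.fun_sum fun j _ => HasDerivAt.fun_sum fun l _ =>
        (hasDerivAt_integral_right (hc j l) t).mul_const _
    have hm : MonotoneOn (fun s => ∑ j, ∑ l, (∫ r in (0 : ℝ)..s, c r j l) * (x j * x l))
        (Icc 0 T) := by
      intro t ht s hs hts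
      rcases hts.eq_or_lt with rfl | hts
      · exact le_rfl
      have h := (hC t s ht.1 hts hs.2).dotProduct_mulVec_nonneg x
      rw [dotProduct_mulVec_eq_sum] at h
      have e : ∀ j l, ∫ r in (0 : ℝ)..s, c r j l =
          (∫ r in (0 : ℝ)..t, c r j l) + ∫ r in t..s, c r j l := fun j l =>
        (intervalIntegral.integral_add_adjacent_intervals ((hc j l).intervalIntegrable _ _)
          ((hc j l).intervalIntegrable _ _)).symm
      simp only [e, add_mul, Finset.sum_add_distrib]
      exact le_add_of_nonneg_right h
    have := (hd t).hasDerivWithinAt (s := Icc 0 T)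
    rw [← this.derivWithin ((uniqueDiffOn_Icc hT) t ht)]
    exact hm.derivWithin_nonneg

/-- The spatially frozen coefficients `q` and the Taylor data `b` are those of the operator with
coefficients `a`, expanded about the curve `zbar`, on the time interval `[0,T]`. -/
structure IsFreezing (T : ℝ) (a : MultiIndex d → ℝ → Space d → ℝ) (zbar : ℝ → Space d)
    (q : FrozenCoeff d) (b : TaylorData d) : Prop where
  rate : ∀ t ∈ Icc 0 T, q.rate t = a 0 t (zbar t)
  drift : ∀ t ∈ Icc 0 T, q.drift t = driftVec a zbar t
  cov : ∀ t ∈ Icc 0 T, q.cov t = covMatrix a zbar t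
  center : ∀ t ∈ Icc 0 T, b.center t = zbar t
  coeff : ∀ t ∈ Icc 0 T, ∀ α η, b.coeff α η t = multiDeriv η (a α t) (zbar t)

theorem FrozenCoeff.exists_boundedOn (q : FrozenCoeff d) {s : Set ℝ} (hs : IsCompact s) :
    ∃ B, q.BoundedOn B s := by
  have h : Continuous fun t => |q.rate t| + (∑ j, |q.drift t j|) + ∑ j, |q.cov t j j| :=
    (q.continuous_rate.abs.add (continuous_finsetSum _ fun j _ => (q.continuous_drift j).abs)).add
      (continuous_finsetSum _ fun j _ => (q.continuous_cov j j).abs)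
  obtain ⟨B, hB⟩ := hs.bddAbove_image h.continuousOn
  have hB' : ∀ t ∈ s, |q.rate t| + (∑ j, |q.drift t j|) + ∑ j, |q.cov t j j| ≤ B :=
    fun t ht => hB (mem_image_of_mem _ ht)
  have h1 : ∀ t, 0 ≤ ∑ j, |q.drift t j| := fun t => Finset.sum_nonneg fun _ _ => abs_nonneg _
  have h2 : ∀ t, 0 ≤ ∑ j, |q.cov t j j| := fun t => Finset.sum_nonneg fun _ _ => abs_nonneg _
  refine ⟨B, fun t ht => ?_, fun t ht j => ?_, fun t ht j => ?_⟩
  · linarith [hB' t ht, h1 t, h2 t]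
  · have := Finset.single_le_sum (f := fun j => |q.drift t j|) (fun _ _ => abs_nonneg _)
      (Finset.mem_univ j)
    linarith [hB' t ht, abs_nonneg (q.rate t), h2 t]
  · have := Finset.single_le_sum (f := fun j => |q.cov t j j|) (fun _ _ => abs_nonneg _)
      (Finset.mem_univ j)
    linarith [hB' t ht, abs_nonneg (q.rate t), h1 t]

/-- Composing with the projection onto `[0,T]` extends all data continuously and constantly beyond
the ends, so that two-sided time derivatives are available at `t = 0`. -/
theorem exists_isFreezing {T : ℝ} (hT : 0 < T) {a : MultiIndex d → ℝ → Space d → ℝ}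
    {zbar : ℝ → Space d}
    (ha_cont : ∀ α ∈ indicesLeTwo d, ∀ η : MultiIndex d,
      ContinuousOn (fun t => multiDeriv η (a α t) (zbar t)) (Icc 0 T))
    (hzbar : ContinuousOn zbar (Icc 0 T))
    (hC : ∀ t s : ℝ, 0 ≤ t → t < s → s ≤ T → (covInt a zbar t s).PosDef) :
    ∃ q b, IsFreezing T a zbar q b := by
  let pr : ℝ → ℝ := fun t => projIcc 0 T hT.le t
  have hpr : ∀ t, pr t ∈ Icc 0 T := fun t => (projIcc 0 T hT.le t).2
  have hpr' : ∀ t ∈ Icc 0 T, pr t = t := fun t ht => by simp [pr, projIcc_of_mem hT.le ht]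
  have hext : ∀ {E : Type} [TopologicalSpace E] {f : ℝ → E}, ContinuousOn f (Icc 0 T) →
      Continuous fun t => f (pr t) := fun hf =>
    hf.comp_continuous (continuous_subtype_val.comp continuous_projIcc) hpr
  have ha : ∀ α ∈ indicesLeTwo d, Continuous fun t => a α (pr t) (zbar (pr t)) := fun α hα => by
    have := hext (ha_cont α hα 0)
    simpa only [multiDeriv_zero] using this
  have hcov : ∀ j l, Continuous fun t => covMatrix a zbar (pr t) j l := fun j l =>
    continuous_const.mul (ha _ (mem_indicesLeTwo.2 (sum_single_add_single j l).le))
  have hpsd : ∀ t, (covMatrix a zbar (pr t)).PosSemidef := fun t => by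
    have h := posSemidef_of_integral hT hcov (fun t j l => ?_) (fun t s h0 hts hs => ?_) (hpr t)
    · rwa [hpr' _ (hpr t)] at h
    · simp only [covMatrix, Matrix.of_apply, add_comm (Pi.single j 1 : MultiIndex d), eq_comm]
    · convert (hC t s h0 hts hs).posSemidef using 1
      ext j l
      refine intervalIntegral.integral_congr fun r hr => ?_
      rw [uIcc_of_le hts.le] at hr
      simp only [hpr' r ⟨h0.trans hr.1, hr.2.trans hs⟩]
  refine ⟨⟨fun t => a 0 (pr t) (zbar (pr t)), fun t => driftVec a zbar (pr t),
    fun t => covMatrix a zbar (pr t), ha 0 (mem_indicesLeTwo.2 (by simp)),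
    fun j => ha _ (mem_indicesLeTwo.2 (by rw [sum_single]; norm_num)), hcov, hpsd⟩,
    ⟨fun α η t => multiDeriv η (a α (pr t)) (zbar (pr t)), fun t => zbar (pr t),
      fun α hα η => hext (ha_cont α hα η), fun j => (continuous_apply j).comp (hext hzbar)⟩, ?_⟩
  constructor <;> intro t ht <;> simp only [hpr' t ht]
  exact fun _ _ => trivial

/-! ### The operators of the expansion on smooth functions -/

theorem taylorCoeff_zero (a : MultiIndex d → ℝ → Space d → ℝ) (zbar : ℝ → Space d)
    (α : MultiIndex d) (t : ℝ) (z : Space d) : taylorCoeff a zbar α 0 t z = a α t (zbar t) := by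
  simp [taylorCoeff, indicesOfOrder_zero, multiDeriv_zero, multiFactorial]

theorem integral_eq_sub_of_continuous {f g : ℝ → ℝ} {T t s : ℝ} (hg : Continuous g)
    (h : ∀ r ∈ Icc 0 T, f r = g r) (ht : t ∈ Icc 0 T) (hs : s ∈ Icc 0 T) :
    ∫ r in t..s, f r = (∫ r in (0 : ℝ)..s, g r) - ∫ r in (0 : ℝ)..t, g r := by
  rw [intervalIntegral.integral_interval_sub_left (hg.intervalIntegrable _ _)
    (hg.intervalIntegrable _ _)]
  exact intervalIntegral.integral_congr fun r hr => h r (uIcc_subset_Icc ht hs hr)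

namespace IsFreezing

variable {T : ℝ} {a : MultiIndex d → ℝ → Space d → ℝ} {zbar : ℝ → Space d}
  {q : FrozenCoeff d} {b : TaylorData d}

theorem generatorTerm_zero (h : IsFreezing T a zbar q b) {t : ℝ} (ht : t ∈ Icc 0 T)
    {f : Space d → ℝ} (hf : ContDiff ℝ 2 f) (z : Space d) :
    generatorTerm a zbar 0 t f z = genFn q t f z := by
  simp only [generatorTerm, taylorCoeff_zero, sum_indicesLeTwo, multiDeriv_zero,
    multiDeriv_single, multiDeriv_single_add_single _ _ hf, genFn, h.rate t ht, h.drift t ht,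
    h.cov t ht, driftVec, covMatrix, Matrix.of_apply, mul_assoc]

theorem meanInt_eq (h : IsFreezing T a zbar q b) {t s : ℝ} (ht : t ∈ Icc 0 T) (hs : s ∈ Icc 0 T)
    (j : Fin (d + 1)) : meanInt a zbar t s j =
      (∫ r in (0 : ℝ)..s, q.drift r j) - ∫ r in (0 : ℝ)..t, q.drift r j :=
  integral_eq_sub_of_continuous (q.continuous_drift j)
    (fun r hr => by rw [h.drift r hr]) ht hs

theorem covInt_eq (h : IsFreezing T a zbar q b) {t s : ℝ} (ht : t ∈ Icc 0 T) (hs : s ∈ Icc 0 T)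
    (j l : Fin (d + 1)) : covInt a zbar t s j l =
      (∫ r in (0 : ℝ)..s, q.cov r j l) - ∫ r in (0 : ℝ)..t, q.cov r j l :=
  integral_eq_sub_of_continuous (q.continuous_cov j l)
    (fun r hr => by rw [h.cov r hr]) ht hs

theorem covI_posDef (h : IsFreezing T a zbar q b)
    (hC : ∀ t s : ℝ, 0 ≤ t → t < s → s ≤ T → (covInt a zbar t s).PosDef) (t s : ℝ)
    (ht : 0 ≤ t) (hts : t < s) (hs : s ≤ T) : (q.covI t s).PosDef := by
  convert hC t s ht hts hs using 1
  ext j l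
  refine intervalIntegral.integral_congr fun r hr => ?_
  rw [uIcc_of_le hts.le] at hr
  simp only [h.cov r ⟨ht.trans hr.1, hr.2.trans hs⟩]

theorem centeredZ_coe (h : IsFreezing T a zbar q b) {t s : ℝ} (ht : t ∈ Icc 0 T)
    (hs : s ∈ Icc 0 T) (j : Fin (d + 1)) (f : Sm d) :
    centeredZ a zbar t s j f = (smCenteredZ q b s t j f : Space d → ℝ) := by
  ext z
  simp only [centeredZ, smCenteredZ, shiftOp, h.meanInt_eq ht hs, h.covInt_eq ht hs,
    h.center s hs, LinearMap.add_apply, LinearMap.smul_apply, LinearMap.sum_apply,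
    LinearMap.mulLeft_apply, Module.End.one_apply, Subalgebra.coe_add, Subalgebra.coe_mul,
    Subalgebra.coe_smul, Pi.add_apply, Pi.mul_apply, Pi.smul_apply, smul_eq_mul, Sm.coe_sum,
    coordFn_apply, coe_smDeriv, sub_mul, neg_mul, Finset.sum_sub_distrib, Finset.sum_neg_distrib]
  ring

theorem taylorOp_coe (h : IsFreezing T a zbar q b) {t s : ℝ} (ht : t ∈ Icc 0 T)
    (hs : s ∈ Icc 0 T) (α : MultiIndex d) (n : ℕ) (f : Sm d) (z : Space d) :
    taylorOp a zbar α n t s f z = ∑ η ∈ indicesOfOrder d n,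
      ((1 / (multiFactorial η : ℝ)) * b.coeff α η s) *
        (ordPow (smCenteredZ q b s t) η f : Space d → ℝ) z := by
  simp only [taylorOp, opMonomial_coe (h.centeredZ_coe ht hs), h.coeff s hs]

theorem gOp_coe (h : IsFreezing T a zbar q b) {t s : ℝ} (ht : t ∈ Icc 0 T)
    (hs : s ∈ Icc 0 T) (n : ℕ) (f : Sm d) :
    gOp a zbar n t s f = (smG q b n s t f : Space d → ℝ) := by
  ext z
  simp only [gOp, smG, multiDeriv_coe, h.taylorOp_coe ht hs, LinearMap.sum_apply,
    LinearMap.smul_apply, Module.End.mul_apply, Sm.coe_sum, Subalgebra.coe_smul, Pi.smul_apply,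
    smul_eq_mul]

theorem gProd_coe (h : IsFreezing T a zbar q b) {t : ℝ} (ht : t ∈ Icc 0 T) {k : ℕ}
    {τ : Fin k → ℝ} (hτ : ∀ j, τ j ∈ Icc 0 T) (i : Fin k → ℕ) (f : Sm d) :
    gProd a zbar i t τ f = (smGProd q b i τ t f : Space d → ℝ) := by
  unfold gProd smGProd
  induction List.finRange k with
  | nil => rfl
  | cons j l ih =>
    rw [List.foldr_cons, ih, h.gOp_coe ht (hτ j), List.map_cons, List.prod_cons]
    rfl

theorem lOp_coe (h : IsFreezing T a zbar q b) {t : ℝ} (ht : t ∈ Icc 0 T) {n : ℕ} (hn : 1 ≤ n)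
    (f : Sm d) : lOp a zbar n t T f = (smL q b T n t t f : Space d → ℝ) := by
  ext z
  have e : Finset.Icc 1 n = Finset.Ico 1 (n + 1) := by
    ext k
    simp only [Finset.mem_Icc, Finset.mem_Ico]
    omega
  rw [smL_apply, lOp, Finset.sum_range_succ', compositions_zero_right hn, Finset.sum_empty,
    add_zero, e, Finset.sum_Ico_eq_sum_range]
  refine Finset.sum_congr rfl fun k _ => ?_
  rw [add_comm 1 k]
  refine Finset.sum_congr rfl fun i _ => iteratedIntegral_congr ht.2 fun τ hτ => ?_
  rw [h.gProd_coe ht fun j => ⟨ht.1.trans (hτ j).1, (hτ j).2⟩]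

/-- At equal times the integrals vanish and `𝒵(t,t)` is multiplication by `z`. -/
theorem ordPow_smCenteredZ_self (h : IsFreezing T a zbar q b) {t : ℝ} (ht : t ∈ Icc 0 T)
    (η : MultiIndex d) (f : Sm d) (z : Space d) :
    (ordPow (smCenteredZ q b t t) η f : Space d → ℝ) z =
      (∏ j, (z j - zbar t j) ^ η j) * (f : Space d → ℝ) z := by
  have h1 : ∀ j (f : Sm d), (smCenteredZ q b t t j f : Space d → ℝ) z =
      (z j - zbar t j) * (f : Space d → ℝ) z := fun j f => by
    rw [← h.centeredZ_coe ht ht]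
    simp [centeredZ, meanInt, covInt, sub_mul]
  have h2 : ∀ j (n : ℕ) (f : Sm d), ((smCenteredZ q b t t j ^ n) f : Space d → ℝ) z =
      (z j - zbar t j) ^ n * (f : Space d → ℝ) z := fun j n => by
    induction n with
    | zero => intro f; simp
    | succ n ih =>
      intro f
      rw [pow_succ, Module.End.mul_apply, ih, h1]
      ring
  have h3 : ∀ l : List (Fin (d + 1)), ((l.map fun j => smCenteredZ q b t t j ^ η j).prod f :
      Space d → ℝ) z = (l.map fun j => (z j - zbar t j) ^ η j).prod * (f : Space d → ℝ) z := by
    intro l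
    induction l with
    | nil => simp
    | cons j l ih =>
      simp only [List.map_cons, List.prod_cons, Module.End.mul_apply, h2, ih, mul_assoc]
  rw [ordPow, h3, ← List.ofFn_eq_map, List.prod_ofFn]

/-- The identity `𝒢_n(t,t) = 𝒜_n(t)`, which turns the boundary terms of the iterated integrals into
the sources of the hierarchy. -/
theorem generatorTerm_coe (h : IsFreezing T a zbar q b) {t : ℝ} (ht : t ∈ Icc 0 T) (n : ℕ)
    (f : Sm d) (z : Space d) :
    generatorTerm a zbar n t f z = (smG q b n t t f : Space d → ℝ) z := by
  simp only [generatorTerm, taylorCoeff, smG, multiDeriv_coe, LinearMap.sum_apply,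
    LinearMap.smul_apply, Module.End.mul_apply, Sm.coe_sum, Subalgebra.coe_smul, Pi.smul_apply,
    smul_eq_mul, h.ordPow_smCenteredZ_self ht, h.coeff t ht, Finset.sum_mul]
  refine Finset.sum_congr rfl fun α _ => Finset.sum_congr rfl fun η _ => ?_
  ring

end IsFreezing

/-! ### The hierarchy before the terminal time, and uniqueness. -/

section
variable {T : ℝ} {a : MultiIndex d → ℝ → Space d → ℝ} {zbar : ℝ → Space d}
  {q : FrozenCoeff d} {b : TaylorData d} {V : ℝ → Sm d}

/-- The functions `𝓛_n(t,T)` applied to a regular solution satisfy the hierarchy of equations. -/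
theorem IsFreezing.hasDerivAt_smL (h : IsFreezing T a zbar q b) (hV : IsRegularSol q T V)
    {n : ℕ} (hn : 1 ≤ n) {t : ℝ} (ht : t ∈ Ico 0 T) (z : Space d) :
    HasDerivAt (fun s => (smL q b T n s s (V s) : Space d → ℝ) z)
      (-((gen q t (smL q b T n t t (V t)) : Space d → ℝ) z + ∑ m ∈ Finset.Icc 1 n,
        generatorTerm a zbar m t (smL q b T (n - m) t t (V t) : Space d → ℝ) z)) t := by
  simp only [h.generatorTerm_coe (Ico_subset_Icc_self ht)]
  exact PolyExpansion.hasDerivAt_smL hV hn ⟨by linarith [ht.1], ht.2⟩ z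

/-- The starting point of the integrals enters only through continuous scalars, which gives joint
continuity and growth bounds on the diagonal. -/
theorem isSeparable_operatorIntegral {k : ℕ} {F : (Fin k → ℝ) → ℝ → SmOp d}
    (hF : IsSeparable q F) : IsSeparable q (operatorIntegral T hF) := by
  obtain ⟨ι, _, c, Q, hc, hQ, h⟩ := id hF
  refine ⟨ι, inferInstance, fun i r => iteratedIntegral T k r (c i), Q,
    fun i => continuous_iteratedIntegral_left T k (hc i), hQ, fun r t => ?_⟩
  ext f z
  rw [operatorIntegral_apply]
  simp only [h, LinearMap.sum_apply, LinearMap.smul_apply, Sm.coe_sum, Subalgebra.coe_smul,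
    Pi.smul_apply, smul_eq_mul]
  rw [iteratedIntegral_sum T k r hc]

theorem isSeparable_smL (n : ℕ) : IsSeparable q (smL q b T n) :=
  IsSeparable.sum _ fun _ _ => IsSeparable.sum _ fun _ _ => isSeparable_operatorIntegral _

theorem IsRegularSol.continuousOn_apply (hV : IsRegularSol q T V) :
    ContinuousOn (fun p : ℝ × Space d => (V p.1 : Space d → ℝ) p.2) (Ioo (-1) T ×ˢ univ) := by
  simpa [ordPow_zero] using hV.cont 0

theorem IsRegularSol.growth_apply (hV : IsRegularSol q T V) {T' : ℝ} (hT' : T' < T) :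
    ∃ K c : ℝ, ∀ t ∈ Icc 0 T', ∀ z, |(V t : Space d → ℝ) z| ≤ K * Real.exp (c * ‖z‖) := by
  simpa [ordPow_zero] using hV.growth 0 T' hT'

theorem IsRegularSol.hasDerivAt_apply (hV : IsRegularSol q T V) {t : ℝ} (ht : t ∈ Ioo (-1) T)
    (z : Space d) : HasDerivAt (fun s => (V s : Space d → ℝ) z)
      (-(gen q t (V t) : Space d → ℝ) z) t := by
  simpa [ordPow_zero] using hV.deriv 0 t ht z

theorem IsSeparable.continuousOn_diag {F : ℝ → ℝ → SmOp d} (hF : IsSeparable q F)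
    (hV : IsRegularSol q T V) :
    ContinuousOn (fun p : ℝ × Space d => (F p.1 p.1 (V p.1) : Space d → ℝ) p.2)
      (Ioo (-1) T ×ˢ univ) := by
  obtain ⟨ι, _, c, Q, hc, hQ, h⟩ := hF
  simp only [h, LinearMap.sum_apply, LinearMap.smul_apply, Sm.coe_sum, Subalgebra.coe_smul,
    Pi.smul_apply, smul_eq_mul]
  exact continuousOn_finsetSum _ fun i _ => ((hc i).comp continuous_fst).continuousOn.mul
    (hV.flowAlg (hQ i)).continuousOn_apply

theorem IsSeparable.growth_diag {F : ℝ → ℝ → SmOp d} (hF : IsSeparable q F)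
    (hV : IsRegularSol q T V) {T' : ℝ} (hT' : T' < T) :
    ∃ K c : ℝ, ∀ t ∈ Icc 0 T', ∀ z,
      |(F t t (V t) : Space d → ℝ) z| ≤ K * Real.exp (c * ‖z‖) := by
  obtain ⟨ι, _, c, Q, hc, hQ, h⟩ := hF
  simp only [h, LinearMap.sum_apply, LinearMap.smul_apply, Sm.coe_sum, Subalgebra.coe_smul,
    Pi.smul_apply, smul_eq_mul]
  refine exp_growth_sum _ fun i _ => exp_growth_mul ?_ ((hV.flowAlg (hQ i)).growth_apply hT')
  obtain ⟨K, hK⟩ := isCompact_Icc.bddAbove_image (K := Icc 0 T') (hc i).abs.continuousOn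
  exact ⟨K, fun t ht => hK (mem_image_of_mem _ ht)⟩

/-- Functions of exponential growth tending to zero are uniformly small relative to a weight. -/
theorem eventually_abs_le_weight {v : ℝ → Space d → ℝ} (hT : 0 < T)
    (hcont : ContinuousOn (fun p : ℝ × Space d => v p.1 p.2) (Icc 0 T ×ˢ univ)) {K c κ : ℝ}
    (hgrowth : ∀ t ∈ Icc 0 T, ∀ z, |v t z| ≤ K * Real.exp (c * ‖z‖)) (hκ : 0 ≤ κ) (hc : c < κ)
    (hv : v T = 0) {ε : ℝ} (hε : 0 < ε) :
    ∀ᶠ s in nhdsWithin T (Iio T), ∀ z, |v s z| ≤ ε * weight κ z := by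
  -- Outside a ball the growth bound suffices since `c < κ`; inside, uniform continuity on a compact
  -- cylinder compares with the zero terminal value.
  obtain ⟨R, hR⟩ := exists_radius_exp_le_weight (d := d) hκ hc K hε
  have hcpt : IsCompact (Icc 0 T ×ˢ Metric.closedBall (0 : Space d) R) :=
    isCompact_Icc.prod (isCompact_closedBall _ _)
  have huc := hcpt.uniformContinuousOn_of_continuous
    (hcont.mono (prod_mono_right (subset_univ _)))
  obtain ⟨δ, hδ, H⟩ := Metric.uniformContinuousOn_iff.1 huc ε hε
  have h1 : Ioo (max 0 (T - δ)) T ∈ nhdsWithin T (Iio T) :=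
    Ioo_mem_nhdsLT (max_lt hT (by linarith))
  filter_upwards [h1] with s hs z
  have hs0 : 0 < s := (le_max_left _ _).trans_lt hs.1
  have hsI : s ∈ Icc 0 T := ⟨hs0.le, hs.2.le⟩
  rcases le_total R ‖z‖ with hz | hz
  · exact (hgrowth s hsI z).trans (hR z hz)
  · have hzb : z ∈ Metric.closedBall (0 : Space d) R := by simpa using hz
    have hdist : dist (s, z) (T, z) < δ := by
      rw [Prod.dist_eq, dist_self, max_eq_left dist_nonneg, Real.dist_eq, abs_lt]
      have := (le_max_right 0 (T - δ)).trans_lt hs.1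
      constructor <;> linarith [hs.2]
    have h2 := H (s, z) ⟨hsI, hzb⟩ (T, z) ⟨⟨hT.le, le_rfl⟩, hzb⟩ hdist
    simp only [hv, Pi.zero_apply, dist_zero_right, Real.norm_eq_abs] at h2
    exact h2.le.trans (le_mul_of_one_le_right hε.le (one_le_weight κ z))

/-- Uniqueness: a classical solution of the `n`-th order problem whose source term is that of
the expansion is the `n`-th term of the expansion. -/
theorem eq_smL_of_isClassicalSolution {B : ℝ} (h : IsFreezing T a zbar q b) (hT : 0 < T)
    (hq : q.BoundedOn B (Icc (-1) T)) (hV : IsRegularSol q T V) {n : ℕ} (hn : 1 ≤ n)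
    {f v : ℝ → Space d → ℝ}
    (hf : ∀ t ∈ Ico 0 T, ∀ z, f t z = ∑ m ∈ Finset.Icc 1 n,
      generatorTerm a zbar m t (smL q b T (n - m) t t (V t) : Space d → ℝ) z)
    (hv : IsClassicalSolution T (generatorTerm a zbar 0) f (fun _ => 0) v)
    {t : ℝ} (ht : t ∈ Ico 0 T) (z : Space d) :
    v t z = (smL q b T n t t (V t) : Space d → ℝ) z := by
  obtain ⟨K, c, hKc⟩ := hv.growth
  have hB : 0 ≤ B := (abs_nonneg _).trans (hq.rate T ⟨by linarith, le_rfl⟩)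
  let κ : ℝ := max c 0 + 1
  have hκ : 0 ≤ κ := by positivity
  have hcκ : c < κ := (le_max_left c 0).trans_lt (lt_add_one _)
  have hgr : 0 ≤ growthRate B κ := by unfold growthRate; positivity
  let C : ℝ := Real.exp (growthRate B κ * T) * weight κ z
  have hC : 0 < C := mul_pos (Real.exp_pos _) (weight_pos _ _)
  let x : ℝ := v t z - (smL q b T n t t (V t) : Space d → ℝ) z
  have key : ∀ ε > 0, |x| ≤ ε * C := by
    intro ε hε
    -- For fixed `t < T` the correction with integrals started at `r` vanishes as `r` tends to `T`,
    -- so it suffices to bound the corrected difference for starting points near `T`.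
    have hlim : Filter.Tendsto (fun r => |x + (smL q b T n r t (V t) : Space d → ℝ) z|)
        (nhdsWithin T (Iio T)) (nhds |x|) := by
      have := ((tendsto_smL (q := q) (b := b) hn T t (V t) z).mono_left
        (nhdsWithin_le_nhds (s := Iio T))).const_add x
      rw [add_zero] at this
      exact this.abs
    refine le_of_tendsto hlim ?_
    filter_upwards [eventually_abs_le_weight hT hv.continuousOn hKc hκ hcκ hv.terminal hε,
      Ioo_mem_nhdsLT ht.2] with T' hsmall hT'
    have hT'0 : 0 < T' := ht.1.trans_lt hT'.1
    have hIcc : Icc 0 T' ⊆ Icc 0 T := Icc_subset_Icc_right hT'.2.le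
    have hIco : Ico 0 T' ⊆ Ico 0 T := Ico_subset_Ico_right hT'.2.le
    have hIoo : Icc 0 T' ⊆ Ioo (-1) T := fun s hs => ⟨by linarith [hs.1], hs.2.trans_lt hT'.2⟩
    -- The first summand cancels the source of `v`; the second solves the homogeneous equation and
    -- cancels the first at `s = T'`. Hence `v + U` is a homogeneous solution equal to `v` at `T'`.
    let U : ℝ → Sm d := fun s =>
      (-1 : ℝ) • smL q b T n s s (V s) + smL q b T n T' s (V s)
    have hW : IsRegularSol q T fun s => smL q b T n T' s (V s) := hV.flowAlg (smL_mem T n T')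
    have hUcont : ContinuousOn (fun p : ℝ × Space d => (U p.1 : Space d → ℝ) p.2)
        (Icc 0 T' ×ˢ univ) :=
      ((((isSeparable_smL n).continuousOn_diag hV).const_smul (-1 : ℝ)).add
        hW.continuousOn_apply).mono (prod_mono_left hIoo)
    have hUgrowth : ∃ K c : ℝ, ∀ s ∈ Icc 0 T', ∀ z,
        |(U s : Space d → ℝ) z| ≤ K * Real.exp (c * ‖z‖) :=
      exp_growth_add (exp_growth_mul (b := fun _ => -1) ⟨|(-1 : ℝ)|, fun _ _ => le_rfl⟩
        ((isSeparable_smL n).growth_diag hV hT'.2)) (hW.growth_apply hT'.2)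
    have hUd : ∀ s ∈ Ico 0 T', ∀ z, HasDerivAt (fun s => (U s : Space d → ℝ) z)
        (f s z - genFn q s (U s) z) s := by
      intro s hs z
      refine (((h.hasDerivAt_smL hV hn (hIco hs) z).const_mul (-1)).add
        (hW.hasDerivAt_apply (hIoo (Ico_subset_Icc_self hs)) z)).congr_deriv ?_
      rw [hf s (hIco hs), ← coe_gen]
      simp only [U, map_add, map_smul, Subalgebra.coe_add, Subalgebra.coe_smul, Pi.add_apply,
        Pi.smul_apply, smul_eq_mul]
      ring
    let w : ℝ → Space d → ℝ := fun s => v s + U s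
    have hwcont : ContinuousOn (fun p : ℝ × Space d => w p.1 p.2) (Icc 0 T' ×ˢ univ) :=
      (hv.continuousOn.mono (prod_mono_left hIcc)).add hUcont
    have hwC2 : ∀ s ∈ Ico 0 T', ContDiff ℝ 2 (w s) := fun s hs =>
      (hv.contDiff s (hIco hs)).add (U s).contDiff_two
    obtain ⟨K', c', hw⟩ := exp_growth_add (f := v) (s := Icc 0 T')
      ⟨K, c, fun s hs => hKc s (hIcc hs)⟩ hUgrowth
    have hwd : ∀ s ∈ Ico 0 T', ∀ z,
        HasDerivWithinAt (fun s => w s z) (-genFn q s (w s) z) (Icc 0 T') s := by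
      intro s hs z
      refine (((hv.pde s (hIco hs) z).mono hIcc).add
        (hUd s hs z).hasDerivWithinAt).congr_deriv ?_
      rw [h.generatorTerm_zero (Ico_subset_Icc_self (hIco hs)) (hv.contDiff s (hIco hs)),
        genFn_add q s (hv.contDiff s (hIco hs)) (U s).contDiff_two]
      ring
    have hwT : ∀ z, w T' z = v T' z := fun z => by
      simp [w, U]
    have hqB : q.BoundedOn B (Icc 0 T') := by
      have hsub : Icc 0 T' ⊆ Icc (-1) T := Icc_subset_Icc (by norm_num) hT'.2.le
      exact ⟨fun s hs => hq.rate s (hsub hs), fun s hs => hq.drift s (hsub hs),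
        fun s hs => hq.cov s (hsub hs)⟩
    have htT' : t ∈ Icc 0 T' := ⟨ht.1, hT'.1.le⟩
    have hexp : ε * (Real.exp (growthRate B κ * (T' - t)) * weight κ z) ≤ ε * C := by
      refine mul_le_mul_of_nonneg_left (mul_le_mul_of_nonneg_right (Real.exp_le_exp.2
        (mul_le_mul_of_nonneg_left ?_ hgr)) (weight_pos _ _).le) hε.le
      linarith [ht.1, hT'.2]
    have hup := le_barrier_of_subsolution q hqB hκ hε.le hwcont hwC2
      ⟨K', c', fun s hs z => (le_abs_self _).trans (hw s hs z)⟩ hwd (fun _ _ _ => le_rfl)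
      (fun z => (hwT z).trans_le ((le_abs_self _).trans (hsmall z))) t htT' z
    have hlo := le_barrier_of_subsolution q hqB hκ hε.le (w := fun s => (-1 : ℝ) • w s)
      (hwcont.const_smul (-1 : ℝ)) (fun s hs => (hwC2 s hs).const_smul (-1 : ℝ))
      ⟨K', c', fun s hs z => by
        rw [Pi.smul_apply, smul_eq_mul, neg_one_mul]
        exact (neg_le_abs _).trans (hw s hs z)⟩
      (fun s hs z => (hwd s hs z).const_smul (-1 : ℝ))
      (fun s hs z => by rw [genFn_smul q s _ (hwC2 s hs), smul_eq_mul]; linarith)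
      (fun z => by simpa [hwT] using (neg_le_abs _).trans (hsmall z)) t htT' z
    have hx : x + (smL q b T n T' t (V t) : Space d → ℝ) z = w t z := by
      simp only [x, w, U, Subalgebra.coe_add, Subalgebra.coe_smul, Pi.add_apply,
        Pi.smul_apply, smul_eq_mul]
      ring
    rw [hx, abs_le]
    simp only [Pi.smul_apply, smul_eq_mul] at hlo
    constructor <;> linarith
  have hx : x = 0 := by
    by_contra hne
    have hpos := abs_pos.2 hne
    -- This choice yields `|x| ≤ |x| / 2`.
    have := key (|x| / (2 * C)) (by positivity)
    rw [div_mul_eq_mul_div, le_div_iff₀ (by positivity)] at this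
    nlinarith
  exact sub_eq_zero.1 hx

end

end PolyExpansion

end

/-! ### The theorem. -/

open PolyExpansion in
theorem proposition5p1 (d : ℕ) (T : ℝ) (hT : 0 < T)
    (a : MultiIndex d → ℝ → Space d → ℝ) (zbar : ℝ → Space d)
    (ha_smooth : ∀ α ∈ indicesLeTwo d, ∀ t ∈ Icc 0 T, ContDiff ℝ ∞ (a α t))
    (ha_cont : ∀ α ∈ indicesLeTwo d, ∀ η : MultiIndex d,
      ContinuousOn (fun t => multiDeriv η (a α t) (zbar t)) (Icc 0 T))
    (hzbar : ContinuousOn zbar (Icc 0 T))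
    (hC : ∀ t s : ℝ, 0 ≤ t → t < s → s ≤ T → (covInt a zbar t s).PosDef)
    (φ : Space d → ℝ) (v : ℕ → ℝ → Space d → ℝ)
    (hv₀ : IsClassicalSolution T (generatorTerm a zbar 0) (fun _ _ => 0) φ (v 0)) :
    -- `v₀(t,·)` is smooth, so that differential operators of any order can be applied to it
    (∀ t ∈ Ico 0 T, ContDiff ℝ ∞ (v 0 t)) ∧
    -- `𝓛_n(t,T)` is a linear differential operator
    (∀ n : ℕ, 1 ≤ n → ∀ t ∈ Ico 0 T, IsLinearDiffOp (lOp a zbar n t T)) ∧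
    -- the functions `𝓛_n(t,T) v₀(t,·)` satisfy the equations of the hierarchy before time `T`
    (∀ n : ℕ, 1 ≤ n →
      SolvesPDE T (generatorTerm a zbar 0) (sourceTerm a zbar (expansionTerm a zbar T (v 0)) n)
        (expansionTerm a zbar T (v 0) n)) ∧
    -- the solution `v_n` of the hierarchy is `𝓛_n(t,T) v₀`
    (∀ n : ℕ, 1 ≤ n →
      (∀ m : ℕ, 1 ≤ m → m ≤ n →
        IsClassicalSolution T (generatorTerm a zbar 0) (sourceTerm a zbar v m) (fun _ => 0)
          (v m)) →
      ∀ t ∈ Ico 0 T, ∀ z : Space d, v n t z = lOp a zbar n t T (v 0 t) z) := by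
  obtain ⟨q, b, h⟩ := exists_isFreezing hT ha_cont hzbar hC
  obtain ⟨B, hq⟩ := q.exists_boundedOn (isCompact_Icc (a := (-1 : ℝ)) (b := T))
  have hI : ∀ {t}, t ∈ Ico 0 T → t ∈ Icc 0 T := fun ht => Ico_subset_Icc_self ht
  obtain ⟨V, hV, hVv⟩ := exists_isRegularSol_eq hT hq (h.covI_posDef hC) hv₀.continuousOn
    hv₀.contDiff hv₀.growth fun t ht z => by
      have hd := hv₀.pde t ht z
      rwa [add_zero, h.generatorTerm_zero (hI ht) (hv₀.contDiff t ht)] at hd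
  have hL : ∀ n, 1 ≤ n → ∀ t ∈ Ico 0 T,
      lOp a zbar n t T (v 0 t) = (smL q b T n t t (V t) : Space d → ℝ) := fun n hn t ht => by
    rw [← hVv t ht, h.lOp_coe (hI ht) hn]
  have hE : ∀ n, ∀ t ∈ Ico 0 T,
      expansionTerm a zbar T (v 0) n t = (smL q b T n t t (V t) : Space d → ℝ) := by
    intro n t ht
    rcases Nat.eq_zero_or_pos n with rfl | hn
    · rw [smL_zero]
      exact (hVv t ht).symm
    · rw [expansionTerm, if_neg hn.ne', hL n hn t ht]
  refine ⟨fun t ht => hVv t ht ▸ (V t).contDiff, fun n hn t ht => ?_, fun n hn t ht z => ?_, ?_⟩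
  · exact isLinearDiffOp_of_weylAlg (mem_weylAlg_of_flowAlg (smL_mem T n t) t)
      (h.lOp_coe (hI ht) hn)
  · have hd := (h.hasDerivAt_smL (b := b) hV hn ht z).hasDerivWithinAt (s := Icc 0 T)
    rw [coe_gen, ← h.generatorTerm_zero (hI ht) (Sm.contDiff_two _), ← hE n t ht] at hd
    simp only [← hE _ t ht] at hd
    -- The expansion agrees with `smL` only before `T`; times near `t` in `[0,T]` are of this kind.
    refine hd.congr_of_eventuallyEq ?_ (congrFun (hE n t ht) z)
    filter_upwards [inter_mem_nhdsWithin (Icc 0 T) (Iio_mem_nhds ht.2)] with s hs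
    exact congrFun (hE n s ⟨hs.1.1, hs.2⟩) z
  · intro n
    -- The source of order `n` involves only lower orders, which are already identified with the
    -- expansion, so the uniqueness lemma applies.
    induction n using Nat.strong_induction_on with
    | _ n ih =>
      intro hn hv t ht z
      rw [hL n hn t ht]
      refine eq_smL_of_isClassicalSolution h hT hq hV hn (fun s hs y => ?_)
        (hv n hn le_rfl) ht z
      refine Finset.sum_congr rfl fun m hm => ?_
      rw [Finset.mem_Icc] at hm
      congr 1
      rcases Nat.eq_zero_or_pos (n - m) with h0 | h0
      · rw [h0, smL_zero]
        exact (hVv s hs).symm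
      · rw [← hL _ h0 s hs]
        exact funext fun y => ih (n - m) (by omega) h0
          (fun k hk hkn => hv k hk (hkn.trans (Nat.sub_le _ _))) s hs y
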